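/- **Setting.** Let $E$ be a locally compact Polish space with its Borel $\sigma$-algebra, $\mathcal B_b(E)$ the bounded measurable functions with the supremum norm (complexified where complex scalars occur), $\mathcal C_b(E)$ the continuous ones among them, $\mathcal M_b(E)$ the bounded signed measures, and $\rightharpoonup$ convergence in $\sigma=\sigma(\mathcal B_b(E),\mathcal M_b(E))$. A kernel operator is an operator $f\mapsto\int f(y)\,k(\cdot,dy)$ with a real signed kernel $k$ satisfying $\sup_x|k|(x,E)<\infty$; these form $\mathcal L(\mathcal B_b(E),\sigma)$. A semigroup of kernel operators of type $(M,\omega)$, $M>0$, $\omega\in\mathbb R$, is a family $(T(t))_{t>0}$ of kernel operators with $T(t+s)=T(t)T(s)$, $\|T(t)\|\le Me^{\omega t}$ and $(t,x)\mapsto T(t)f(x)$ measurable for $f\in\mathcal B_b(E)$. It is a $\mathcal C_b$-semigroup if $T(t)\mathcal C_b(E)\subset\mathcal C_b(E)$ and $T(t)f\rightharpoonup f$ as $t\to0$ for $f\in\mathcal C_b(E)$; it is contractive if it is of type $(1,0)$; an operator is strong Feller if it maps $\mathcal B_b(E)$ into $\mathcal C_b(E)$. The full generator of $T$ is the multivalued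 operator $\hat A=\{(f,g): T(t)f-f=\int_0^tT(s)g\,ds\ \ \forall t>0\}$, and $R(\lambda)f=\int_0^\infty e^{-\lambda t}T(t)f\,dt$ for $\operatorname{Re}\lambda>\omega$. A number $\lambda\in\mathbb C$ is in the resolvent set $\rho(G)$ of a multivalued operator $G$ if $(\lambda-G)^{-1}$ is (the graph of) a bounded everywhere defined operator on $\mathcal B_b(E)$. Let $T$ be a $\mathcal C_b$-semigroup of type $(M,\omega)$ consisting of strong Feller operators, with full generator $\hat A$. Say that a single-valued linear operator $\hat C:D(\hat C)\to\mathcal B_b(E)$ with $D(\hat A)\subset D(\hat C)\subset\mathcal B_b(E)$ is admissible if: for $t>0$ the operator $\hat CT(t)$, initially defined on $D(\hat A)$, extends to a kernel operator on $\mathcal B_b(E)$ (still denoted $\hat CT(t)$); $\hat CR(\lambda)$ is a kernel operator for one real $\lambda>\omega$; $(t,x)\mapsto\hat CT(t)f(x)$ is measurable for all $f\in\mathcal B_b(E)$; and $\|\hat CT(t)\|\le\varphi(t)$ for $t>0$ with some $\varphi$ integrable near $0$. Let $\hat B$ and $\hat B_n$ ($n\in\mathbb N$) be admissible, and assume, for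 real $\lambda$: 1. $\sup_n\|\hat B_nR(\lambda)\|\to0$ as $\lambda\to\infty$; 2. for every $h\in\mathcal B_b(E)$ and all large enough $\lambda$, $\hat B_nR(\lambda)h\rightharpoonup\hat BR(\lambda)h$ as $n\to\infty$; 3. whenever $h_n\in\mathcal B_b(E)$ and $h_n\rightharpoonup0$, then $\hat B_nR(\lambda)h_n\rightharpoonup0$ for all large enough $\lambda$. **Claim.** The operator $\hat A+\hat B$ is the full generator of a $\mathcal C_b$-semigroup $S$ of strong Feller operators, and the following hold. (a) Suppose that every $\lambda\in\mathbb C$ with $\operatorname{Re}\lambda>0$ belongs to $\rho(\hat A+\hat B_n)$ and satisfies $\|(\lambda-(\hat A+\hat B_n))^{-1}\|\le(\operatorname{Re}\lambda)^{-1}$, for all $n\in\mathbb N$. Then every $\lambda\in\mathbb C$ with $\operatorname{Re}\lambda>0$ belongs to $\rho(\hat A+\hat B)$ and $\|(\lambda-(\hat A+\hat B))^{-1}\|\le(\operatorname{Re}\lambda)^{-1}$. In this case every such semigroup $S$ generated by $\hat A+\hat B$ is contractive. (b) Let $\lambda_0\in\mathbb R$ and suppose that every real $\lambda\ge\lambda_0$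 belongs to $\rho(\hat A+\hat B_n)$ and satisfies $(\lambda-(\hat A+\hat B_n))^{-1}\ge0$, for all $n\in\mathbb N$. Then $\rho(\hat A+\hat B)$ contains a half-line $[\lambda_1,\infty)$, and $(\lambda-(\hat A+\hat B))^{-1}\ge0$ for every real $\lambda\ge\lambda_0$ with $[\lambda,\infty)\subset\rho(\hat A+\hat B)$. In this case every such semigroup $S$ generated by $\hat A+\hat B$ is positive. -/

import Mathlib

open MeasureTheory Filter Topology
open scoped ENNReal NNReal

/-! ### Bounded measurable functions and kernel operators -/

/-- The bounded measurable functions on `E`, as a subspace of the space of all bounded complex-valued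
functions with the supremum norm. Scalars are complex, so that the resolvent at a complex number
makes sense; kernels (and hence semigroups and perturbations) are real, see `IsKernel`. -/
def bddMeas (E : Type*) [MeasurableSpace E] : Submodule ℂ (lp (fun _ : E => ℂ) ∞) where
  carrier := {f | Measurable (f : E → ℂ)}
  zero_mem' := by
    change Measurable (fun _ : E => (0 : ℂ))
    exact measurable_const
  add_mem' := by
    intro f g hf hg
    change Measurable (fun x => f x + g x)
    exact Measurable.add hf hg
  smul_mem' := by
    intro c f hf
    change Measurable (fun x => c • f x)
    exact Measurable.const_smul hf c

/-- The Banach space `B_b(E)` of bounded measurable functions with the supremum norm. -/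
abbrev BB (E : Type*) [MeasurableSpace E] : Type _ := ↥(bddMeas E)

instance (E : Type*) [MeasurableSpace E] : CoeFun (BB E) (fun _ => E → ℂ) := ⟨fun f => f.1⟩

/-- The integral of a (bounded measurable) function with respect to a finite signed measure. -/
noncomputable def sintegral {E : Type*} [MeasurableSpace E] (f : E → ℂ) (μ : SignedMeasure E) : ℂ :=
  (∫ y, f y ∂μ.toJordanDecomposition.posPart) - ∫ y, f y ∂μ.toJordanDecomposition.negPart

/-- A (bounded, signed) kernel on `E`. -/
structure IsKernel {E : Type*} [MeasurableSpace E] (k : E → SignedMeasure E) : Prop where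
  measurable : ∀ A : Set E, MeasurableSet A → Measurable fun x => k x A
  bounded : ∃ C : ℝ≥0, ∀ x, (k x).totalVariation Set.univ ≤ C

/-- `T` is the operator associated with a bounded signed kernel, i.e. `T ∈ L(B_b(E), σ)`. -/
def IsKernelOp {E : Type*} [MeasurableSpace E] (T : BB E →L[ℂ] BB E) : Prop :=
  ∃ k : E → SignedMeasure E, IsKernel k ∧ ∀ (f : BB E) (x : E), T f x = sintegral f (k x)

/-- Convergence with respect to the weak topology `σ(B_b(E), M_b(E))`, where `M_b(E)` is the space
of bounded signed measures. -/
def SigmaTendsto {E ι : Type*} [MeasurableSpace E] (F : ι → BB E) (l : Filter ι) (f : BB E) : Prop :=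
  ∀ μ : SignedMeasure E, Tendsto (fun i => sintegral (F i) μ) l (𝓝 (sintegral f μ))

/-- `0 ≤ f`, i.e. `f` is real-valued and nonnegative everywhere. -/
def IsNonneg {E : Type*} [MeasurableSpace E] (f : BB E) : Prop :=
  ∀ x, 0 ≤ (f x).re ∧ (f x).im = 0

/-- The operator `T` is positive. -/
def IsPositiveOp {E : Type*} [MeasurableSpace E] (T : BB E →L[ℂ] BB E) : Prop :=
  ∀ f : BB E, IsNonneg f → IsNonneg (T f)

/-- The strong Feller property: `T` maps `B_b(E)` into `C_b(E)`. -/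
def IsStrongFeller {E : Type*} [MeasurableSpace E] [TopologicalSpace E]
    (T : BB E →L[ℂ] BB E) : Prop :=
  ∀ f : BB E, Continuous (T f : E → ℂ)

/-! ### Semigroups of kernel operators

A semigroup is indexed by `t > 0`; the values of `T : ℝ → _` at `t ≤ 0` play no role. -/

/-- `T` is a semigroup of kernel operators of type `(M, ω)`. -/
structure IsKernelSemigroup {E : Type*} [MeasurableSpace E] (T : ℝ → BB E →L[ℂ] BB E)
    (M ω : ℝ) : Prop where
  kernel : ∀ t, 0 < t → IsKernelOp (T t)
  mul : ∀ s t, 0 < s → 0 < t → ∀ f, T (t + s) f = T t (T s f)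
  pos : 0 < M
  bound : ∀ t, 0 < t → ‖T t‖ ≤ M * Real.exp (ω * t)
  measurable : ∀ f : BB E, Measurable fun p : Set.Ioi (0 : ℝ) × E => T p.1 f p.2

/-- A semigroup of kernel operators that leaves `C_b(E)` invariant and is stochastically continuous
there, i.e. `T(t) f → f` with respect to `σ` as `t → 0` for every `f ∈ C_b(E)`. -/
structure IsCbSemigroup {E : Type*} [MeasurableSpace E] [TopologicalSpace E]
    (T : ℝ → BB E →L[ℂ] BB E) (M ω : ℝ) : Prop extends IsKernelSemigroup T M ω where
  invariant : ∀ t, 0 < t → ∀ f : BB E, Continuous (f : E → ℂ) → Continuous (T t f : E → ℂ)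
  continuous : ∀ f : BB E, Continuous (f : E → ℂ) → SigmaTendsto (fun t => T t f) (𝓝[>] 0) f

/-- The contraction semigroups of kernel operators, i.e. those of type `(1, 0)`. -/
def IsContractionSemigroup {E : Type*} [MeasurableSpace E] (T : ℝ → BB E →L[ℂ] BB E) : Prop :=
  IsKernelSemigroup T 1 0

open Classical in
/-- The Laplace transform `R(z) f = ∫₀^∞ e^{-zt} T(t) f dt` of the semigroup `T` as an element of
`B_b(E)`; for a semigroup of type `(M, ω)` and `Re z > ω` the value is given by `laplace_apply`. -/
noncomputable def laplace {E : Type*} [MeasurableSpace E] (T : ℝ → BB E →L[ℂ] BB E) (z : ℂ)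
    (f : BB E) : BB E :=
  if h : Memℓp (fun x : E => ∫ t in Set.Ioi (0 : ℝ), Complex.exp (-(z * t)) * T t f x) ∞ ∧
      Measurable (fun x : E => ∫ t in Set.Ioi (0 : ℝ), Complex.exp (-(z * t)) * T t f x)
  then ⟨⟨_, h.1⟩, h.2⟩ else 0

theorem laplace_apply {E : Type*} [MeasurableSpace E] {T : ℝ → BB E →L[ℂ] BB E} {M ω : ℝ}
    (hT : IsKernelSemigroup T M ω) {z : ℂ} (hz : ω < z.re) (f : BB E) (x : E) :
    laplace T z f x = ∫ t in Set.Ioi (0 : ℝ), Complex.exp (-(z * t)) * T t f x := by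
  have hb : ∀ x : E, ∀ t ∈ Set.Ioi (0 : ℝ), ‖Complex.exp (-(z * t)) * T t f x‖ ≤
      M * ‖f‖ * Real.exp (-(z.re - ω) * t) := by
    intro x t ht
    have h1 : ‖T t f x‖ ≤ M * Real.exp (ω * t) * ‖f‖ :=
      ((lp.norm_apply_le_norm (by simp) (T t f).1 x).trans ((T t).le_opNorm f)).trans
        (mul_le_mul_of_nonneg_right (hT.bound t ht) (norm_nonneg f))
    have h2 : ‖Complex.exp (-(z * t))‖ = Real.exp (-(z.re * t)) := by
      rw [Complex.norm_exp]; simp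
    rw [norm_mul, h2]
    calc Real.exp (-(z.re * t)) * ‖T t f x‖
        ≤ Real.exp (-(z.re * t)) * (M * Real.exp (ω * t) * ‖f‖) := by gcongr
      _ = M * ‖f‖ * (Real.exp (-(z.re * t)) * Real.exp (ω * t)) := by ring
      _ = M * ‖f‖ * Real.exp (-(z.re - ω) * t) := by rw [← Real.exp_add]; ring_nf
  have hint : IntegrableOn (fun t : ℝ => M * ‖f‖ * Real.exp (-(z.re - ω) * t)) (Set.Ioi 0) :=
    (integrableOn_exp_mul_Ioi (by linarith) 0).const_mul _
  have hm : Measurable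
      (fun x : E => ∫ t in Set.Ioi (0 : ℝ), Complex.exp (-(z * t)) * T t f x) := by
    have h3 : (fun x : E => ∫ t in Set.Ioi (0 : ℝ), Complex.exp (-(z * t)) * T t f x) =
        fun x : E => ∫ t : Set.Ioi (0 : ℝ), Complex.exp (-(z * (t : ℝ))) * T t f x
          ∂(Measure.comap (Subtype.val : Set.Ioi (0 : ℝ) → ℝ) volume) := by
      funext x
      exact (integral_subtype_comap measurableSet_Ioi
        (fun t : ℝ => Complex.exp (-(z * t)) * T t f x)).symm
    rw [h3]
    have h4 : Measurable (fun p : E × Set.Ioi (0 : ℝ) =>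
        Complex.exp (-(z * (p.2 : ℝ))) * T p.2 f p.1) := by
      refine Measurable.mul ?_ ((hT.measurable f).comp measurable_swap)
      fun_prop
    have : SigmaFinite (Measure.comap (Subtype.val : Set.Ioi (0 : ℝ) → ℝ) volume) := by
      refine SigmaFinite.of_map _ measurable_subtype_coe.aemeasurable ?_
      rw [map_comap_subtype_coe measurableSet_Ioi]
      infer_instance
    exact (h4.stronglyMeasurable.integral_prod_right (f := fun (x : E) (t : Set.Ioi (0 : ℝ)) =>
      Complex.exp (-(z * (t : ℝ))) * T t f x)).measurable
  have hl : Memℓp (fun x : E => ∫ t in Set.Ioi (0 : ℝ), Complex.exp (-(z * t)) * T t f x) ∞ := by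
    refine memℓp_infty ⟨∫ t in Set.Ioi (0 : ℝ), M * ‖f‖ * Real.exp (-(z.re - ω) * t), ?_⟩
    rintro _ ⟨x, rfl⟩
    exact norm_integral_le_of_norm_le hint
      ((ae_restrict_iff' measurableSet_Ioi).2 (Eventually.of_forall (hb x)))
  unfold laplace
  rw [dif_pos ⟨hl, hm⟩]

/-! ### Multivalued operators and full generators

A multivalued operator on `B_b(E)` is represented by its graph in `B_b(E) × B_b(E)`. -/

/-- The full generator of `T`: the pairs `(f, g)` with `T(t) f - f = ∫₀ᵗ T(s) g ds` for `t > 0`. -/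
def fullGenerator {E : Type*} [MeasurableSpace E] (T : ℝ → BB E →L[ℂ] BB E) : Set (BB E × BB E) :=
  {p | ∀ t, 0 < t → ∀ x, T t p.1 x - p.1 x = ∫ s in (0 : ℝ)..t, T s p.2 x}

/-- The domain of a multivalued operator. -/
def mdomain {E : Type*} [MeasurableSpace E] (G : Set (BB E × BB E)) : Set (BB E) :=
  {u | ∃ g, (u, g) ∈ G}

/-- The sum of a multivalued operator `G` and a single-valued operator `B`, defined on the
intersection of the two domains. -/
def addOp {E : Type*} [MeasurableSpace E] (G : Set (BB E × BB E)) (B : BB E →ₗ.[ℂ] BB E) :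
    Set (BB E × BB E) :=
  {p | ∃ (u : B.domain) (g : BB E), ((u : BB E), g) ∈ G ∧ p = ((u : BB E), g + B u)}

/-- `Q = (z - G)⁻¹`: the inverse of the multivalued operator `z - G` is the graph of the bounded
everywhere defined operator `Q`. -/
def IsResolventAt {E : Type*} [MeasurableSpace E] (G : Set (BB E × BB E)) (z : ℂ)
    (Q : BB E →L[ℂ] BB E) : Prop :=
  {p : BB E × BB E | ∃ u g, (u, g) ∈ G ∧ p = (z • u - g, u)} = {p | p.2 = Q p.1}

/-- The resolvent set of a multivalued operator. -/
def mresolventSet {E : Type*} [MeasurableSpace E] (G : Set (BB E × BB E)) : Set ℂ :=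
  {z | ∃ Q : BB E →L[ℂ] BB E, IsResolventAt G z Q}

/-- `S` is a `C_b`-semigroup (of some type) consisting of strong Feller operators whose full
generator is `G`. -/
def GeneratesCbStrongFeller {E : Type*} [MeasurableSpace E] [TopologicalSpace E]
    (G : Set (BB E × BB E)) (S : ℝ → BB E →L[ℂ] BB E) : Prop :=
  (∃ M ω : ℝ, IsCbSemigroup S M ω) ∧ (∀ t, 0 < t → IsStrongFeller (S t)) ∧ fullGenerator S = G

open Classical in
/-- The value `B u` for `u ∈ D(B)` (and `0` for other `u`). -/
noncomputable def pval {E : Type*} [MeasurableSpace E] (B : BB E →ₗ.[ℂ] BB E) (u : BB E) : BB E :=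
  if h : u ∈ B.domain then B ⟨u, h⟩ else 0

/-- The standing assumptions on the semigroup `T` of type `(M, ω)` and the perturbation `B` of its
full generator. The operator `K t` is the extension to `B_b(E)` of `B T(t)`, which is initially
defined on the domain of the full generator. -/
structure PerturbationHyp {E : Type*} [MeasurableSpace E] [TopologicalSpace E]
    (T : ℝ → BB E →L[ℂ] BB E) (M ω : ℝ) (B : BB E →ₗ.[ℂ] BB E) : Prop where
  semigroup : IsCbSemigroup T M ω
  strongFeller : ∀ t, 0 < t → IsStrongFeller (T t)
  domain_le : ∀ u ∈ mdomain (fullGenerator T), u ∈ B.domain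
  resolvent : ∃ l : ℝ, ω < l ∧ ∃ Q : BB E →L[ℂ] BB E, IsKernelOp Q ∧
    ∀ f, Q f = pval B (laplace T l f)
  extension : ∃ K : ℝ → BB E →L[ℂ] BB E,
    (∀ t, 0 < t → IsKernelOp (K t)) ∧
    (∀ t, 0 < t → ∀ f ∈ mdomain (fullGenerator T), K t f = pval B (T t f)) ∧
    (∀ f : BB E, Measurable fun p : Set.Ioi (0 : ℝ) × E => K p.1 f p.2) ∧
    ∃ (φ : ℝ → ℝ) (δ : ℝ), 0 < δ ∧ IntegrableOn φ (Set.Ioo 0 δ) ∧ ∀ t, 0 < t → ‖K t‖ ≤ φ t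

/-! ### The space of bounded measurable functions -/

/-! A bounded operator is a kernel operator exactly when it is real and sequentially continuous for
bounded pointwise convergence (`isKernelOp_iff`). This criterion replaces kernels almost everywhere
below: it is stable under composition, under integration in time and under dominated series, and
such an operator is determined by its values on continuous functions.

Generation. Let `K(t)` extend `B T(t)`. For a large weight `l` the number `q = ∫ e^{-lt} ψ(t) dt`,
with `ψ` a majorant of `‖K(t)‖`, is less than 1. The Dyson–Phillips series `S = T + T*K + T*K*K + ⋯`
is then dominated by a geometric series and satisfies `S = T + S*K`. The defect `S(t+u) - S(t)S(u)`
solves the homogeneous equation `W = W*K`, so it vanishes (`Perturbation.dysonSum_add`). Laplace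
transforms turn `S = T + S*K` into `lap S = R (1 - B R)⁻¹`, which is the resolvent of `A + B` by
algebra (`IsRes.addG`). One resolvent determines a multivalued operator, so `A + B` is the full
generator of `S` (`Perturbation.exists_semigroup`).

Approximation. The assumptions on `Bₙ R(l)` give `Bₙ R(l) hₙ → B R(l) h` whenever `hₙ → h` boundedly
and pointwise (`tendsto_apply_of_eventually`). For large `l` the Neumann series of `(1 - Bₙ R(l))⁻¹`
converge uniformly in `n`, so the resolvents of `A + Bₙ` converge boundedly and pointwise to that of
`A + B` (`SFSemigroup.eventually_bTendsto_resolvent`). Norm bounds and positivity therefore pass to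
the limit for large real `l`.

Back to the semigroup. The strong Feller property makes orbits right-continuous at every `t > 0`. A
right-continuous function is nonnegative if its integrals against `e^{-lt}(1 - e^{-t})^m` are, by
Bernstein approximation in the variable `e^{-t}`; the resolvent identity expresses these integrals
through the products `R(l) R(l+1) ⋯ R(l+m)`. This yields positivity (`SFSemigroup.isPos`) and
contractivity (`SFSemigroup.norm_le_one`). A contractive semigroup gives the bound on the whole
half-plane through its Laplace transform, and positivity of the resolvent moves leftwards along an
interval of the resolvent set (`IsPos.continuation`). -/

section Basic

variable {E : Type*} [MeasurableSpace E]

/-- A copy of `BB E` that is opaque to instance search. -/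
def BMFun (E : Type*) [MeasurableSpace E] : Type _ := BB E

noncomputable instance : NormedAddCommGroup (BMFun E) := inferInstanceAs (NormedAddCommGroup (BB E))
noncomputable instance : NormedSpace ℂ (BMFun E) := inferInstanceAs (NormedSpace ℂ (BB E))

instance : FunLike (BMFun E) E ℂ where
  coe f := Subtype.val (Subtype.val f)
  coe_injective := fun _ _ h => Subtype.ext (lp.ext h)

/-- The bounded operators on the space of bounded measurable functions. -/
abbrev Op (E : Type*) [MeasurableSpace E] : Type _ := BMFun E →L[ℂ] BMFun E

/-- A bounded measurable function as an element of `BMFun E`. -/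
def toFn (f : BB E) : BMFun E := f

/-- An element of `BMFun E` as a bounded measurable function. -/
def ofFn (f : BMFun E) : BB E := f

/-- A bounded operator on `BB E` as an operator on `BMFun E`. -/
def toOp (T : BB E →L[ℂ] BB E) : Op E := T

/-- A bounded operator on `BMFun E` as an operator on `BB E`. -/
def ofOp (T : Op E) : BB E →L[ℂ] BB E := T

theorem BMFun.ext {f g : BMFun E} (h : ∀ x, f x = g x) : f = g := DFunLike.ext f g h

theorem BMFun.norm_apply_le (f : BMFun E) (x : E) : ‖f x‖ ≤ ‖f‖ :=
  lp.norm_apply_le_norm (by simp) (ofFn f).1 x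

theorem BMFun.norm_le {f : BMFun E} {C : ℝ} (hC : 0 ≤ C) (h : ∀ x, ‖f x‖ ≤ C) : ‖f‖ ≤ C :=
  lp.norm_le_of_forall_le hC h

theorem BMFun.measurable (f : BMFun E) : Measurable (f : E → ℂ) := f.2

@[simp] theorem BMFun.add_apply (f g : BMFun E) (x : E) : (f + g) x = f x + g x := rfl
@[simp] theorem BMFun.sub_apply (f g : BMFun E) (x : E) : (f - g) x = f x - g x := rfl
@[simp] theorem BMFun.smul_apply (c : ℂ) (f : BMFun E) (x : E) : (c • f) x = c * f x := rfl
@[simp] theorem BMFun.zero_apply (x : E) : (0 : BMFun E) x = 0 := rfl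

/-- A bounded measurable function as an element of `BMFun E`. -/
def BMFun.mk (f : E → ℂ) (hf : Measurable f) (hb : ∃ C, ∀ x, ‖f x‖ ≤ C) : BMFun E :=
  ⟨⟨f, memℓp_infty (by obtain ⟨C, hC⟩ := hb; exact ⟨C, by rintro _ ⟨x, rfl⟩; exact hC x⟩)⟩, hf⟩

@[simp] theorem BMFun.mk_apply (f : E → ℂ) (hf : Measurable f) (hb : ∃ C, ∀ x, ‖f x‖ ≤ C) (x : E) :
    BMFun.mk f hf hb x = f x := rfl

/-- Evaluation at a point. -/
noncomputable def BMFun.eval (x : E) : BMFun E →L[ℂ] ℂ :=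
  LinearMap.mkContinuous
    { toFun := fun f => f x
      map_add' := fun _ _ => rfl
      map_smul' := fun _ _ => rfl } 1 (fun f => by
      rw [one_mul]
      exact BMFun.norm_apply_le f x)

@[simp] theorem BMFun.eval_apply (x : E) (f : BMFun E) : BMFun.eval x f = f x := rfl

theorem BMFun.tendsto_apply {ι : Type*} {l : Filter ι} {F : ι → BMFun E} {f : BMFun E}
    (h : Tendsto F l (𝓝 f)) (x : E) : Tendsto (fun i => F i x) l (𝓝 (f x)) :=
  ((BMFun.eval x).continuous.tendsto f).comp h

/-- Measurability survives uniform limits of sequences, so the space is closed in the complete space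
of bounded functions. Completeness is what lets the Neumann and Dyson–Phillips series converge in
operator norm. -/
instance BMFun.instCompleteSpace : CompleteSpace (BMFun E) := by
  have : IsClosed {f : lp (fun _ : E => ℂ) ∞ | Measurable (f : E → ℂ)} := by
    refine IsSeqClosed.isClosed ?_
    intro u f hu hf
    refine measurable_of_tendsto_metrizable (f := fun n => (u n : E → ℂ)) hu ?_
    rw [tendsto_pi_nhds]
    intro x
    rw [tendsto_iff_norm_sub_tendsto_zero] at hf ⊢
    refine squeeze_zero (fun _ => norm_nonneg _) (fun n => ?_) hf
    exact lp.norm_apply_le_norm (by simp) (u n - f) x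
  exact this.completeSpace_coe

/-- The indicator function of a measurable set. -/
noncomputable def BMFun.indicator (s : Set E) (hs : MeasurableSet s) : BMFun E :=
  BMFun.mk (s.indicator fun _ => 1) (measurable_const.indicator hs)
    ⟨1, fun x => by by_cases h : x ∈ s <;> simp [h]⟩

theorem BMFun.indicator_apply (s : Set E) (hs : MeasurableSet s) (x : E) :
    BMFun.indicator s hs x = s.indicator (fun _ => 1) x := rfl

theorem BMFun.norm_indicator_le (s : Set E) (hs : MeasurableSet s) : ‖BMFun.indicator s hs‖ ≤ 1 :=
  BMFun.norm_le zero_le_one fun x => by by_cases h : x ∈ s <;> simp [BMFun.indicator_apply, h]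

/-- Induction on bounded measurable functions, via pointwise limits of simple functions. -/
theorem bounded_measurable_induction {α : Type*} [MeasurableSpace α] {P : (α → ℂ) → Prop}
    (hind : ∀ (c : ℂ) (s : Set α), MeasurableSet s → P (s.indicator fun _ => c))
    (hadd : ∀ f g : α → ℂ, Measurable f → Measurable g → (∃ C, ∀ x, ‖f x‖ ≤ C) →
      (∃ C, ∀ x, ‖g x‖ ≤ C) → P f → P g → P (fun x => f x + g x))
    (hlim : ∀ (f : ℕ → α → ℂ) (g : α → ℂ) (C : ℝ), (∀ n, Measurable (f n)) →
      (∀ n x, ‖f n x‖ ≤ C) → (∀ n, P (f n)) →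
      (∀ x, Tendsto (fun n => f n x) atTop (𝓝 (g x))) → P g)
    {g : α → ℂ} (hg : Measurable g) {C : ℝ} (hC : ∀ x, ‖g x‖ ≤ C) : P g := by
  have hsimple : ∀ f : SimpleFunc α ℂ, P f := by
    intro f
    induction f using SimpleFunc.induction with
    | const c hs =>
      convert hind c _ hs using 1
      ext x
      simp [SimpleFunc.piecewise_apply, Set.indicator]
    | @add f g _ hf hg =>
      obtain ⟨C, hC⟩ := f.exists_forall_norm_le
      obtain ⟨D, hD⟩ := g.exists_forall_norm_le
      exact hadd f g f.measurable g.measurable ⟨C, hC⟩ ⟨D, hD⟩ hf hg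
  -- On an empty `α` the bound `hC` does not force `C` to be nonnegative.
  have hC0 : 0 ≤ max C 0 := le_max_right _ _
  have hs := hg.stronglyMeasurable
  exact hlim (fun n => hs.approxBounded (max C 0) n) g (max C 0)
    (fun n => (hs.approxBounded (max C 0) n).measurable)
    (fun n x => hs.norm_approxBounded_le hC0 n x) (fun n => hsimple _)
    (fun x => hs.tendsto_approxBounded_of_norm_le ((hC x).trans (le_max_left _ _)))

/-- Pointwise convergence of a bounded sequence of functions. -/
def BTendsto (f : ℕ → BMFun E) (g : BMFun E) : Prop :=
  (∃ C, ∀ n, ‖f n‖ ≤ C) ∧ ∀ x, Tendsto (fun n => f n x) atTop (𝓝 (g x))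

/-- Sequential continuity of an operator for bounded pointwise convergence. -/
def IsBPC (T : Op E) : Prop :=
  ∀ (f : ℕ → BMFun E) (g : BMFun E), BTendsto f g → ∀ x, Tendsto (fun n => T (f n) x) atTop (𝓝 (T g x))

/-- The operator `T` maps real functions to real functions. -/
def IsRealOp (T : Op E) : Prop :=
  ∀ f : BMFun E, (∀ x, (f x).im = 0) → ∀ x, (T f x).im = 0

theorem BTendsto.map {T : Op E} (hT : IsBPC T) {f : ℕ → BMFun E} {g : BMFun E}
    (h : BTendsto f g) : BTendsto (fun n => T (f n)) (T g) := by
  obtain ⟨C, hC⟩ := h.1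
  exact ⟨⟨‖T‖ * C, fun n => (T.le_opNorm _).trans (by gcongr; exact hC n)⟩, hT f g h⟩

theorem IsBPC.zero : IsBPC (0 : Op E) := fun _ _ _ _ => tendsto_const_nhds

theorem IsBPC.comp {S T : Op E} (hS : IsBPC S) (hT : IsBPC T) : IsBPC (S ∘L T) :=
  fun _ _ h => hS _ _ (h.map hT)

theorem IsBPC.add {S T : Op E} (hS : IsBPC S) (hT : IsBPC T) : IsBPC (S + T) :=
  fun f g h x => (hS f g h x).add (hT f g h x)

theorem IsBPC.smul {S : Op E} (hS : IsBPC S) (c : ℂ) : IsBPC (c • S) :=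
  fun f g h x => (hS f g h x).const_mul c

theorem IsRealOp.zero : IsRealOp (0 : Op E) := fun _ _ _ => rfl

theorem IsRealOp.comp {S T : Op E} (hS : IsRealOp S) (hT : IsRealOp T) :
    IsRealOp (S ∘L T) := fun f hf => hS _ (hT f hf)

/-! ### Kernel operators -/

theorem BMFun.integrable (f : BMFun E) (μ : Measure E) [IsFiniteMeasure μ] :
    Integrable (fun x => f x) μ :=
  Integrable.of_bound f.measurable.aestronglyMeasurable ‖f‖
    (Eventually.of_forall f.norm_apply_le)

/-- Dominated convergence for both parts of the Jordan decomposition. The filter is general because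
stochastic continuity needs it along `𝓝[>] 0`, not only along sequences. -/
theorem tendsto_sintegral {ι : Type*} {l : Filter ι} [l.IsCountablyGenerated] {F : ι → BMFun E}
    {g : BMFun E} {C : ℝ} (hC : ∀ᶠ i in l, ‖F i‖ ≤ C)
    (h : ∀ x, Tendsto (fun i => F i x) l (𝓝 (g x))) :
    SigmaTendsto (fun i => ofFn (F i)) l (ofFn g) := by
  intro μ
  have key : ∀ (ν : Measure E) [IsFiniteMeasure ν],
      Tendsto (fun i => ∫ y, F i y ∂ν) l (𝓝 (∫ y, g y ∂ν)) := by
    intro ν _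
    refine tendsto_integral_filter_of_dominated_convergence (fun _ => C)
      (Eventually.of_forall fun i => (F i).measurable.aestronglyMeasurable)
      (hC.mono fun i hi => Eventually.of_forall fun x => ((F i).norm_apply_le x).trans hi)
      (integrable_const _) (Eventually.of_forall h)
  exact (key _).sub (key _)

theorem BTendsto.sigmaTendsto {f : ℕ → BMFun E} {g : BMFun E} (h : BTendsto f g) :
    SigmaTendsto (fun n => ofFn (f n)) atTop (ofFn g) := by
  obtain ⟨C, hC⟩ := h.1
  exact tendsto_sintegral (Eventually.of_forall hC) h.2

theorem sintegral_dirac (f : BMFun E) (x : E) :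
    sintegral f (Measure.dirac x).toSignedMeasure = f x := by
  have h : (Measure.dirac x).toSignedMeasure.toJordanDecomposition =
      ⟨Measure.dirac x, 0, Measure.MutuallySingular.zero_right⟩ := by
    rw [SignedMeasure.toJordanDecomposition_eq]
    simp [JordanDecomposition.toSignedMeasure]
  rw [sintegral, h]
  simp [integral_dirac' _ _ f.measurable.stronglyMeasurable]

/-- Point masses are admissible test measures. Only the pointwise content of the weak convergence
hypotheses is ever used; norm bounds come from elsewhere. -/
theorem SigmaTendsto.apply {ι : Type*} {l : Filter ι} {F : ι → BB E} {g : BB E}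
    (h : SigmaTendsto F l g) (x : E) : Tendsto (fun i => F i x) l (𝓝 (g x)) := by
  have key : ∀ f : BB E, sintegral f (Measure.dirac x).toSignedMeasure = f x :=
    fun f => sintegral_dirac (toFn f) x
  simpa only [key] using h (Measure.dirac x).toSignedMeasure

theorem IsKernelOp.isBPC {T : BB E →L[ℂ] BB E} (hT : IsKernelOp T) : IsBPC (toOp T) := by
  obtain ⟨k, -, hk⟩ := hT
  intro f g h x
  have hk' : ∀ f : BMFun E, toOp T f x = sintegral f (k x) := fun f => hk (ofFn f) x
  simp only [hk']
  exact h.sigmaTendsto (k x)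

theorem sintegral_im_eq_zero {f : BMFun E} (hf : ∀ x, (f x).im = 0) (μ : SignedMeasure E) :
    (sintegral f μ).im = 0 := by
  have key : ∀ (ν : Measure E) [IsFiniteMeasure ν], (∫ y, f y ∂ν).im = 0 := by
    intro ν _
    have := integral_im (f.integrable ν)
    simp only [RCLike.im_to_complex] at this
    rw [← this]
    simp [hf]
  rw [sintegral, Complex.sub_im, key, key, sub_zero]

theorem IsKernelOp.isRealOp {T : BB E →L[ℂ] BB E} (hT : IsKernelOp T) : IsRealOp (toOp T) := by
  obtain ⟨k, -, hk⟩ := hT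
  intro f hf x
  rw [show toOp T f x = sintegral f (k x) from hk (ofFn f) x]
  exact sintegral_im_eq_zero hf _

/-- Two operators that are continuous for bounded pointwise convergence coincide at `x` as soon as
they coincide there on the indicator functions. -/
theorem functional_ext {F G : BMFun E → ℂ} (hFa : ∀ f g, F (f + g) = F f + F g)
    (hGa : ∀ f g, G (f + g) = G f + G g) (hFs : ∀ (c : ℂ) f, F (c • f) = c * F f)
    (hGs : ∀ (c : ℂ) f, G (c • f) = c * G f)
    (hF : ∀ f g, BTendsto f g → Tendsto (fun n => F (f n)) atTop (𝓝 (F g)))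
    (hG : ∀ f g, BTendsto f g → Tendsto (fun n => G (f n)) atTop (𝓝 (G g)))
    (h : ∀ s hs, F (BMFun.indicator s hs) = G (BMFun.indicator s hs)) (f : BMFun E) : F f = G f := by
  refine bounded_measurable_induction (P := fun u => ∀ f : BMFun E, (f : E → ℂ) = u → F f = G f)
    ?_ ?_ ?_ f.measurable f.norm_apply_le f rfl
  · intro c s hs f hf
    have : f = c • BMFun.indicator s hs := BMFun.ext fun x => by
      rw [hf, BMFun.smul_apply, BMFun.indicator_apply]
      by_cases hx : x ∈ s <;> simp [hx]
    rw [this, hFs, hGs, h]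
  · intro u v hu hv hub hvb hPu hPv f hf
    have : f = BMFun.mk u hu hub + BMFun.mk v hv hvb := BMFun.ext fun x => by rw [hf]; rfl
    rw [this, hFa, hGa, hPu _ rfl, hPv _ rfl]
  · intro u v C hu hC hP hlim f hf
    have hb : BTendsto (fun n => BMFun.mk (u n) (hu n) ⟨C, hC n⟩) f := by
      refine ⟨⟨max C 0, fun n => BMFun.norm_le (le_max_right _ _) fun x =>
        (hC n x).trans (le_max_left _ _)⟩, fun x => ?_⟩
      rw [hf]
      exact hlim x
    refine tendsto_nhds_unique (hF _ _ hb) ?_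
    have h' : ∀ n, F (BMFun.mk (u n) (hu n) ⟨C, hC n⟩) = G (BMFun.mk (u n) (hu n) ⟨C, hC n⟩) :=
      fun n => hP n _ rfl
    simp only [h']
    exact hG _ _ hb

theorem sum_indicator_apply {f : ℕ → Set E} (hf : ∀ i, MeasurableSet (f i))
    (hd : Pairwise (Function.onFun Disjoint f)) (I : Finset ℕ) (x : E) :
    (∑ i ∈ I, BMFun.indicator (f i) (hf i)) x =
      (⋃ i ∈ I, f i).indicator (fun _ => (1 : ℂ)) x := by
  have := map_sum (BMFun.eval x) (fun i => BMFun.indicator (f i) (hf i)) I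
  simp only [BMFun.eval_apply, BMFun.indicator_apply] at this
  rw [this, Finset.indicator_biUnion_apply]
  exact fun i _ j _ hij => hd hij

theorem norm_sum_indicator_le {f : ℕ → Set E} (hf : ∀ i, MeasurableSet (f i))
    (hd : Pairwise (Function.onFun Disjoint f)) (I : Finset ℕ) :
    ‖∑ i ∈ I, BMFun.indicator (f i) (hf i)‖ ≤ 1 := by
  refine BMFun.norm_le zero_le_one fun x => ?_
  rw [sum_indicator_apply hf hd]
  by_cases h : x ∈ ⋃ i ∈ I, f i
  · simp [Set.indicator_of_mem h]
  · simp [Set.indicator_of_notMem h]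

/-- Partial sums are indicators of finite unions, hence bounded by 1. Through this, sequential
continuity of an operator becomes countable additivity of a set function. -/
theorem BTendsto.iUnion {f : ℕ → Set E} (hf : ∀ i, MeasurableSet (f i))
    (hd : Pairwise (Function.onFun Disjoint f)) :
    BTendsto (fun n => ∑ i ∈ Finset.range n, BMFun.indicator (f i) (hf i))
      (BMFun.indicator (⋃ i, f i) (MeasurableSet.iUnion hf)) := by
  refine ⟨⟨1, fun n => norm_sum_indicator_le hf hd _⟩, fun x => ?_⟩
  simp only [sum_indicator_apply hf hd, BMFun.indicator_apply]
  by_cases hx : x ∈ ⋃ i, f i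
  · obtain ⟨j, hj⟩ := Set.mem_iUnion.1 hx
    refine tendsto_const_nhds.congr' ?_
    filter_upwards [eventually_gt_atTop j] with n hn
    rw [Set.indicator_of_mem hx, Set.indicator_of_mem]
    exact Set.mem_biUnion (Finset.mem_coe.2 (Finset.mem_range.2 hn)) hj
  · refine tendsto_const_nhds.congr fun n => ?_
    rw [Set.indicator_of_notMem hx, Set.indicator_of_notMem]
    simp only [Set.mem_iUnion, not_exists] at hx ⊢
    exact fun i _ => hx i

/-- Splitting a finite index set by the sign of the terms gives two sums of absolute value at most
`C`, so the absolute values sum to at most `2 * C`. -/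
theorem summable_of_abs_sum_le {f : ℕ → ℝ} {C : ℝ} (h : ∀ I : Finset ℕ, |∑ i ∈ I, f i| ≤ C) :
    Summable f := by
  refine Summable.of_abs (summable_of_sum_le (c := 2 * C) (fun _ => abs_nonneg _) fun I => ?_)
  rw [← Finset.sum_filter_add_sum_filter_not I (fun i => 0 ≤ f i)]
  have h1 : ∑ i ∈ I with 0 ≤ f i, |f i| = ∑ i ∈ I with 0 ≤ f i, f i :=
    Finset.sum_congr rfl fun i hi => abs_of_nonneg (Finset.mem_filter.1 hi).2
  have h2 : ∑ i ∈ I with ¬ 0 ≤ f i, |f i| = -∑ i ∈ I with ¬ 0 ≤ f i, f i := by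
    rw [← Finset.sum_neg_distrib]
    exact Finset.sum_congr rfl fun i hi => abs_of_neg (not_le.1 (Finset.mem_filter.1 hi).2)
  rw [h1, h2]
  have h3 := (abs_le.1 (h {i ∈ I | 0 ≤ f i})).2
  have h4 := (abs_le.1 (h {i ∈ I | ¬ 0 ≤ f i})).1
  linarith

open Classical in
/-- The signed measure `A ↦ Re T 1_A (x)`. -/
noncomputable def opMeasure (T : Op E) (hT : IsBPC T) (x : E) : SignedMeasure E where
  measureOf' A := if hA : MeasurableSet A then (T (BMFun.indicator A hA) x).re else 0
  empty' := by
    have : BMFun.indicator (∅ : Set E) MeasurableSet.empty = 0 := BMFun.ext fun y => by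
      simp [BMFun.indicator_apply]
    simp [this]
  not_measurable' A hA := by simp [hA]
  m_iUnion' f hf hd := by
    have hsum : ∀ I : Finset ℕ, ∑ i ∈ I, (T (BMFun.indicator (f i) (hf i)) x).re =
        (T (∑ i ∈ I, BMFun.indicator (f i) (hf i)) x).re := by
      intro I
      have := map_sum (BMFun.eval x ∘L T) (fun i => BMFun.indicator (f i) (hf i)) I
      simp only [ContinuousLinearMap.comp_apply, BMFun.eval_apply] at this
      rw [this, Complex.re_sum]
    simp only [hf, MeasurableSet.iUnion hf, dif_pos]
    -- Countable additivity of a vector measure is an unconditional sum. Boundedness of all finite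
    -- sums gives summability, after which convergence along `Finset.range n` is enough.
    have hsumm : Summable fun i => (T (BMFun.indicator (f i) (hf i)) x).re := by
      refine summable_of_abs_sum_le (C := ‖T‖ * 1) fun I => ?_
      rw [hsum]
      refine (Complex.abs_re_le_norm _).trans ((BMFun.norm_apply_le _ x).trans ?_)
      exact T.le_opNorm_of_le (norm_sum_indicator_le hf hd I)
    refine (hsumm.hasSum_iff_tendsto_nat).2 ?_
    simp only [hsum]
    exact (Complex.continuous_re.tendsto _).comp (hT _ _ (BTendsto.iUnion hf hd) x)

theorem opMeasure_apply (T : Op E) (hT : IsBPC T) (x : E) {A : Set E} (hA : MeasurableSet A) :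
    opMeasure T hT x A = (T (BMFun.indicator A hA) x).re :=
  dif_pos hA

theorem sintegral_indicator (μ : SignedMeasure E) {A : Set E} (hA : MeasurableSet A) :
    sintegral (BMFun.indicator A hA) μ = (μ A : ℂ) := by
  have key : ∀ (ν : Measure E) [IsFiniteMeasure ν],
      ∫ y, BMFun.indicator A hA y ∂ν = (ν.real A : ℂ) := by
    intro ν _
    simp only [BMFun.indicator_apply]
    rw [integral_indicator hA]
    simp
  have h : μ A = μ.toJordanDecomposition.posPart.real A - μ.toJordanDecomposition.negPart.real A := by
    conv_lhs => rw [← μ.toSignedMeasure_toJordanDecomposition]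
    rw [JordanDecomposition.toSignedMeasure, Measure.toSignedMeasure_sub_apply hA]
  rw [sintegral, key, key, h]
  push_cast
  rfl

theorem sintegral_add (f g : BMFun E) (μ : SignedMeasure E) :
    sintegral (f + g : BMFun E) μ = sintegral f μ + sintegral g μ := by
  simp only [sintegral, BMFun.add_apply]
  rw [integral_add (f.integrable _) (g.integrable _), integral_add (f.integrable _) (g.integrable _)]
  ring

theorem sintegral_smul (c : ℂ) (f : BMFun E) (μ : SignedMeasure E) :
    sintegral (c • f : BMFun E) μ = c * sintegral f μ := by
  simp only [sintegral, BMFun.smul_apply, integral_const_mul]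
  ring

/-- On a Hahn decomposition the two Jordan parts have masses `μ(P)` and `-μ(N)`, each at most `‖T‖`;
hence the factor 2. -/
theorem totalVariation_opMeasure_le (T : Op E) (hT : IsBPC T) (x : E) :
    (opMeasure T hT x).totalVariation Set.univ ≤ (2 * ‖T‖₊ : ℝ≥0) := by
  set μ := opMeasure T hT x
  have hb : ∀ A, |μ A| ≤ ‖T‖ := by
    intro A
    by_cases hA : MeasurableSet A
    · rw [opMeasure_apply T hT x hA]
      refine (Complex.abs_re_le_norm _).trans ((BMFun.norm_apply_le _ x).trans ?_)
      exact (T.le_opNorm_of_le (BMFun.norm_indicator_le A hA)).trans_eq (mul_one _)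
    · rw [VectorMeasure.not_measurable _ hA, abs_zero]
      exact norm_nonneg _
  obtain ⟨i, hi, hi₂, hi₃, hp, hn⟩ := μ.toJordanDecomposition_spec
  have h1 : μ.toJordanDecomposition.posPart Set.univ ≤ (‖T‖₊ : ℝ≥0) := by
    rw [hp, SignedMeasure.toMeasureOfZeroLE_apply _ _ _ MeasurableSet.univ]
    refine ENNReal.coe_le_coe.2 (NNReal.coe_le_coe.1 ?_)
    exact (le_abs_self _).trans (hb _)
  have h2 : μ.toJordanDecomposition.negPart Set.univ ≤ (‖T‖₊ : ℝ≥0) := by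
    rw [hn, SignedMeasure.toMeasureOfLEZero_apply _ _ _ MeasurableSet.univ]
    refine ENNReal.coe_le_coe.2 (NNReal.coe_le_coe.1 ?_)
    exact (neg_le_abs _).trans (hb _)
  rw [SignedMeasure.totalVariation, Measure.add_apply]
  refine (add_le_add h1 h2).trans_eq ?_
  push_cast
  ring

/-- A bounded operator is a kernel operator if and only if it is real and sequentially continuous
for bounded pointwise convergence. -/
theorem isKernelOp_iff {T : BB E →L[ℂ] BB E} :
    IsKernelOp T ↔ IsBPC (toOp T) ∧ IsRealOp (toOp T) := by
  refine ⟨fun h => ⟨h.isBPC, h.isRealOp⟩, fun ⟨hT, hR⟩ => ?_⟩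
  refine ⟨opMeasure (toOp T) hT, ⟨fun A hA => ?_, ⟨2 * ‖toOp T‖₊, fun x => ?_⟩⟩, fun f x => ?_⟩
  · simp only [opMeasure_apply _ hT _ hA]
    exact Complex.measurable_re.comp (BMFun.measurable _)
  · exact totalVariation_opMeasure_le _ hT x
  · refine functional_ext (F := fun f => toOp T f x) (G := fun f => sintegral f (opMeasure _ hT x))
      ?_ ?_ ?_ ?_ ?_ ?_ ?_ (toFn f)
    · intro f g
      rw [map_add, BMFun.add_apply]
    · exact fun f g => sintegral_add f g _
    · intro c f
      rw [map_smul, BMFun.smul_apply]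
    · exact fun c f => sintegral_smul c f _
    · exact fun f g h => hT f g h x
    · exact fun f g h => h.sigmaTendsto _
    · intro s hs
      rw [sintegral_indicator, opMeasure_apply _ hT x hs]
      -- The signed measure records real parts only; the imaginary part vanishes because the
      -- operator is real.
      refine Complex.ext (by simp) ?_
      rw [hR _ fun y => ?_]
      · simp
      · by_cases hy : y ∈ s <;> simp [BMFun.indicator_apply, hy]

end Basic

/-! ### Kernel operators are determined by continuous functions -/

section Determination

variable {E : Type*} [MeasurableSpace E]

theorem BMFun.indicator_compl {s : Set E} (hs : MeasurableSet s) :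
    BMFun.indicator sᶜ hs.compl = BMFun.indicator Set.univ MeasurableSet.univ -
      BMFun.indicator s hs := BMFun.ext fun x => by
  by_cases h : x ∈ s <;> simp [BMFun.indicator_apply, h]

/-- Operators that are sequentially continuous for bounded pointwise convergence are determined by
their action on continuous functions. -/
theorem IsBPC.ext_of_continuous [TopologicalSpace E] [HasOuterApproxClosed E] [BorelSpace E]
    {S T : Op E} (hS : IsBPC S) (hT : IsBPC T)
    (h : ∀ f : BMFun E, Continuous f → S f = T f) : S = T := by
  refine ContinuousLinearMap.ext fun f => BMFun.ext fun x => ?_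
  refine functional_ext (F := fun f => S f x) (G := fun f => T f x) ?_ ?_ ?_ ?_
    (fun f g h => hS f g h x) (fun f g h => hT f g h x) ?_ f
  · intro f g
    rw [map_add, BMFun.add_apply]
  · intro f g
    rw [map_add, BMFun.add_apply]
  · intro f g
    rw [map_smul, BMFun.smul_apply]
  · intro f g
    rw [map_smul, BMFun.smul_apply]
  have huniv : S (BMFun.indicator Set.univ MeasurableSet.univ) x =
      T (BMFun.indicator Set.univ MeasurableSet.univ) x := by
    rw [h]
    refine continuous_const (y := (1 : ℂ)) |>.congr fun y => ?_
    simp [BMFun.indicator_apply]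
  -- Closed sets form a generating π-system, and the indicator of a closed set is a bounded
  -- pointwise limit of continuous functions. Complements are handled by `huniv`, disjoint unions by
  -- sequential continuity.
  refine MeasurableSpace.induction_on_inter
    ((BorelSpace.measurable_eq (α := E)).trans borel_eq_generateFrom_isClosed) isPiSystem_isClosed
    ?_ ?_ ?_ ?_
  · have : BMFun.indicator (∅ : Set E) MeasurableSet.empty = 0 := BMFun.ext fun y => by
      simp [BMFun.indicator_apply]
    simp [this]
  · intro F hF
    have hF : IsClosed F := hF
    have hFm : MeasurableSet F := hF.measurableSet
    have hc : ∀ n, Continuous fun y => ((hF.apprSeq n y : ℝ≥0) : ℂ) := fun n =>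
      Complex.continuous_ofReal.comp (NNReal.continuous_coe.comp (hF.apprSeq n).continuous)
    have hle : ∀ n y, ‖((hF.apprSeq n y : ℝ≥0) : ℂ)‖ ≤ 1 := fun n y => by
      have := HasOuterApproxClosed.apprSeq_apply_le_one hF n y
      have h2 : ((hF.apprSeq n y : ℝ≥0) : ℝ) ≤ 1 := this
      change ‖(((hF.apprSeq n y : ℝ≥0) : ℝ) : ℂ)‖ ≤ 1
      rwa [Complex.norm_real, Real.norm_of_nonneg (NNReal.coe_nonneg _)]
    have hb : BTendsto (fun n => BMFun.mk _ (hc n).measurable ⟨1, hle n⟩)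
        (BMFun.indicator F hFm) := by
      refine ⟨⟨1, fun n => BMFun.norm_le zero_le_one (hle n)⟩, fun y => ?_⟩
      have h1 := (tendsto_pi_nhds.1 (HasOuterApproxClosed.tendsto_apprSeq hF)) y
      have h2 := (Complex.continuous_ofReal.tendsto _).comp
        ((NNReal.continuous_coe.tendsto _).comp h1)
      have h3 : (((F.indicator (fun _ => (1 : ℝ≥0)) y : ℝ≥0) : ℝ) : ℂ) =
          BMFun.indicator F hFm y := by
        by_cases hy : y ∈ F <;> simp [BMFun.indicator_apply, hy]
      rw [← h3]
      exact h2
    refine tendsto_nhds_unique (hS _ _ hb x) ?_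
    have h' : ∀ n, S (BMFun.mk _ (hc n).measurable ⟨1, hle n⟩) =
      T (BMFun.mk _ (hc n).measurable ⟨1, hle n⟩) := fun n => h _ (hc n)
    simp only [h']
    exact hT _ _ hb x
  · intro t ht hP
    rw [BMFun.indicator_compl ht, map_sub, map_sub, BMFun.sub_apply, BMFun.sub_apply, huniv, hP]
  · intro f hd hf hP
    have h1 := hS _ _ (BTendsto.iUnion hf hd) x
    have h2 := hT _ _ (BTendsto.iUnion hf hd) x
    refine tendsto_nhds_unique h1 (h2.congr fun n => ?_)
    have e1 := map_sum (BMFun.eval x ∘L T) (fun i => BMFun.indicator (f i) (hf i)) (Finset.range n)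
    have e2 := map_sum (BMFun.eval x ∘L S) (fun i => BMFun.indicator (f i) (hf i)) (Finset.range n)
    simp only [ContinuousLinearMap.comp_apply, BMFun.eval_apply] at e1 e2
    rw [e1, e2]
    exact Finset.sum_congr rfl fun i _ => (hP i).symm

end Determination

/-! ### Joint measurability of operators applied to functions -/

section Joint

variable {E : Type*} [MeasurableSpace E] {α : Type*} [MeasurableSpace α]

/-- The section at `a` of a function on a product. -/
noncomputable def BMFun.section' (g : α × E → ℂ) (hg : Measurable g) (C : ℝ)
    (hC : ∀ p, ‖g p‖ ≤ C) (a : α) : BMFun E :=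
  BMFun.mk (fun x => g (a, x)) (hg.comp measurable_prodMk_left) ⟨C, fun x => hC (a, x)⟩

/-- A monotone class argument: for the indicator of a rectangle `A ×ˢ B` the expression factors as
`1_A(a) · P(a) 1_B(x)`, and sequential continuity of each `P a` carries the claim to limits. -/
theorem measurable_apply_of_bounded {P : α → Op E} (hP : ∀ a, IsBPC (P a))
    (hm : ∀ f, Measurable fun p : α × E => P p.1 f p.2) {g : α × E → ℂ} (hg : Measurable g)
    {C : ℝ} (hC : ∀ p, ‖g p‖ ≤ C) (h : α → BMFun E) (hh : ∀ a x, h a x = g (a, x)) :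
    Measurable fun p : α × E => P p.1 (h p.1) p.2 := by
  refine bounded_measurable_induction (P := fun g => ∀ h : α → BMFun E,
    (∀ a x, h a x = g (a, x)) → Measurable fun p : α × E => P p.1 (h p.1) p.2)
    ?_ ?_ ?_ hg hC h hh
  · intro c s hs h hh
    have hsec : ∀ a, MeasurableSet (Prod.mk a ⁻¹' s) := fun a => measurable_prodMk_left hs
    have key : Measurable fun p : α × E => P p.1 (BMFun.indicator _ (hsec p.1)) p.2 := by
      clear hh
      refine MeasurableSpace.induction_on_inter (C := fun s (hs : MeasurableSet s) =>
        Measurable fun p : α × E => P p.1 (BMFun.indicator (Prod.mk p.1 ⁻¹' s)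
          (measurable_prodMk_left hs)) p.2) generateFrom_prod.symm isPiSystem_prod
        ?_ ?_ ?_ ?_ s hs
      · have : ∀ a : α, BMFun.indicator (Prod.mk a ⁻¹' (∅ : Set (α × E)))
          (measurable_prodMk_left MeasurableSet.empty) = 0 := fun a => BMFun.ext fun y => by
          simp [BMFun.indicator_apply]
        simp only [this, map_zero]
        exact measurable_const
      · rintro _ ⟨A, hA, B, hB, rfl⟩
        have hA : MeasurableSet A := hA
        have hB : MeasurableSet B := hB
        have : ∀ p : α × E, P p.1 (BMFun.indicator (Prod.mk p.1 ⁻¹' (A ×ˢ B))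
            (measurable_prodMk_left (hA.prod hB))) p.2 =
            A.indicator (fun _ => (1 : ℂ)) p.1 * P p.1 (BMFun.indicator B hB) p.2 := by
          intro p
          have : BMFun.indicator (Prod.mk p.1 ⁻¹' (A ×ˢ B))
            (measurable_prodMk_left (hA.prod hB)) =
              A.indicator (fun _ => (1 : ℂ)) p.1 • BMFun.indicator B hB := BMFun.ext fun y => by
            by_cases h1 : p.1 ∈ A <;> by_cases h2 : y ∈ B <;> simp [BMFun.indicator_apply, h1, h2]
          rw [this, map_smul, BMFun.smul_apply]
        simp only [this]
        exact ((measurable_const.indicator hA).comp measurable_fst).mul (hm _)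
      · intro t ht hPt
        have : ∀ p : α × E, P p.1 (BMFun.indicator (Prod.mk p.1 ⁻¹' tᶜ)
            (measurable_prodMk_left ht.compl)) p.2 =
            P p.1 (BMFun.indicator Set.univ MeasurableSet.univ) p.2 -
              P p.1 (BMFun.indicator (Prod.mk p.1 ⁻¹' t) (measurable_prodMk_left ht)) p.2 := by
          intro p
          rw [← BMFun.sub_apply, ← map_sub, ← BMFun.indicator_compl]
          rfl
        simp only [this]
        exact (hm _).sub hPt
      · intro f hd hf hPf
        have hf' : ∀ (a : α) (i : ℕ), MeasurableSet (Prod.mk a ⁻¹' f i) :=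
          fun a i => measurable_prodMk_left (hf i)
        refine measurable_of_tendsto_metrizable (f := fun n (p : α × E) =>
          ∑ i ∈ Finset.range n, P p.1 (BMFun.indicator (Prod.mk p.1 ⁻¹' f i) (hf' p.1 i)) p.2)
          (fun n => Finset.measurable_sum _ fun i _ => hPf i) ?_
        rw [tendsto_pi_nhds]
        intro p
        have hb := BTendsto.iUnion (hf' p.1) fun i j hij => (hd hij).preimage _
        have h1 := hP p.1 _ _ hb p.2
        have e1 : BMFun.indicator (⋃ i, Prod.mk p.1 ⁻¹' f i) (MeasurableSet.iUnion (hf' p.1)) =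
            BMFun.indicator (Prod.mk p.1 ⁻¹' ⋃ i, f i)
              (measurable_prodMk_left (MeasurableSet.iUnion hf)) := BMFun.ext fun y => by
          simp only [BMFun.indicator_apply, Set.preimage_iUnion]
        rw [e1] at h1
        refine h1.congr fun n => ?_
        have e2 := map_sum (BMFun.eval p.2 ∘L P p.1)
          (fun i => BMFun.indicator _ (hf' p.1 i)) (Finset.range n)
        simpa only [ContinuousLinearMap.comp_apply, BMFun.eval_apply] using e2
    have : ∀ p : α × E, P p.1 (h p.1) p.2 =
        c * P p.1 (BMFun.indicator _ (hsec p.1)) p.2 := by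
      intro p
      have : h p.1 = c • BMFun.indicator _ (hsec p.1) := BMFun.ext fun y => by
        rw [hh, BMFun.smul_apply, BMFun.indicator_apply]
        by_cases hy : (p.1, y) ∈ s <;> simp [hy]
      rw [this, map_smul, BMFun.smul_apply]
    simp only [this]
    exact key.const_mul c
  · rintro u v hu hv ⟨C, hC⟩ ⟨D, hD⟩ hPu hPv h hh
    have : ∀ p : α × E, P p.1 (h p.1) p.2 = P p.1 (BMFun.section' u hu C hC p.1) p.2 +
        P p.1 (BMFun.section' v hv D hD p.1) p.2 := by
      intro p
      rw [← BMFun.add_apply, ← map_add]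
      congr 2
      exact BMFun.ext fun y => hh p.1 y
    simp only [this]
    exact (hPu _ fun _ _ => rfl).add (hPv _ fun _ _ => rfl)
  · intro u v C hu hC hPu hlim h hh
    refine measurable_of_tendsto_metrizable (f := fun n (p : α × E) =>
      P p.1 (BMFun.section' (u n) (hu n) C (hC n) p.1) p.2)
      (fun n => hPu n _ fun _ _ => rfl) ?_
    rw [tendsto_pi_nhds]
    intro p
    refine hP p.1 _ _ ⟨⟨max C 0, fun n => BMFun.norm_le (le_max_right _ _) fun x =>
        (hC n _).trans (le_max_left _ _)⟩, fun x => ?_⟩ p.2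
    rw [hh]
    exact hlim _

/-- Joint measurability of `(a, x) ↦ P a (h a) x` for a measurable family of kernel operators and a
jointly measurable family of functions. -/
theorem measurable_apply {P : α → Op E} (hP : ∀ a, IsBPC (P a))
    (hm : ∀ f, Measurable fun p : α × E => P p.1 f p.2) {h : α → BMFun E}
    (hh : Measurable fun p : α × E => h p.1 p.2) :
    Measurable fun p : α × E => P p.1 (h p.1) p.2 := by
  -- The norms `‖h a‖` may be unbounded in `a`, so `h` is truncated at height `n`. For each fixed
  -- `a` the truncations are bounded by `‖h a‖` and converge pointwise to `h a`.
  have hs : ∀ n : ℕ, MeasurableSet {p : α × E | ‖h p.1 p.2‖ ≤ n} := fun n =>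
    measurableSet_le hh.norm measurable_const
  have hg : ∀ n : ℕ, Measurable
      ({p : α × E | ‖h p.1 p.2‖ ≤ n}.indicator fun p => h p.1 p.2) := fun n => hh.indicator (hs n)
  have hC : ∀ (n : ℕ) (p : α × E),
      ‖{p : α × E | ‖h p.1 p.2‖ ≤ n}.indicator (fun p => h p.1 p.2) p‖ ≤ n := by
    intro n p
    by_cases hp : ‖h p.1 p.2‖ ≤ n
    · rw [Set.indicator_of_mem (by exact hp)]
      exact hp
    · rw [Set.indicator_of_notMem (by exact hp), norm_zero]
      exact n.cast_nonneg
  refine measurable_of_tendsto_metrizable (f := fun n (p : α × E) =>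
    P p.1 (BMFun.section' _ (hg n) n (hC n) p.1) p.2)
    (fun n => measurable_apply_of_bounded hP hm (hg n) (hC n) _ fun _ _ => rfl) ?_
  rw [tendsto_pi_nhds]
  intro p
  refine hP p.1 _ _ ⟨⟨‖h p.1‖, fun n => BMFun.norm_le (norm_nonneg _) fun x =>
    (norm_indicator_le_norm_self (fun p : α × E => h p.1 p.2) (p.1, x)).trans
      ((h p.1).norm_apply_le x)⟩, fun x => ?_⟩ p.2
  refine tendsto_const_nhds.congr' ?_
  obtain ⟨N, hN⟩ := exists_nat_ge ‖h p.1 x‖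
  filter_upwards [eventually_ge_atTop N] with n hn
  refine (Set.indicator_of_mem (s := {p : α × E | ‖h p.1 p.2‖ ≤ n}) (a := (p.1, x)) ?_ fun p => h p.1 p.2).symm
  exact hN.trans (by exact_mod_cast hn)

end Joint

/-! ### Integrals of operator families -/

section Integral

variable {E : Type*} [MeasurableSpace E]

open Classical in
/-- The operator given by the formula `F`, if there is one. -/
noncomputable def opOf (F : BMFun E → E → ℂ) : Op E :=
  if h : ∃ T : Op E, ∀ f x, T f x = F f x then h.choose else 0

theorem opOf_apply {F : BMFun E → E → ℂ} (h : ∃ T : Op E, ∀ f x, T f x = F f x) (f : BMFun E)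
    (x : E) : opOf F f x = F f x := by
  rw [opOf, dif_pos h]
  exact h.choose_spec f x

theorem exists_op {F : BMFun E → E → ℂ} {C : ℝ} (hm : ∀ f, Measurable (F f))
    (hb : ∀ f x, ‖F f x‖ ≤ C * ‖f‖) (ha : ∀ f g x, F (f + g) x = F f x + F g x)
    (hs : ∀ (c : ℂ) f x, F (c • f) x = c * F f x) : ∃ T : Op E, ∀ f x, T f x = F f x := by
  have hC : ∀ f : BMFun E, ∀ x : E, ‖F f x‖ ≤ max C 0 * ‖f‖ := fun f x =>
    (hb f x).trans (by gcongr; exact le_max_left _ _)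
  refine ⟨LinearMap.mkContinuous
    { toFun := fun f => BMFun.mk (F f) (hm f) ⟨_, hb f⟩
      map_add' := fun f g => BMFun.ext (ha f g)
      map_smul' := fun c f => BMFun.ext (hs c f) } (max C 0) fun f => ?_, fun f x => rfl⟩
  exact BMFun.norm_le (by positivity) (hC f)

/-- A measurable family of operators that are continuous for bounded pointwise convergence, with an
integrable bound `b`. -/
structure IntegrableFamily (P : ℝ → Op E) (b : ℝ → ℝ) : Prop where
  bpc : ∀ t, IsBPC (P t)
  meas : ∀ f, Measurable fun p : ℝ × E => P p.1 f p.2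
  bound : ∀ t, ‖P t‖ ≤ b t
  int : Integrable b

/-- The operator `f ↦ ∫ P(t) f dt`. -/
noncomputable def opIntegral (P : ℝ → Op E) : Op E := opOf fun f x => ∫ t, P t f x

theorem Op.norm_apply_apply_le (T : Op E) (f : BMFun E) (x : E) : ‖T f x‖ ≤ ‖T‖ * ‖f‖ :=
  ((T f).norm_apply_le x).trans (T.le_opNorm f)

namespace IntegrableFamily

variable {P : ℝ → Op E} {b : ℝ → ℝ}

theorem norm_le (h : IntegrableFamily P b) (f : BMFun E) (x : E) (t : ℝ) :
    ‖P t f x‖ ≤ b t * ‖f‖ :=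
  (Op.norm_apply_apply_le _ _ _).trans (by gcongr; exact h.bound t)

theorem integrable (h : IntegrableFamily P b) (f : BMFun E) (x : E) :
    Integrable fun t => P t f x :=
  (h.int.mul_const ‖f‖).mono' ((h.meas f).comp measurable_prodMk_right).aestronglyMeasurable
    (Eventually.of_forall (h.norm_le f x))

theorem exists_integral (h : IntegrableFamily P b) :
    ∃ T : Op E, ∀ f x, T f x = ∫ t, P t f x := by
  refine exists_op (C := ∫ t, b t) ?_ ?_ ?_ ?_
  · intro f
    exact (((h.meas f).comp measurable_swap).stronglyMeasurable.integral_prod_right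
      (f := fun x t => P t f x)).measurable
  · intro f x
    rw [← integral_mul_const]
    exact norm_integral_le_of_norm_le (h.int.mul_const _) (Eventually.of_forall (h.norm_le f x))
  · intro f g x
    rw [← integral_add (h.integrable f x) (h.integrable g x)]
    simp only [map_add, BMFun.add_apply]
  · intro c f x
    rw [← integral_const_mul]
    simp only [map_smul, BMFun.smul_apply]

theorem apply (h : IntegrableFamily P b) (f : BMFun E) (x : E) :
    opIntegral P f x = ∫ t, P t f x :=
  opOf_apply h.exists_integral f x

theorem integral_nonneg (h : IntegrableFamily P b) : 0 ≤ ∫ t, b t :=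
  MeasureTheory.integral_nonneg fun t => (norm_nonneg _).trans (h.bound t)

theorem norm_opIntegral_le (h : IntegrableFamily P b) : ‖opIntegral P‖ ≤ ∫ t, b t := by
  refine ContinuousLinearMap.opNorm_le_bound _ h.integral_nonneg fun f => ?_
  refine BMFun.norm_le (mul_nonneg h.integral_nonneg (norm_nonneg _)) fun x => ?_
  rw [h.apply, ← integral_mul_const]
  exact norm_integral_le_of_norm_le (h.int.mul_const _) (Eventually.of_forall (h.norm_le f x))

theorem isBPC (h : IntegrableFamily P b) : IsBPC (opIntegral P) := by
  intro f g hfg x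
  obtain ⟨C, hC⟩ := hfg.1
  simp only [h.apply]
  refine tendsto_integral_of_dominated_convergence (fun t => b t * C)
    (fun n => (h.integrable _ x).aestronglyMeasurable) (h.int.mul_const C) ?_ ?_
  · intro n
    refine Eventually.of_forall fun t => (h.norm_le _ x t).trans ?_
    have : 0 ≤ b t := (norm_nonneg _).trans (h.bound t)
    gcongr
    exact hC n
  · exact Eventually.of_forall fun t => h.bpc t f g hfg x

theorem isRealOp (h : IntegrableFamily P b) (hR : ∀ t, IsRealOp (P t)) :
    IsRealOp (opIntegral P) := by
  intro f hf x
  rw [h.apply]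
  have := integral_im (h.integrable f x)
  simp only [RCLike.im_to_complex] at this
  rw [← this]
  simp [hR _ f hf]

theorem continuous [TopologicalSpace E] [FirstCountableTopology E] (h : IntegrableFamily P b)
    {f : BMFun E} (hc : ∀ t, Continuous (P t f)) : Continuous (opIntegral P f) := by
  have : (opIntegral P f : E → ℂ) = fun x => ∫ t, P t f x := funext (h.apply f)
  rw [this]
  exact continuous_of_dominated (fun x => (h.integrable f x).aestronglyMeasurable)
    (fun x => Eventually.of_forall (h.norm_le f x)) (h.int.mul_const _)
    (Eventually.of_forall hc)

/-- A kernel operator commutes with the integral of a family of functions. -/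
theorem _root_.IsBPC.integral_comm {Q : Op E} (hQ : IsBPC Q) (hR : IsRealOp Q) {h : ℝ → BMFun E} {b : ℝ → ℝ}
    (hm : Measurable fun p : ℝ × E => h p.1 p.2) (hb : ∀ t, ‖h t‖ ≤ b t) (hi : Integrable b)
    {g : BMFun E} (hg : ∀ x, g x = ∫ t, h t x) (x : E) : Q g x = ∫ t, Q (h t) x := by
  -- The criterion provides a kernel for `Q`, so the exchange becomes Fubini's theorem for the two
  -- Jordan parts of `k x`.
  obtain ⟨k, -, hk⟩ := (isKernelOp_iff (T := ofOp Q)).2 ⟨hQ, hR⟩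
  have hk' : ∀ f : BMFun E, Q f x = sintegral f (k x) := fun f => hk (ofFn f) x
  have key : ∀ (ν : Measure E) [IsFiniteMeasure ν],
      Integrable (fun t => ∫ y, h t y ∂ν) ∧ ∫ y, g y ∂ν = ∫ t, ∫ y, h t y ∂ν := by
    intro ν _
    have hint : Integrable (Function.uncurry fun t y => h t y) (volume.prod ν) := by
      refine (hi.comp_fst ν).mono' hm.aestronglyMeasurable (Eventually.of_forall fun p => ?_)
      exact ((h p.1).norm_apply_le p.2).trans (hb p.1)
    refine ⟨hint.integral_prod_left, ?_⟩
    rw [integral_integral_swap hint]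
    simp only [hg]
  simp only [hk', sintegral]
  rw [(key _).2, (key _).2, integral_sub (key _).1 (key _).1]

theorem comp_left (h : IntegrableFamily P b) {Q : Op E} (hQ : IsBPC Q) :
    IntegrableFamily (fun t => Q ∘L P t) (fun t => ‖Q‖ * b t) where
  bpc t := hQ.comp (h.bpc t)
  meas f := measurable_apply (P := fun _ : ℝ => Q) (h := fun t => P t f) (fun _ => hQ) (fun f => (Q f).measurable.comp measurable_snd) (h.meas f)
  bound t := (Q.opNorm_comp_le _).trans (by gcongr; exact h.bound t)
  int := h.int.const_mul _

theorem comp_right (h : IntegrableFamily P b) {Q : Op E} (hQ : IsBPC Q) :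
    IntegrableFamily (fun t => P t ∘L Q) (fun t => b t * ‖Q‖) where
  bpc t := (h.bpc t).comp hQ
  meas f := h.meas (Q f)
  bound t := ((P t).opNorm_comp_le _).trans (by gcongr; exact h.bound t)
  int := h.int.mul_const _

theorem opIntegral_comp_left (h : IntegrableFamily P b) {Q : Op E} (hQ : IsBPC Q)
    (hR : IsRealOp Q) : opIntegral (fun t => Q ∘L P t) = Q ∘L opIntegral P := by
  refine ContinuousLinearMap.ext fun f => BMFun.ext fun x => ?_
  rw [(h.comp_left hQ).apply]
  refine (hQ.integral_comm hR (h.meas f) (b := fun t => b t * ‖f‖) ?_ (h.int.mul_const _)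
    (h.apply f) x).symm
  exact fun t => ((P t).le_opNorm f).trans (by gcongr; exact h.bound t)

theorem opIntegral_comp_right (h : IntegrableFamily P b) {Q : Op E} (hQ : IsBPC Q) :
    opIntegral (fun t => P t ∘L Q) = opIntegral P ∘L Q := by
  refine ContinuousLinearMap.ext fun f => BMFun.ext fun x => ?_
  rw [(h.comp_right hQ).apply, ContinuousLinearMap.comp_apply, h.apply]
  rfl

end IntegrableFamily

end Integral

/-! ### Integration by parts against an exponential -/

section Parts

theorem integral_cexp_mul (z : ℂ) (a b : ℝ) :
    ∫ s in a..b, z * Complex.exp (-(z * s)) = Complex.exp (-(z * a)) - Complex.exp (-(z * b)) := by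
  have h : ∀ s : ℝ, HasDerivAt (fun s : ℝ => -Complex.exp (-(z * s)))
      (z * Complex.exp (-(z * s))) s := by
    intro s
    have h1 : HasDerivAt (fun s : ℝ => -(z * (s : ℂ))) (-(z * 1)) s :=
      ((HasDerivAt.ofReal_comp (hasDerivAt_id s)).const_mul z).neg
    exact h1.cexp.fun_neg.congr_deriv (by ring)
  rw [intervalIntegral.integral_eq_sub_of_hasDerivAt (fun s _ => h s)
    (Continuous.intervalIntegrable (by fun_prop) _ _)]
  ring

/-- Integration by parts for an exponential and the primitive of an integrable function. -/
theorem cexp_mul_primitive_sub {a : ℝ → ℂ} {t : ℝ} (ht : 0 ≤ t)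
    (ha : IntegrableOn a (Set.Ioc 0 t)) (c z : ℂ) :
    Complex.exp (-(z * t)) * (c + ∫ s in (0 : ℝ)..t, a s) - c =
      ∫ s in (0 : ℝ)..t, Complex.exp (-(z * s)) * (a s - z * (c + ∫ r in (0 : ℝ)..s, a r)) := by
  have hab : IntervalIntegrable a volume 0 t := (intervalIntegrable_iff_integrableOn_Ioc_of_le ht).2 ha
  have hcont : ContinuousOn (fun s => ∫ r in (0 : ℝ)..s, a r) (Set.uIcc 0 t) :=
    intervalIntegral.continuousOn_primitive_interval'
      hab Set.left_mem_uIcc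
  have hexp : Continuous fun s : ℝ => Complex.exp (-(z * s)) := by fun_prop
  set μ := volume.restrict (Set.Ioc 0 t)
  -- The primitive of `a` need not be differentiable everywhere, so the integration by parts is
  -- carried out as Fubini's theorem on the triangle `r ≤ s ≤ t`.
  have hswap : ∫ s in (0 : ℝ)..t, z * Complex.exp (-(z * s)) * ∫ r in (0 : ℝ)..s, a r =
      ∫ r in (0 : ℝ)..t, a r * (Complex.exp (-(z * r)) - Complex.exp (-(z * t))) := by
    have hD : MeasurableSet {p : ℝ × ℝ | p.2 ≤ p.1} := measurableSet_le measurable_snd measurable_fst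
    have hint : Integrable (Function.uncurry fun s r : ℝ =>
        {p : ℝ × ℝ | p.2 ≤ p.1}.indicator
          (fun p => z * Complex.exp (-(z * p.1)) * a p.2) (s, r)) (μ.prod μ) := by
      have h1 : Integrable (fun s : ℝ => z * Complex.exp (-(z * s))) μ :=
        ((hexp.const_mul z).integrableOn_Icc).mono_set Set.Ioc_subset_Icc_self
      exact (h1.mul_prod ha).indicator hD
    have e1 : ∫ s in (0 : ℝ)..t, z * Complex.exp (-(z * s)) * ∫ r in (0 : ℝ)..s, a r =
        ∫ s, ∫ r, {p : ℝ × ℝ | p.2 ≤ p.1}.indicator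
          (fun p => z * Complex.exp (-(z * p.1)) * a p.2) (s, r) ∂μ ∂μ := by
      rw [intervalIntegral.integral_of_le ht]
      refine setIntegral_congr_fun measurableSet_Ioc fun s hs => ?_
      have : ∀ r, {p : ℝ × ℝ | p.2 ≤ p.1}.indicator
          (fun p => z * Complex.exp (-(z * p.1)) * a p.2) (s, r) =
          (Set.Iic s).indicator (fun r => z * Complex.exp (-(z * s)) * a r) r := fun r => rfl
      simp only [this]
      rw [integral_indicator measurableSet_Iic, Measure.restrict_restrict measurableSet_Iic,
        integral_const_mul, intervalIntegral.integral_of_le hs.1.le]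
      congr 3
      ext r
      exact ⟨fun h => ⟨h.2, h.1, h.2.trans hs.2⟩, fun h => ⟨h.2.1, h.1⟩⟩
    have e2 : ∫ r in (0 : ℝ)..t, a r * (Complex.exp (-(z * r)) - Complex.exp (-(z * t))) =
        ∫ r, ∫ s, {p : ℝ × ℝ | p.2 ≤ p.1}.indicator
          (fun p => z * Complex.exp (-(z * p.1)) * a p.2) (s, r) ∂μ ∂μ := by
      rw [intervalIntegral.integral_of_le ht]
      refine setIntegral_congr_fun measurableSet_Ioc fun r hr => ?_
      have : ∀ s, {p : ℝ × ℝ | p.2 ≤ p.1}.indicator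
          (fun p => z * Complex.exp (-(z * p.1)) * a p.2) (s, r) =
          (Set.Ici r).indicator (fun s : ℝ => z * Complex.exp (-(z * s)) * a r) s := fun s => rfl
      simp only [this]
      rw [integral_indicator measurableSet_Ici, Measure.restrict_restrict measurableSet_Ici,
        integral_mul_const, ← integral_cexp_mul, intervalIntegral.integral_of_le hr.2, mul_comm]
      have : Set.Ici r ∩ Set.Ioc 0 t = Set.Icc r t := by
        ext s
        exact ⟨fun h => ⟨h.1, h.2.2⟩, fun h => ⟨h.1, hr.1.trans_le h.1, h.2⟩⟩
      rw [this, integral_Icc_eq_integral_Ioc]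
    rw [e1, e2, integral_integral_swap hint]
  have i1 : IntervalIntegrable (fun r => a r * (Complex.exp (-(z * r)))) volume 0 t :=
    hab.mul_continuousOn hexp.continuousOn
  have i2 : IntervalIntegrable (fun r => a r * Complex.exp (-(z * t))) volume 0 t :=
    hab.mul_const _
  have i3 : IntervalIntegrable (fun s : ℝ => z * Complex.exp (-(z * s)) * c) volume 0 t :=
    Continuous.intervalIntegrable (by fun_prop) _ _
  have i4 : IntervalIntegrable (fun s : ℝ => z * Complex.exp (-(z * s)) * ∫ r in (0 : ℝ)..s, a r)
      volume 0 t :=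
    ContinuousOn.intervalIntegrable (((hexp.const_mul z).continuousOn).mul hcont)
  have e : ∀ s : ℝ, Complex.exp (-(z * s)) * (a s - z * (c + ∫ r in (0 : ℝ)..s, a r)) =
      a s * Complex.exp (-(z * s)) - z * Complex.exp (-(z * s)) * c -
        z * Complex.exp (-(z * s)) * ∫ r in (0 : ℝ)..s, a r := fun s => by ring
  simp only [e]
  rw [intervalIntegral.integral_sub (i1.sub i3) i4, intervalIntegral.integral_sub i1 i3, hswap,
    intervalIntegral.integral_mul_const, integral_cexp_mul]
  simp only [mul_sub]
  rw [intervalIntegral.integral_sub i1 i2, intervalIntegral.integral_mul_const]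
  simp
  ring

end Parts

/-! ### Laplace transforms and the full generator -/

section Families

variable {E : Type*} [MeasurableSpace E]

/-- A measurable family of kernel operators, vanishing for `t ≤ 0`. -/
structure KernelFamily (P : ℝ → Op E) : Prop where
  zero : ∀ t ≤ 0, P t = 0
  bpc : ∀ t, IsBPC (P t)
  real : ∀ t, IsRealOp (P t)
  meas : ∀ f, Measurable fun p : ℝ × E => P p.1 f p.2

/-- A kernel family with exponential bound `‖P(t)‖ ≤ c e^{wt}`. -/
structure ExpFamily (P : ℝ → Op E) (c w : ℝ) : Prop extends KernelFamily P where
  bound : ∀ t, ‖P t‖ ≤ c * Real.exp (w * t)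

/-- The Laplace transform of a family of operators. -/
noncomputable def lap (P : ℝ → Op E) (z : ℂ) : Op E :=
  opIntegral fun t => Complex.exp (-(z * t)) • P t

theorem norm_cexp_neg_mul (z : ℂ) (t : ℝ) : ‖Complex.exp (-(z * t))‖ = Real.exp (-(z.re * t)) := by
  rw [Complex.norm_exp]
  simp

/-- The family `e^{-zt} P(t)` is integrable if `e^{-lt} ψ(t)` is integrable, where
`‖P(t)‖ ≤ ψ(t)`. -/
theorem KernelFamily.integrableFamily {P : ℝ → Op E} (h : KernelFamily P) {ψ : ℝ → ℝ} {z : ℂ}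
    (hb : ∀ t, ‖P t‖ ≤ ψ t) (hi : Integrable fun t => Real.exp (-(z.re * t)) * ψ t) :
    IntegrableFamily (fun t => Complex.exp (-(z * t)) • P t)
      fun t => Real.exp (-(z.re * t)) * ψ t where
  bpc t := (h.bpc t).smul _
  meas f := by
    change Measurable fun p : ℝ × E => Complex.exp (-(z * p.1)) * P p.1 f p.2
    exact Measurable.mul (by fun_prop) (h.meas f)
  bound t := by
    rw [norm_smul, norm_cexp_neg_mul]
    gcongr
    exact hb t
  int := hi

theorem integrable_exp_indicator {c w l : ℝ} (h : w < l) :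
    Integrable fun t : ℝ => Real.exp (-(l * t)) *
      (Set.Ioi (0 : ℝ)).indicator (fun t => c * Real.exp (w * t)) t := by
  have h1 : (fun t : ℝ => Real.exp (-(l * t)) *
      (Set.Ioi (0 : ℝ)).indicator (fun t => c * Real.exp (w * t)) t) =
      (Set.Ioi (0 : ℝ)).indicator fun t => c * Real.exp (-(l - w) * t) := by
    ext t
    by_cases ht : t ∈ Set.Ioi (0 : ℝ)
    · simp only [Set.indicator_of_mem ht]
      rw [mul_left_comm, ← Real.exp_add]
      ring_nf
    · simp only [Set.indicator_of_notMem ht, mul_zero]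
  rw [h1, integrable_indicator_iff measurableSet_Ioi]
  exact (integrableOn_exp_mul_Ioi (by linarith) 0).const_mul _

theorem integral_exp_indicator {c w l : ℝ} (h : w < l) :
    ∫ t : ℝ, Real.exp (-(l * t)) *
      (Set.Ioi (0 : ℝ)).indicator (fun t => c * Real.exp (w * t)) t = c / (l - w) := by
  have h1 : (fun t : ℝ => Real.exp (-(l * t)) *
      (Set.Ioi (0 : ℝ)).indicator (fun t => c * Real.exp (w * t)) t) =
      (Set.Ioi (0 : ℝ)).indicator fun t => c * Real.exp (-(l - w) * t) := by
    ext t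
    by_cases ht : t ∈ Set.Ioi (0 : ℝ)
    · simp only [Set.indicator_of_mem ht]
      rw [mul_left_comm, ← Real.exp_add]
      ring_nf
    · simp only [Set.indicator_of_notMem ht, mul_zero]
  rw [h1, integral_indicator measurableSet_Ioi, integral_const_mul,
    integral_exp_mul_Ioi (by linarith)]
  simp only [mul_zero, Real.exp_zero]
  rw [neg_div_neg_eq, mul_one_div]

namespace ExpFamily

variable {P : ℝ → Op E} {c w : ℝ}

/-- The weight `e^{-lt} c e^{wt}` with `w < l` is integrable only on the positive half-line;
vanishing of the family for `t ≤ 0` permits the cut-off. -/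
theorem bound_indicator (h : ExpFamily P c w) (t : ℝ) :
    ‖P t‖ ≤ (Set.Ioi (0 : ℝ)).indicator (fun t => c * Real.exp (w * t)) t := by
  by_cases ht : t ∈ Set.Ioi (0 : ℝ)
  · rw [Set.indicator_of_mem ht]
    exact h.bound t
  · rw [Set.indicator_of_notMem ht, h.zero t (not_lt.1 ht), norm_zero]

theorem integrableFamily (h : ExpFamily P c w) {z : ℂ} (hz : w < z.re) :
    IntegrableFamily (fun t => Complex.exp (-(z * t)) • P t) fun t => Real.exp (-(z.re * t)) *
      (Set.Ioi (0 : ℝ)).indicator (fun t => c * Real.exp (w * t)) t :=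
  h.toKernelFamily.integrableFamily h.bound_indicator (integrable_exp_indicator hz)

theorem lap_apply (h : ExpFamily P c w) {z : ℂ} (hz : w < z.re) (f : BMFun E) (x : E) :
    lap P z f x = ∫ t : ℝ, Complex.exp (-(z * t)) * P t f x :=
  (h.integrableFamily hz).apply f x

theorem integrable (h : ExpFamily P c w) {z : ℂ} (hz : w < z.re) (f : BMFun E) (x : E) :
    Integrable fun t : ℝ => Complex.exp (-(z * t)) * P t f x :=
  (h.integrableFamily hz).integrable f x

theorem integral_eq_Ioi (h : ExpFamily P c w) (z : ℂ) (f : BMFun E) (x : E) :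
    ∫ t : ℝ, Complex.exp (-(z * t)) * P t f x =
      ∫ t in Set.Ioi (0 : ℝ), Complex.exp (-(z * t)) * P t f x := by
  rw [← integral_indicator measurableSet_Ioi]
  congr 1
  ext t
  by_cases ht : t ∈ Set.Ioi (0 : ℝ)
  · rw [Set.indicator_of_mem ht]
  · rw [Set.indicator_of_notMem ht, h.zero t (not_lt.1 ht)]
    simp

theorem lap_apply_Ioi (h : ExpFamily P c w) {z : ℂ} (hz : w < z.re) (f : BMFun E) (x : E) :
    lap P z f x = ∫ t in Set.Ioi (0 : ℝ), Complex.exp (-(z * t)) * P t f x := by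
  rw [h.lap_apply hz, h.integral_eq_Ioi]

theorem norm_lap_le (h : ExpFamily P c w) {z : ℂ} (hz : w < z.re) :
    ‖lap P z‖ ≤ c / (z.re - w) :=
  ((h.integrableFamily hz).norm_opIntegral_le).trans_eq (integral_exp_indicator hz)

theorem isBPC_lap (h : ExpFamily P c w) {z : ℂ} (hz : w < z.re) : IsBPC (lap P z) :=
  (h.integrableFamily hz).isBPC

end ExpFamily

theorem IsRealOp.real_smul {T : Op E} (h : IsRealOp T) (c : ℝ) : IsRealOp ((c : ℂ) • T) := by
  intro f hf x
  change ((c : ℂ) * T f x).im = 0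
  rw [Complex.re_ofReal_mul |> fun _ => Complex.im_ofReal_mul, h f hf, mul_zero]

theorem cexp_neg_ofReal (l t : ℝ) :
    Complex.exp (-((l : ℂ) * t)) = ((Real.exp (-(l * t)) : ℝ) : ℂ) := by
  push_cast
  rfl

theorem KernelFamily.isRealOp_lap {P : ℝ → Op E} (h : KernelFamily P) {ψ : ℝ → ℝ} {l : ℝ}
    (hb : ∀ t, ‖P t‖ ≤ ψ t) (hi : Integrable fun t => Real.exp (-(l * t)) * ψ t) :
    IsRealOp (lap P l) := by
  refine (h.integrableFamily (z := (l : ℂ)) hb hi).isRealOp fun t => ?_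
  rw [cexp_neg_ofReal]
  exact (h.real t).real_smul _

theorem ExpFamily.isRealOp_lap {P : ℝ → Op E} {c w : ℝ} (h : ExpFamily P c w) {l : ℝ}
    (hl : w < l) : IsRealOp (lap P l) :=
  h.toKernelFamily.isRealOp_lap h.bound_indicator (integrable_exp_indicator hl)

/-- A semigroup of kernel operators, extended by `0` to `t ≤ 0`. -/
structure KSemigroup (T : ℝ → Op E) (c w : ℝ) : Prop extends ExpFamily T c w where
  mul : ∀ s t, 0 < s → 0 < t → T (t + s) = T t ∘L T s

/-- The full generator. -/
def gen (T : ℝ → Op E) : Set (BMFun E × BMFun E) :=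
  {p | ∀ t, 0 < t → ∀ x, T t p.1 x - p.1 x = ∫ s in (0 : ℝ)..t, T s p.2 x}

/-- `Q = (z - G)⁻¹` for the multivalued operator `G`. -/
def IsRes (G : Set (BMFun E × BMFun E)) (z : ℂ) (Q : Op E) : Prop :=
  ∀ u g, (u, g) ∈ G ↔ u = Q (z • u - g)

namespace KSemigroup

variable {T : ℝ → Op E} {c w : ℝ}

theorem integrableOn (h : KSemigroup T c w) (f : BMFun E) (x : E) (t : ℝ) :
    IntegrableOn (fun s => T s f x) (Set.Ioc 0 t) := by
  have h1 := (h.integrable (z := ((w + 1 : ℝ) : ℂ)) (by simp) f x).integrableOn (s := Set.Icc 0 t)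
  have hc : ContinuousOn (fun s : ℝ => Complex.exp (((w + 1 : ℝ) : ℂ) * s)) (Set.Icc 0 t) := by
    fun_prop
  refine ((h1.continuousOn_mul hc isCompact_Icc).mono_set Set.Ioc_subset_Icc_self).congr_fun
    (fun s _ => ?_) measurableSet_Ioc
  simp only
  rw [← mul_assoc, ← Complex.exp_add, add_neg_cancel, Complex.exp_zero, one_mul]

/-- The semigroup law gives `T(t)R(z)f = ∫₀^∞ e^{-zs} T(s+t)f ds`; the substitution `r = s + t`
extracts `e^{zt}` and leaves the tail of the Laplace integral beyond `t`. -/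
theorem apply_lap (h : KSemigroup T c w) {z : ℂ} (hz : w < z.re) {t : ℝ} (ht : 0 < t)
    (f : BMFun E) (x : E) : T t (lap T z f) x = Complex.exp (z * t) *
      (lap T z f x - ∫ r in (0 : ℝ)..t, Complex.exp (-(z * r)) * T r f x) := by
  have hI := h.integrableFamily hz
  have e1 : T t (lap T z f) x = ∫ s in Set.Ioi (0 : ℝ),
      Complex.exp (z * t) * (Complex.exp (-(z * (s + t : ℝ))) * T (s + t) f x) := by
    rw [(h.bpc t).integral_comm (h.real t) (g := lap T z f) (hI.meas f) (b := fun s => (Real.exp (-(z.re * s)) *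
      (Set.Ioi (0 : ℝ)).indicator (fun t => c * Real.exp (w * t)) s) * ‖f‖) (fun s =>
        (ContinuousLinearMap.le_opNorm _ f).trans (by gcongr; exact hI.bound s))
      (hI.int.mul_const _) (hI.apply f), ← integral_indicator measurableSet_Ioi]
    congr 1
    ext s
    by_cases hs : s ∈ Set.Ioi (0 : ℝ)
    · have hs' : 0 < s := hs
      rw [Set.indicator_of_mem hs, smul_apply, map_smul, BMFun.smul_apply,
        add_comm s t, h.mul s t hs' ht, ← mul_assoc, ← Complex.exp_add]
      congr 2
      push_cast
      ring
    · rw [Set.indicator_of_notMem hs, h.zero s (not_lt.1 hs)]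
      simp
  rw [e1, integral_const_mul, h.lap_apply_Ioi hz]
  congr 1
  have e2 : ∫ s in Set.Ioi (0 : ℝ), Complex.exp (-(z * (s + t : ℝ))) * T (s + t) f x =
      ∫ r in Set.Ioi t, Complex.exp (-(z * r)) * T r f x := by
    have := (measurePreserving_add_right volume t).setIntegral_preimage_emb
      (measurableEmbedding_addRight t) (fun r : ℝ => Complex.exp (-(z * r)) * T r f x) (Set.Ioi t)
    rw [← this, Set.preimage_add_const_Ioi, sub_self]
  rw [e2, ← intervalIntegral.integral_Ioi_sub_Ioi
      (h.integrable hz f x).integrableOn ht.le, sub_sub_cancel]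

/-- The resolvent of the full generator is the Laplace transform of the semigroup. -/
theorem isRes (h : KSemigroup T c w) {z : ℂ} (hz : w < z.re) : IsRes (gen T) z (lap T z) := by
  intro u g
  constructor
  · intro hug
    refine BMFun.ext fun x => ?_
    -- Integration by parts converts the generator identity into a truncated Laplace integral of `z
    -- • u - g`. Since `w < Re z`, the boundary term `e^{-zt} T(t)u` vanishes as `t → ∞`.
    have key : ∀ t : ℝ, 0 < t → u x - Complex.exp (-(z * t)) * T t u x =
        ∫ s in (0 : ℝ)..t, Complex.exp (-(z * s)) * T s (z • u - g) x := by
      intro t ht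
      have h1 := cexp_mul_primitive_sub ht.le (h.integrableOn g x t) (u x) z
      have h2 : ∀ s : ℝ, 0 < s → u x + ∫ r in (0 : ℝ)..s, T r g x = T s u x := fun s hs => by
        rw [← hug s hs x]
        ring
      rw [h2 t ht] at h1
      rw [← neg_inj, neg_sub, h1, ← intervalIntegral.integral_neg,
        intervalIntegral.integral_of_le ht.le, intervalIntegral.integral_of_le ht.le]
      refine setIntegral_congr_fun measurableSet_Ioc fun s hs => ?_
      rw [h2 s hs.1, map_sub, map_smul, BMFun.sub_apply, BMFun.smul_apply]
      ring
    have l1 := intervalIntegral_tendsto_integral_Ioi 0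
      (h.integrable hz (z • u - g) x).integrableOn tendsto_id
    rw [← h.lap_apply_Ioi hz] at l1
    have l2 : Tendsto (fun t : ℝ => u x - Complex.exp (-(z * t)) * T t u x) atTop
        (𝓝 (u x - 0)) := by
      refine tendsto_const_nhds.sub ?_
      rw [tendsto_zero_iff_norm_tendsto_zero]
      have l3 : Tendsto (fun t : ℝ => c * ‖u‖ * Real.exp (-((z.re - w) * t))) atTop (𝓝 (c * ‖u‖ * 0)) :=
        (Real.tendsto_exp_neg_atTop_nhds_zero.comp
          (tendsto_id.const_mul_atTop (sub_pos.2 hz))).const_mul _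
      rw [mul_zero] at l3
      refine squeeze_zero (fun _ => norm_nonneg _) (fun t => ?_) l3
      rw [norm_mul, norm_cexp_neg_mul]
      calc Real.exp (-(z.re * t)) * ‖T t u x‖
          ≤ Real.exp (-(z.re * t)) * (c * Real.exp (w * t) * ‖u‖) := by
            gcongr
            exact (Op.norm_apply_apply_le _ _ _).trans (by gcongr; exact h.bound t)
        _ = c * ‖u‖ * (Real.exp (-(z.re * t)) * Real.exp (w * t)) := by ring
        _ = _ := by rw [← Real.exp_add]; ring_nf
    rw [sub_zero] at l2
    refine tendsto_nhds_unique (l2.congr' ?_) l1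
    filter_upwards [eventually_gt_atTop 0] with t ht
    exact key t ht
  · intro hu t ht x
    obtain ⟨f, hf⟩ : ∃ f, f = z • u - g := ⟨_, rfl⟩
    rw [← hf] at hu
    have h0 : ∀ s : ℝ, 0 < s → T s u x = Complex.exp (z * s) *
        (u x - ∫ r in (0 : ℝ)..s, Complex.exp (-(z * r)) * T r f x) := by
      intro s hs
      have := h.apply_lap hz hs f x
      rwa [← hu] at this
    -- The same integration by parts, with `-z` for `z` and `-e^{-zr} T(r)f` for the integrand,
    -- differentiates the orbit formula `h0`: its derivative is `z T(s)u - T(s)f = T(s)g`.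
    have h1 := cexp_mul_primitive_sub ht.le
      ((h.integrable hz f x).neg.integrableOn (s := Set.Ioc 0 t)) (u x) (-z)
    simp only [Pi.neg_apply, intervalIntegral.integral_neg, neg_mul, neg_neg, ← sub_eq_add_neg] at h1
    rw [← h0 t ht] at h1
    refine h1.trans ?_
    rw [intervalIntegral.integral_of_le ht.le, intervalIntegral.integral_of_le ht.le]
    refine setIntegral_congr_fun measurableSet_Ioc fun s hs => ?_
    simp only
    have h2 : g = z • u - f := by rw [hf, sub_sub_cancel]
    rw [h2, map_sub, map_smul, BMFun.sub_apply, BMFun.smul_apply, h0 s hs.1]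
    have h3 : Complex.exp (z * s) * Complex.exp (-(z * s)) = 1 := by
      rw [← Complex.exp_add, add_neg_cancel, Complex.exp_zero]
    linear_combination (-T s f x) * h3

end KSemigroup

end Families

/-! ### Resolvents of multivalued operators and their perturbation -/

section Resolvent

variable {E : Type*} [MeasurableSpace E]

namespace IsRes

variable {G G' : Set (BMFun E × BMFun E)} {z z' : ℂ} {Q Q' : Op E}

theorem mem (h : IsRes G z Q) (f : BMFun E) : (Q f, z • Q f - f) ∈ G :=
  (h _ _).2 (by rw [sub_sub_cancel])

/-- `IsRes` describes the graph entirely through `z` and `Q`, so two operators with a common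
resolvent at one point agree. This identifies the generator of the perturbed semigroup. -/
theorem ext (h : IsRes G z Q) (h' : IsRes G' z Q) : G = G' := by
  ext ⟨u, g⟩
  rw [h, h']

/-- The resolvent identity. -/
theorem identity (h : IsRes G z Q) (h' : IsRes G z' Q') : Q' = Q + (z - z') • (Q ∘L Q') := by
  refine ContinuousLinearMap.ext fun f => ?_
  have h1 := (h _ _).1 (h'.mem f)
  have h2 : z • Q' f - (z' • Q' f - f) = f + (z - z') • Q' f := by
    rw [sub_smul]
    abel
  rw [h2, map_add, map_smul] at h1
  exact h1

theorem unique (h : IsRes G z Q) (h' : IsRes G z Q') : Q = Q' := by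
  have := h.identity h'
  rw [sub_self, zero_smul, add_zero] at this
  exact this.symm

/-- In this form the identity exhibits `Q' f` as a value of `Q`, so it can be rewritten under an
arbitrary map `b` for which only `b ∘ Q` is known to be linear. -/
theorem identity_apply (h : IsRes G z Q) (h' : IsRes G z' Q') (f : BMFun E) :
    Q' f = Q (f + (z - z') • Q' f) := by
  conv_lhs => rw [h.identity h']
  rw [map_add, map_smul]
  rfl

/-- For `z ≠ z'` the resolvent identity and its mirror image express `(z - z')` times either product
as `Q' - Q`. -/
theorem comm (h : IsRes G z Q) (h' : IsRes G z' Q') : Q ∘L Q' = Q' ∘L Q := by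
  rcases eq_or_ne z z' with rfl | hz
  · rw [h.unique h']
  have h1 := h.identity h'
  have h2 := h'.identity h
  have h3 : (z - z') • (Q ∘L Q') = (z - z') • (Q' ∘L Q) := by
    have e1 : (z - z') • (Q ∘L Q') = Q' - Q := by
      nth_rewrite 2 [h1]
      rw [add_sub_cancel_left]
    have e2 : (z' - z) • (Q' ∘L Q) = Q - Q' := by
      nth_rewrite 2 [h2]
      rw [add_sub_cancel_left]
    rw [e1, ← neg_sub z' z, neg_smul, e2, neg_sub]
  exact smul_right_injective _ (sub_ne_zero.2 hz) h3

end IsRes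

/-- The sum of a multivalued operator and a function. -/
def addG (G : Set (BMFun E × BMFun E)) (b : BMFun E → BMFun E) : Set (BMFun E × BMFun E) :=
  {p | ∃ u g, (u, g) ∈ G ∧ p = (u, g + b u)}

theorem mem_addG {G : Set (BMFun E × BMFun E)} {b : BMFun E → BMFun E} {u g : BMFun E} :
    (u, g) ∈ addG G b ↔ (u, g - b u) ∈ G := by
  constructor
  · rintro ⟨u, g, h, e⟩
    obtain ⟨rfl, rfl⟩ := Prod.mk.inj e
    rwa [add_sub_cancel_right]
  · exact fun h => ⟨u, _, h, by rw [sub_add_cancel]⟩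

/-- If `N = (1 - B R)⁻¹`, then `R N` is the resolvent of the perturbed operator. -/
theorem IsRes.addG {G : Set (BMFun E × BMFun E)} {z : ℂ} {R C N : Op E} {b : BMFun E → BMFun E}
    (h : IsRes G z R) (hb : ∀ f, b (R f) = C f) (h1 : ∀ f, N (f - C f) = f)
    (h2 : ∀ f, N f - C (N f) = f) : IsRes (addG G b) z (R ∘L N) := by
  intro u g
  rw [mem_addG, h]
  constructor
  · intro hu
    -- With `k = z • u - (g - b u)` one has `u = R k`, hence `z • u - g = k - C k`, and `N` recovers
    -- `k`.
    have h3 : z • u - g = (z • u - (g - b u)) - C (z • u - (g - b u)) := by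
      rw [← hb, ← hu]
      abel
    rw [h3, ContinuousLinearMap.comp_apply, h1]
    exact hu
  · intro hu
    set k := N (z • u - g)
    have h3 : b u = C k := by
      rw [← hb k]
      exact congrArg b hu
    have h4 : z • u - (g - b u) = k := by
      rw [h3, ← sub_add, ← h2 (z • u - g), sub_add_cancel]
    rw [h4]
    exact hu

/-- Existence of `(1 - C)⁻¹` for `‖C‖ < 1`. -/
theorem exists_inverse_one_sub {C : Op E} (hC : ‖C‖ < 1) :
    ∃ N : Op E, (∀ f, N (f - C f) = f) ∧ ∀ f, N f - C (N f) = f := by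
  refine ⟨((Units.oneSub C hC)⁻¹ : (Op E)ˣ), fun f => ?_, fun f => ?_⟩
  · exact DFunLike.congr_fun (Units.inv_mul (Units.oneSub C hC)) f
  · exact DFunLike.congr_fun (Units.mul_inv (Units.oneSub C hC)) f

theorem KSemigroup.comp_lap_comm {T : ℝ → Op E} {c w : ℝ} (h : KSemigroup T c w) {l : ℝ}
    (hl : w < l) (t : ℝ) : T t ∘L lap T l = lap T l ∘L T t := by
  rcases le_or_gt t 0 with ht | ht
  · rw [h.zero t ht, ContinuousLinearMap.zero_comp, ContinuousLinearMap.comp_zero]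
  have hI := h.integrableFamily (z := (l : ℂ)) (by simpa using hl)
  rw [lap, ← hI.opIntegral_comp_left (h.bpc t) (h.real t), ← hI.opIntegral_comp_right (h.bpc t)]
  congr 1
  ext1 s
  rw [ContinuousLinearMap.comp_smul, ContinuousLinearMap.smul_comp]
  rcases le_or_gt s 0 with hs | hs
  · rw [h.zero s hs, ContinuousLinearMap.zero_comp, ContinuousLinearMap.comp_zero]
  · rw [← h.mul s t hs ht, ← h.mul t s ht hs, add_comm]

end Resolvent

/-! ### Strong Feller semigroups and approximation by the resolvent -/

section Continuous

variable {E : Type*} [MeasurableSpace E] [TopologicalSpace E]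

/-- A semigroup of strong Feller kernel operators that is stochastically continuous on continuous
functions. -/
structure SFSemigroup (T : ℝ → Op E) (c w : ℝ) : Prop extends KSemigroup T c w where
  strongFeller : ∀ t, 0 < t → ∀ f, Continuous (T t f)
  tendsto : ∀ f : BMFun E, Continuous f → ∀ x, Tendsto (fun t => T t f x) (𝓝[>] 0) (𝓝 (f x))

namespace SFSemigroup

variable {T : ℝ → Op E} {c w : ℝ}

theorem c_nonneg (h : SFSemigroup T c w) : 0 ≤ c := by
  have := (norm_nonneg _).trans (h.bound 0)
  simpa using this

/-- The substitution `r = l t` turns `l R(l) f` into `∫₀^∞ e^{-r} T(r/l) f dr`, and stochastic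
continuity allows dominated convergence. The choice `l = |w| + 1 + n` keeps `l > 0` and `l - w ≥ 1`.
-/
theorem bTendsto_lap (h : SFSemigroup T c w) {f : BMFun E} (hf : Continuous f) :
    BTendsto (fun n : ℕ => ((|w| + 1 + n : ℝ) : ℂ) • lap T ((|w| + 1 + n : ℝ) : ℂ) f) f := by
  have hw : ∀ n : ℕ, 1 ≤ |w| + 1 + n - w := fun n => by
    have := le_abs_self w
    have : (0 : ℝ) ≤ n := n.cast_nonneg
    linarith
  have hl : ∀ n : ℕ, 0 < |w| + 1 + (n : ℝ) := fun n => by positivity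
  have hc := h.c_nonneg
  refine ⟨⟨c * (1 + |w|) * ‖f‖, fun n => ?_⟩, fun x => ?_⟩
  · rw [norm_smul, Complex.norm_real, Real.norm_of_nonneg (hl n).le]
    have h1 := h.norm_lap_le (z := ((|w| + 1 + n : ℝ) : ℂ)) (by
      rw [Complex.ofReal_re]
      linarith [hw n])
    rw [Complex.ofReal_re] at h1
    calc (|w| + 1 + n) * ‖lap T ((|w| + 1 + n : ℝ) : ℂ) f‖
        ≤ (|w| + 1 + n) * (c / (|w| + 1 + n - w) * ‖f‖) := by
          gcongr
          exact (ContinuousLinearMap.le_opNorm _ _).trans (by gcongr)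
      _ = c * ((|w| + 1 + n) / (|w| + 1 + n - w)) * ‖f‖ := by ring
      _ ≤ c * (1 + |w|) * ‖f‖ := by
          gcongr
          -- Since `l - w ≥ 1`, one has `l = (l - w) + w ≤ (1 + |w|)(l - w)`.
          rw [div_le_iff₀ (by linarith [hw n])]
          nlinarith [hw n, abs_nonneg w, le_abs_self w]
  -- As `l ≥ |w| + 1`, the growth of `T(r/l)` is at most `e^{θ r}` with `θ < 1`, which `e^{-r}`
  -- dominates uniformly in `n`.
  · set θ := |w| / (|w| + 1)
    have hθ : θ < 1 := (div_lt_one (by positivity)).2 (by linarith)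
    have e1 : ∀ n : ℕ, (((|w| + 1 + n : ℝ) : ℂ) • lap T ((|w| + 1 + n : ℝ) : ℂ) f) x =
        ∫ r in Set.Ioi (0 : ℝ), Complex.exp (-r) * T ((|w| + 1 + n : ℝ)⁻¹ * r) f x := by
      intro n
      rw [BMFun.smul_apply, h.lap_apply_Ioi (by rw [Complex.ofReal_re]; linarith [hw n])]
      have := integral_comp_mul_left_Ioi' (fun r : ℝ => Complex.exp (-r) *
        T ((|w| + 1 + n : ℝ)⁻¹ * r) f x) 0 (hl n)
      rw [mul_zero] at this
      rw [← this, Complex.real_smul]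
      congr 2
      ext t
      rw [inv_mul_cancel_left₀ (hl n).ne', Complex.ofReal_mul]
    simp only [e1]
    have e2 : f x = ∫ r in Set.Ioi (0 : ℝ), Complex.exp (-r) * f x := by
      have := integral_exp_mul_complex_Ioi (a := -1) (by simp) 0
      simp only [neg_mul, one_mul] at this
      rw [integral_mul_const, this]
      simp
    rw [e2]
    refine tendsto_integral_of_dominated_convergence
      (fun r => c * ‖f‖ * Real.exp (-(1 - θ) * r)) (fun n => ?_) ?_ (fun n => ?_) ?_
    · refine (Measurable.mul (by fun_prop) ?_).aestronglyMeasurable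
      exact (h.meas f).comp ((measurable_const_mul _).prodMk measurable_const)
    · exact (integrableOn_exp_mul_Ioi (by linarith) 0).const_mul _
    · refine (ae_restrict_iff' measurableSet_Ioi).2 (Eventually.of_forall fun r (hr : 0 < r) => ?_)
      have h1 : ‖Complex.exp (-(r : ℂ))‖ = Real.exp (-r) := by
        rw [Complex.norm_exp]
        simp
      rw [norm_mul, h1]
      have h2 : w * ((|w| + 1 + n : ℝ)⁻¹ * r) ≤ θ * r := by
        rw [← mul_assoc]
        gcongr
        rw [← div_eq_mul_inv]
        have : (0 : ℝ) ≤ n := n.cast_nonneg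
        calc w / (|w| + 1 + n) ≤ |w| / (|w| + 1 + n) := by gcongr; exact le_abs_self w
          _ ≤ |w| / (|w| + 1) :=
            div_le_div_of_nonneg_left (abs_nonneg w) (by positivity) (by linarith)
      calc Real.exp (-r) * ‖T ((|w| + 1 + n : ℝ)⁻¹ * r) f x‖
          ≤ Real.exp (-r) * (c * Real.exp (θ * r) * ‖f‖) := by
            gcongr
            exact (Op.norm_apply_apply_le _ _ _).trans
              (by
                gcongr
                exact (h.bound _).trans (mul_le_mul_of_nonneg_left (Real.exp_le_exp.2 h2) hc))
        _ = c * ‖f‖ * (Real.exp (-r) * Real.exp (θ * r)) := by ring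
        _ = _ := by rw [← Real.exp_add]; ring_nf
    · refine (ae_restrict_iff' measurableSet_Ioi).2 (Eventually.of_forall fun r (hr : 0 < r) => ?_)
      refine tendsto_const_nhds.mul ((h.tendsto f hf x).comp ?_)
      refine tendsto_nhdsWithin_iff.2 ⟨?_, Eventually.of_forall fun n => ?_⟩
      · have : Tendsto (fun n : ℕ => (|w| + 1 + n : ℝ)⁻¹) atTop (𝓝 0) :=
          tendsto_inv_atTop_zero.comp (tendsto_atTop_add_const_left _ _ tendsto_natCast_atTop_atTop)
        simpa using this.mul_const r
      · exact mul_pos (inv_pos.2 (hl n)) hr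

/-- Kernel operators that coincide on the range of the resolvent are equal. -/
theorem ext_of_comp_lap [HasOuterApproxClosed E] [BorelSpace E] (h : SFSemigroup T c w) {A A' : Op E}
    (hA : IsBPC A) (hA' : IsBPC A') {l : ℝ} (hl : w < l)
    (heq : A ∘L lap T l = A' ∘L lap T l) : A = A' := by
  -- All resolvents have the same range, so agreement on one range gives agreement on all. Then `l'
  -- R(l') f → f` reaches every continuous `f`.
  have h2 : ∀ (l' : ℝ), w < l' → ∀ f, A (lap T l' f) = A' (lap T l' f) := by
    intro l' hl' f
    rw [(h.isRes (z := (l : ℂ)) (by simpa using hl)).identity_apply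
      (h.isRes (z := (l' : ℂ)) (by simpa using hl')) f]
    exact DFunLike.congr_fun heq _
  refine hA.ext_of_continuous hA' fun f hf => BMFun.ext fun x => ?_
  have hb := h.bTendsto_lap hf
  refine tendsto_nhds_unique (hA _ _ hb x) ?_
  have h3 : ∀ n : ℕ, A (((|w| + 1 + n : ℝ) : ℂ) • lap T ((|w| + 1 + n : ℝ) : ℂ) f) =
      A' (((|w| + 1 + n : ℝ) : ℂ) • lap T ((|w| + 1 + n : ℝ) : ℂ) f) := fun n => by
    rw [map_smul, map_smul, h2]
    have := le_abs_self w
    have : (0 : ℝ) ≤ n := n.cast_nonneg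
    linarith
  simp only [h3]
  exact hA' _ _ hb x

end SFSemigroup

end Continuous

/-! ### Convolution of operator families -/

section Convolution

variable {E : Type*} [MeasurableSpace E]

/-- The convolution `∫ P(t - s) K(s) ds` of two families of operators. -/
noncomputable def conv (P K : ℝ → Op E) (t : ℝ) : Op E :=
  opIntegral fun s => P (t - s) ∘L K s

/-- A kernel family `K` with `‖K(t)‖ ≤ ψ(t)`, where `e^{-lt} ψ(t)` is integrable. -/
structure MajFamily (K : ℝ → Op E) (ψ : ℝ → ℝ) (l : ℝ) : Prop extends KernelFamily K where
  bound : ∀ t, ‖K t‖ ≤ ψ t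
  int : Integrable fun t => Real.exp (-(l * t)) * ψ t

variable {P K : ℝ → Op E} {ψ : ℝ → ℝ} {c l : ℝ}

theorem MajFamily.nonneg (hK : MajFamily K ψ l) (t : ℝ) : 0 ≤ ψ t :=
  (norm_nonneg _).trans (hK.bound t)

theorem MajFamily.integral_nonneg (hK : MajFamily K ψ l) :
    0 ≤ ∫ t, Real.exp (-(l * t)) * ψ t :=
  MeasureTheory.integral_nonneg fun t => mul_nonneg (Real.exp_pos _).le (hK.nonneg t)

theorem ExpFamily.c_nonneg (hP : ExpFamily P c l) : 0 ≤ c := by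
  simpa using (norm_nonneg _).trans (hP.bound 0)

theorem measurable_conv_integrand (hP : KernelFamily P) (hK : KernelFamily K) (f : BMFun E) :
    Measurable fun p : (ℝ × ℝ) × E => P (p.1.1 - p.1.2) (K p.1.2 f) p.2 :=
  measurable_apply (P := fun a : ℝ × ℝ => P (a.1 - a.2)) (h := fun a => K a.2 f)
    (fun _ => hP.bpc _)
    (fun f => (hP.meas f).comp ((measurable_fst.fst.sub measurable_fst.snd).prodMk measurable_snd))
    ((hK.meas f).comp (measurable_fst.snd.prodMk measurable_snd))

/-- Splitting `e^{l(t-s)} = e^{lt} e^{-ls}` leaves the weighted majorant of `K`. The range `0 < s <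
t` is implicit, because both families vanish at nonpositive times. -/
theorem convFamily (hP : ExpFamily P c l) (hK : MajFamily K ψ l) (t : ℝ) :
    IntegrableFamily (fun s => P (t - s) ∘L K s)
      fun s => c * Real.exp (l * t) * (Real.exp (-(l * s)) * ψ s) where
  bpc s := (hP.bpc _).comp (hK.bpc _)
  meas f := (measurable_conv_integrand hP.toKernelFamily hK.toKernelFamily f).comp
    (f := fun p : ℝ × E => ((t, p.1), p.2)) (by fun_prop)
  bound s := by
    have hc := hP.c_nonneg
    refine (ContinuousLinearMap.opNorm_comp_le _ _).trans ?_
    calc ‖P (t - s)‖ * ‖K s‖ ≤ c * Real.exp (l * (t - s)) * ψ s := by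
          gcongr
          · exact hP.bound _
          · exact hK.bound _
      _ = _ := by rw [mul_assoc, mul_assoc, ← mul_assoc (Real.exp _), ← Real.exp_add]; ring_nf
  int := hK.int.const_mul _

theorem conv_apply (hP : ExpFamily P c l) (hK : MajFamily K ψ l) (t : ℝ) (f : BMFun E) (x : E) :
    conv P K t f x = ∫ s, P (t - s) (K s f) x :=
  (convFamily hP hK t).apply f x

/-- Convolution with `K` keeps the exponent `l` and multiplies the constant by the weighted integral
of `ψ`; iteration is therefore geometric. -/
theorem ExpFamily.conv (hP : ExpFamily P c l) (hK : MajFamily K ψ l) :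
    ExpFamily (conv P K) (c * ∫ t, Real.exp (-(l * t)) * ψ t) l where
  zero t ht := by
    refine ContinuousLinearMap.ext fun f => BMFun.ext fun x => ?_
    rw [conv_apply hP hK]
    refine (integral_congr_ae (Eventually.of_forall fun s => ?_)).trans (integral_zero _ _)
    rcases le_or_gt s 0 with hs | hs
    · simp only [hK.zero s hs, zero_apply, map_zero, BMFun.zero_apply]
    · simp only [hP.zero (t - s) (by linarith), zero_apply, BMFun.zero_apply]
  bpc t := (convFamily hP hK t).isBPC
  real t := (convFamily hP hK t).isRealOp fun s => (hP.real _).comp (hK.real _)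
  meas f := by
    simp only [conv_apply hP hK]
    have := ((measurable_conv_integrand hP.toKernelFamily hK.toKernelFamily f).comp
      (f := fun p : (ℝ × E) × ℝ => ((p.1.1, p.2), p.1.2)) (by fun_prop))
    exact (this.stronglyMeasurable.integral_prod_right
      (f := fun (p : ℝ × E) (s : ℝ) => P (p.1 - s) (K s f) p.2)).measurable
  bound t := by
    refine (convFamily hP hK t).norm_opIntegral_le.trans_eq ?_
    rw [integral_const_mul]
    ring

/-- The strong Feller property of the left factor suffices: each `P(t-s) K(s) f` is continuous in
`x`, and dominated convergence passes this to the integral. Nothing is required of `K(s) f` beyond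
boundedness and measurability. -/
theorem continuous_conv [TopologicalSpace E] [FirstCountableTopology E] (hP : ExpFamily P c l)
    (hK : MajFamily K ψ l) (hc : ∀ t, 0 < t → ∀ f, Continuous (P t f)) (t : ℝ) (f : BMFun E) :
    Continuous (conv P K t f) := by
  refine (convFamily hP hK t).continuous fun s => ?_
  rcases le_or_gt (t - s) 0 with h | h
  · rw [hP.zero _ h]
    exact continuous_const (y := (0 : ℂ))
  · exact hc _ h _

/-- The convolution theorem: Fubini's theorem and the translation `t ↦ t + s`. The strict inequality
`l < l'` makes the integrand integrable on the plane. -/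
theorem lap_conv (hP : ExpFamily P c l) (hK : MajFamily K ψ l) {l' : ℝ} (hl : l < l')
    (hi : Integrable fun t => Real.exp (-(l' * t)) * ψ t) :
    lap (conv P K) l' = lap P l' ∘L lap K l' := by
  refine ContinuousLinearMap.ext fun f => BMFun.ext fun x => ?_
  have hl' : l < ((l' : ℝ) : ℂ).re := by simpa using hl
  have hKf := hK.toKernelFamily.integrableFamily (z := (l' : ℂ)) hK.bound (by simpa using hi)
  rw [ContinuousLinearMap.comp_apply, (hP.conv hK).lap_apply hl']
  simp only [conv_apply hP hK, ← integral_const_mul]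
  set F : ℝ → ℝ → ℂ := fun t s => Complex.exp (-(l' * t)) * P (t - s) (K s f) x
  have hF : Integrable (Function.uncurry F) (volume.prod volume) := by
    have h1 : Integrable (fun p : ℝ × ℝ => (Real.exp (-(l' * p.2)) * ψ p.2 * ‖f‖) *
        (Real.exp (-(l' * (p.1 - p.2))) *
        (Set.Ioi (0 : ℝ)).indicator (fun t => c * Real.exp (l * t)) (p.1 - p.2)))
        (volume.prod volume) :=
      Integrable.convolution_integrand (ContinuousLinearMap.mul ℝ ℝ) (hi.mul_const ‖f‖)
        (integrable_exp_indicator hl)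
    refine h1.mono' ?_ (Eventually.of_forall fun p => ?_)
    · refine Measurable.aestronglyMeasurable (Measurable.mul (by fun_prop) ?_)
      exact (measurable_conv_integrand hP.toKernelFamily hK.toKernelFamily f).comp
        (f := fun p : ℝ × ℝ => ((p.1, p.2), x)) (by fun_prop)
    · simp only [F, Function.uncurry]
      rw [norm_mul, norm_cexp_neg_mul, Complex.ofReal_re]
      have h2 := (Op.norm_apply_apply_le (P (p.1 - p.2)) (K p.2 f) x).trans
        (mul_le_mul (hP.bound_indicator (p.1 - p.2)) (((K p.2).le_opNorm f).trans
          (mul_le_mul_of_nonneg_right (hK.bound p.2) (norm_nonneg f))) (norm_nonneg _)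
          ((norm_nonneg _).trans (hP.bound_indicator _)))
      refine (mul_le_mul_of_nonneg_left h2 (Real.exp_pos _).le).trans_eq ?_
      have h3 : Real.exp (-(l' * p.1)) =
          Real.exp (-(l' * p.2)) * Real.exp (-(l' * (p.1 - p.2))) := by
        rw [← Real.exp_add]
        ring_nf
      rw [h3]
      ring
  rw [integral_integral_swap hF]
  have h4 : ∀ s, ∫ t, F t s = lap P l' (Complex.exp (-(l' * s)) • K s f) x := by
    intro s
    rw [hP.lap_apply hl', ← integral_add_right_eq_self (fun t => F t s) s]
    refine integral_congr_ae (Eventually.of_forall fun t => ?_)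
    simp only [F]
    rw [map_smul, BMFun.smul_apply, ← mul_assoc, ← Complex.exp_add, add_sub_cancel_right]
    congr 2
    push_cast
    ring
  simp only [h4]
  -- What remains is to pull the kernel operator `lap P l'` out of the integral over `s`.
  refine ((hP.isBPC_lap hl').integral_comm (hP.isRealOp_lap hl) (hKf.meas f)
    (b := fun t => Real.exp (-(((l' : ℝ) : ℂ).re * t)) * ψ t * ‖f‖) (fun t => ?_)
    (hKf.int.mul_const _) (hKf.apply f) x).symm
  exact (ContinuousLinearMap.le_opNorm _ f).trans (by gcongr; exact hKf.bound t)

end Convolution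

/-! ### The Dyson–Phillips series -/

section Series

variable {E : Type*} [MeasurableSpace E]

/-- The terms of the Dyson–Phillips series. -/
noncomputable def dyson (T K : ℝ → Op E) : ℕ → ℝ → Op E
  | 0 => T
  | n + 1 => conv (dyson T K n) K

/-- The sum of the Dyson–Phillips series. -/
noncomputable def dysonSum (T K : ℝ → Op E) (t : ℝ) : Op E := ∑' n, dyson T K n t

variable {T K : ℝ → Op E} {ψ : ℝ → ℝ} {c l q : ℝ}

theorem expFamily_dyson (hT : ExpFamily T c l) (hK : MajFamily K ψ l)
    (hq : ∫ t, Real.exp (-(l * t)) * ψ t = q) (n : ℕ) :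
    ExpFamily (dyson T K n) (c * q ^ n) l := by
  induction n with
  | zero => simpa [dyson] using hT
  | succ n ih =>
    have := ih.conv hK
    rw [hq, mul_assoc, ← pow_succ] at this
    exact this

theorem summable_dyson_bound (hq0 : 0 ≤ q) (hq1 : q < 1) (a : ℝ) :
    Summable fun n : ℕ => c * q ^ n * a :=
  ((summable_geometric_of_lt_one hq0 hq1).mul_left c).mul_right a

theorem tsum_dyson_bound (hq0 : 0 ≤ q) (hq1 : q < 1) (a : ℝ) :
    ∑' n : ℕ, c * q ^ n * a = c / (1 - q) * a := by
  rw [tsum_mul_right, tsum_mul_left, tsum_geometric_of_lt_one hq0 hq1, div_eq_mul_inv]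

theorem hasSum_dyson (hT : ExpFamily T c l) (hK : MajFamily K ψ l)
    (hq : ∫ t, Real.exp (-(l * t)) * ψ t = q) (hq1 : q < 1) (t : ℝ) :
    HasSum (fun n => dyson T K n t) (dysonSum T K t) :=
  (Summable.of_norm_bounded (summable_dyson_bound (hq ▸ hK.integral_nonneg) hq1 _)
    fun n => (expFamily_dyson hT hK hq n).bound t).hasSum

theorem hasSum_dyson_apply (hT : ExpFamily T c l) (hK : MajFamily K ψ l)
    (hq : ∫ t, Real.exp (-(l * t)) * ψ t = q) (hq1 : q < 1) (t : ℝ) (f : BMFun E) (x : E) :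
    HasSum (fun n => dyson T K n t f x) (dysonSum T K t f x) :=
  (hasSum_dyson hT hK hq hq1 t).mapL
    (BMFun.eval x ∘L ContinuousLinearMap.apply ℂ (BMFun E) f)

theorem norm_dyson_apply_le (hT : ExpFamily T c l) (hK : MajFamily K ψ l)
    (hq : ∫ t, Real.exp (-(l * t)) * ψ t = q) (n : ℕ) (t : ℝ) (f : BMFun E) (x : E) :
    ‖dyson T K n t f x‖ ≤ c * q ^ n * (Real.exp (l * t) * ‖f‖) :=
  (Op.norm_apply_apply_le _ _ _).trans
    ((mul_le_mul_of_nonneg_right ((expFamily_dyson hT hK hq n).bound t)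
      (norm_nonneg f)).trans_eq (by ring))

theorem expFamily_dysonSum (hT : ExpFamily T c l) (hK : MajFamily K ψ l)
    (hq : ∫ t, Real.exp (-(l * t)) * ψ t = q) (hq1 : q < 1) :
    ExpFamily (dysonSum T K) (c / (1 - q)) l where
  zero t ht := by
    simp only [dysonSum, (expFamily_dyson hT hK hq _).zero t ht, tsum_zero]
  bpc t := by
    intro f g hfg x
    obtain ⟨C, hC⟩ := hfg.1
    simp only [← (hasSum_dyson_apply hT hK hq hq1 _ _ _).tsum_eq]
    have hq0 : 0 ≤ q := hq ▸ hK.integral_nonneg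
    have hc := hT.c_nonneg
    refine tendsto_tsum_of_dominated_convergence
      (summable_dyson_bound (c := c) hq0 hq1 (Real.exp (l * t) * C))
      (fun n => (expFamily_dyson hT hK hq n).bpc t f g hfg x) (Eventually.of_forall fun k n => ?_)
    refine (norm_dyson_apply_le hT hK hq n t (f k) x).trans ?_
    gcongr
    exact hC k
  real t := by
    intro f hf x
    have := (hasSum_dyson_apply hT hK hq hq1 t f x).mapL Complex.imCLM
    simp only [Complex.imCLM_apply, (expFamily_dyson hT hK hq _).real t f hf] at this
    exact this.unique hasSum_zero
  meas f := by
    refine measurable_of_tendsto_metrizable (f := fun n (p : ℝ × E) =>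
      ∑ i ∈ Finset.range n, dyson T K i p.1 f p.2)
      (fun n => Finset.measurable_sum _ fun i _ => (expFamily_dyson hT hK hq i).meas f) ?_
    rw [tendsto_pi_nhds]
    exact fun p => (hasSum_dyson_apply hT hK hq hq1 p.1 f p.2).tendsto_sum_nat
  bound t := by
    rw [← tsum_dyson_bound (hq ▸ hK.integral_nonneg) hq1]
    exact tsum_of_norm_bounded (summable_dyson_bound (hq ▸ hK.integral_nonneg) hq1 _).hasSum
      fun n => (expFamily_dyson hT hK hq n).bound t

/-- The integral equation for the Dyson–Phillips series. -/
theorem dysonSum_eq (hT : ExpFamily T c l) (hK : MajFamily K ψ l)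
    (hq : ∫ t, Real.exp (-(l * t)) * ψ t = q) (hq1 : q < 1) (t : ℝ) :
    dysonSum T K t = T t + conv (dysonSum T K) K t := by
  have hS := expFamily_dysonSum hT hK hq hq1
  have hq0 : 0 ≤ q := hq ▸ hK.integral_nonneg
  refine ContinuousLinearMap.ext fun f => BMFun.ext fun x => ?_
  have h1 := hasSum_dyson_apply hT hK hq hq1 t f x
  rw [← hasSum_nat_add_iff' 1] at h1
  simp only [Finset.range_one, Finset.sum_singleton, dyson] at h1
  -- Shifting the index by one turns the series minus its first term into a sum of convolutions;
  -- dominated convergence exchanges that sum with the integral.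
  have h2 : HasSum (fun n => conv (dyson T K n) K t f x) (conv (dysonSum T K) K t f x) := by
    rw [conv_apply hS hK]
    simp only [conv_apply (expFamily_dyson hT hK hq _) hK]
    have hb : ∀ s (n : ℕ), ‖dyson T K n (t - s) (K s f) x‖ ≤
        c * q ^ n * (Real.exp (l * (t - s)) * (ψ s * ‖f‖)) := by
      intro s n
      have hc := hT.c_nonneg
      refine (norm_dyson_apply_le hT hK hq n (t - s) (K s f) x).trans ?_
      gcongr
      exact ((K s).le_opNorm f).trans (by gcongr; exact hK.bound s)
    refine hasSum_integral_of_dominated_convergence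
      (fun n s => c * q ^ n * (Real.exp (l * (t - s)) * (ψ s * ‖f‖))) (fun n => ?_)
      (fun n => Eventually.of_forall fun s => hb s n)
      (Eventually.of_forall fun s => summable_dyson_bound hq0 hq1 _) ?_
      (Eventually.of_forall fun s => hasSum_dyson_apply hT hK hq hq1 _ _ _)
    · exact ((convFamily (expFamily_dyson hT hK hq n) hK t).integrable f x).aestronglyMeasurable
    · simp only [tsum_dyson_bound hq0 hq1]
      refine Integrable.const_mul ?_ _
      have := (hK.int.const_mul (Real.exp (l * t))).mul_const ‖f‖
      refine this.congr (Eventually.of_forall fun s => ?_)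
      simp only
      rw [← mul_assoc, ← Real.exp_add, mul_assoc]
      ring_nf
  have h3 := h1.unique h2
  rw [add_apply, BMFun.add_apply, ← h3]
  ring

end Series

/-! ### Data of an admissible perturbation -/

section Perturbation

variable {E : Type*} [MeasurableSpace E] [TopologicalSpace E]

/-- The data of a perturbation of the semigroup `T`: the family `K(t) = B T(t)`, with a majorant
`ψ`, and the operator `C = B R(l₀)`. -/
structure Perturbation (T : ℝ → Op E) (c w : ℝ) (K : ℝ → Op E) (ψ : ℝ → ℝ) (l₁ : ℝ) (C : Op E)
    (l₀ : ℝ) : Prop where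
  semigroup : SFSemigroup T c w
  maj : MajFamily K ψ l₁
  zero : ∀ t ≤ 0, ψ t = 0
  lt : w < l₀
  bpc : IsBPC C
  real : IsRealOp C
  comp : ∀ t, 0 < t → K t ∘L lap T l₀ = C ∘L T t

end Perturbation

/-! ### Dependence of the weighted majorant on the weight -/

section Majorant

variable {E : Type*} [MeasurableSpace E]

theorem MajFamily.integrable_of_le {K : ℝ → Op E} {ψ : ℝ → ℝ} {l₁ l : ℝ} (h : MajFamily K ψ l₁)
    (h0 : ∀ t ≤ 0, ψ t = 0) (hl : l₁ ≤ l) : Integrable fun t => Real.exp (-(l * t)) * ψ t := by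
  -- The factor relating the two weights is bounded only for `t ≥ 0`; `max t 0` makes it bounded
  -- everywhere, which is harmless because `ψ` vanishes elsewhere.
  have h1 : Integrable fun t => Real.exp (-(l - l₁) * max t 0) * (Real.exp (-(l₁ * t)) * ψ t) := by
    refine h.int.bdd_mul (c := 1) (Measurable.aestronglyMeasurable (by fun_prop))
      (Eventually.of_forall fun t => ?_)
    rw [Real.norm_of_nonneg (Real.exp_pos _).le, Real.exp_le_one_iff]
    exact mul_nonpos_of_nonpos_of_nonneg (by linarith) (le_max_right _ _)
  refine h1.congr (Eventually.of_forall fun t => ?_)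
  rcases le_or_gt t 0 with ht | ht
  · simp [h0 t ht]
  · simp only [max_eq_left ht.le]
    rw [← mul_assoc, ← Real.exp_add]
    ring_nf

theorem MajFamily.of_le {K : ℝ → Op E} {ψ : ℝ → ℝ} {l₁ l : ℝ} (h : MajFamily K ψ l₁)
    (h0 : ∀ t ≤ 0, ψ t = 0) (hl : l₁ ≤ l) : MajFamily K ψ l :=
  ⟨h.toKernelFamily, h.bound, h.integrable_of_le h0 hl⟩

/-- Dominated convergence as the weight grows. This is the source of `q < 1` and of the smallness of
`B R(l)`. -/
theorem MajFamily.tendsto_integral {K : ℝ → Op E} {ψ : ℝ → ℝ} {l₁ : ℝ} (h : MajFamily K ψ l₁)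
    (h0 : ∀ t ≤ 0, ψ t = 0) :
    Tendsto (fun l => ∫ t, Real.exp (-(l * t)) * ψ t) atTop (𝓝 0) := by
  have : (0 : ℝ) = ∫ _ : ℝ, (0 : ℝ) := (integral_zero _ _).symm
  rw [this]
  refine tendsto_integral_filter_of_dominated_convergence
    (fun t => Real.exp (-(l₁ * t)) * ψ t) ?_ ?_ h.int (Eventually.of_forall fun t => ?_)
  · filter_upwards [eventually_ge_atTop l₁] with l hl
    exact (h.integrable_of_le h0 hl).aestronglyMeasurable
  · filter_upwards [eventually_ge_atTop l₁] with l hl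
    refine Eventually.of_forall fun t => ?_
    rw [Real.norm_of_nonneg (mul_nonneg (Real.exp_pos _).le (h.nonneg t))]
    rcases le_or_gt t 0 with ht | ht
    · simp [h0 t ht]
    · have := h.nonneg t
      gcongr
  · rcases le_or_gt t 0 with ht | ht
    · simp [h0 t ht]
    · have h1 : Tendsto (fun l : ℝ => Real.exp (-(l * t))) atTop (𝓝 0) :=
        Real.tendsto_exp_neg_atTop_nhds_zero.comp (tendsto_id.atTop_mul_const ht)
      simpa using h1.mul_const (ψ t)

end Majorant

/-! ### The perturbed semigroup and its generator -/

section Perturbation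

variable {E : Type*} [MeasurableSpace E] [TopologicalSpace E]

/-- If `K(t) = B T(t)`, then `K(t + s) = K(t) T(s)`. -/
theorem SFSemigroup.comp_add [HasOuterApproxClosed E] [BorelSpace E] {T K : ℝ → Op E}
    {c w l₀ : ℝ} {C : Op E} (hT : SFSemigroup T c w) (hK : KernelFamily K) (hl : w < l₀)
    (hC : ∀ t, 0 < t → K t ∘L lap T l₀ = C ∘L T t) {s t : ℝ} (hs : 0 < s) (ht : 0 < t) :
    K (t + s) = K t ∘L T s := by
  -- `K(t)` is known only through `K(t) R(l₀) = C T(t)`. After composition with `R(l₀)` both sides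
  -- equal `C T(t) T(s)`, and `R(l₀)` may be cancelled.
  refine hT.ext_of_comp_lap (hK.bpc _) ((hK.bpc t).comp (hT.bpc s)) hl ?_
  rw [ContinuousLinearMap.comp_assoc, hT.comp_lap_comm hl, ← ContinuousLinearMap.comp_assoc,
    hC t ht, hC _ (add_pos ht hs), hT.mul s t hs ht, ContinuousLinearMap.comp_assoc]

namespace Perturbation

variable {T K : ℝ → Op E} {c w l₁ l₀ : ℝ} {ψ : ℝ → ℝ} {C : Op E}

theorem comp' (h : Perturbation T c w K ψ l₁ C l₀) (t : ℝ) : K t ∘L lap T l₀ = C ∘L T t := by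
  rcases le_or_gt t 0 with ht | ht
  · rw [h.maj.zero t ht, h.semigroup.zero t ht, ContinuousLinearMap.zero_comp,
      ContinuousLinearMap.comp_zero]
  · exact h.comp t ht

theorem expFamily_of_le (h : Perturbation T c w K ψ l₁ C l₀) {l : ℝ} (hl : w ≤ l) :
    ExpFamily T c l where
  toKernelFamily := h.semigroup.toKernelFamily
  bound t := by
    have hc := h.semigroup.c_nonneg
    rcases le_or_gt t 0 with ht | ht
    · rw [h.semigroup.zero t ht, norm_zero]
      positivity
    · exact (h.semigroup.bound t).trans (by gcongr)

/-- The Laplace transform of the perturbed semigroup. -/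
theorem lap_dysonSum (h : Perturbation T c w K ψ l₁ C l₀) {l q : ℝ} (hl : w ≤ l)
    (hl₁ : l₁ ≤ l) (hq : ∫ t, Real.exp (-(l * t)) * ψ t = q) (hq1 : q < 1) {l' : ℝ} (hl' : l < l') :
    lap (dysonSum T K) l' = lap T l' + lap (dysonSum T K) l' ∘L lap K l' := by
  have hT := h.expFamily_of_le hl
  have hK := h.maj.of_le h.zero hl₁
  have hS := expFamily_dysonSum hT hK hq hq1
  have hlr : l < ((l' : ℝ) : ℂ).re := by simpa using hl'
  rw [← lap_conv hS hK hl' (h.maj.integrable_of_le h.zero (hl₁.trans hl'.le))]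
  refine ContinuousLinearMap.ext fun f => BMFun.ext fun x => ?_
  rw [add_apply, BMFun.add_apply, hS.lap_apply hlr, hT.lap_apply hlr, (hS.conv hK).lap_apply hlr,
    ← integral_add (hT.integrable hlr f x) ((hS.conv hK).integrable hlr f x)]
  congr 1
  ext t
  conv_lhs => rw [dysonSum_eq hT hK hq hq1 t]
  rw [add_apply, BMFun.add_apply, mul_add]

theorem norm_lap_K_le (h : Perturbation T c w K ψ l₁ C l₀) {l : ℝ} (hl₁ : l₁ ≤ l) :
    ‖lap K l‖ ≤ ∫ t, Real.exp (-(l * t)) * ψ t := by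
  have := (h.maj.toKernelFamily.integrableFamily (z := (l : ℂ)) h.maj.bound
    (by simpa using h.maj.integrable_of_le h.zero hl₁)).norm_opIntegral_le
  simp only [Complex.ofReal_re] at this
  exact this

theorem eventually_norm_lap_K_le (h : Perturbation T c w K ψ l₁ C l₀) {ε : ℝ} (hε : 0 < ε) :
    ∀ᶠ l : ℝ in atTop, ‖lap K l‖ ≤ ε := by
  filter_upwards [eventually_ge_atTop l₁,
    (h.maj.tendsto_integral h.zero).eventually (eventually_le_nhds hε)] with l hl hl'
  exact (h.norm_lap_K_le hl).trans hl'

variable [HasOuterApproxClosed E] [BorelSpace E]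

theorem K_add (h : Perturbation T c w K ψ l₁ C l₀) {s t : ℝ} (hs : 0 < s) (ht : 0 < t) :
    K (t + s) = K t ∘L T s :=
  h.semigroup.comp_add h.maj.toKernelFamily h.lt h.comp hs ht

/-- The Laplace transform of `B T(t)` is `B R(l)`. -/
theorem lap_K (h : Perturbation T c w K ψ l₁ C l₀) {l : ℝ} (hl : w < l) (hl₁ : l₁ ≤ l) (f : BMFun E) :
    lap K l f = C (f + ((l₀ : ℂ) - l) • lap T l f) := by
  have hT := h.semigroup
  have hwl : w < ((l : ℝ) : ℂ).re := by simpa using hl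
  have hw0 : w < ((l₀ : ℝ) : ℂ).re := by simpa using h.lt
  have hi : Integrable fun t => Real.exp (-(((l : ℝ) : ℂ).re * t)) * ψ t := by
    simpa using h.maj.integrable_of_le h.zero hl₁
  have hK := h.maj.toKernelFamily.integrableFamily (z := (l : ℂ)) h.maj.bound hi
  have hL := hT.integrableFamily hwl
  have hR0 := hT.isBPC_lap hw0
  have hRl := hT.isBPC_lap hwl
  have e1 : lap K l ∘L lap T l₀ = C ∘L lap T l := by
    rw [lap, lap.eq_def T l, ← hK.opIntegral_comp_right hR0, ← hL.opIntegral_comp_left h.bpc h.real]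
    congr 1
    ext1 t
    rw [ContinuousLinearMap.smul_comp, ContinuousLinearMap.comp_smul, h.comp']
  -- By the resolvent identity, `C R(l)` in `e1` equals the right-hand side composed with `R(l₀)`,
  -- since resolvents commute; then `R(l₀)` is cancelled.
  have e2 : lap K l = C + ((l₀ : ℂ) - l) • (C ∘L lap T l) := by
    refine hT.ext_of_comp_lap hK.isBPC (h.bpc.add ((h.bpc.comp hRl).smul _)) h.lt ?_
    have hid := (hT.isRes hw0).identity (hT.isRes hwl)
    have hcomm := (hT.isRes hw0).comm (hT.isRes hwl)
    rw [e1, ContinuousLinearMap.add_comp, ContinuousLinearMap.smul_comp,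
      ContinuousLinearMap.comp_assoc, ← hcomm]
    conv_lhs => rw [hid]
    rw [ContinuousLinearMap.comp_add, ContinuousLinearMap.comp_smul]
  rw [e2, map_add, map_smul]
  rfl

/-- The semigroup law for the Dyson–Phillips series. -/
theorem dysonSum_add (h : Perturbation T c w K ψ l₁ C l₀) {l q : ℝ} (hl : w ≤ l) (hl₁ : l₁ ≤ l)
    (hq : ∫ t, Real.exp (-(l * t)) * ψ t = q) (hq1 : q < 1) {s t : ℝ} (hs : 0 < s) (ht : 0 < t) :
    dysonSum T K (t + s) = dysonSum T K t ∘L dysonSum T K s := by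
  have hT := h.expFamily_of_le hl
  have hK := h.maj.of_le h.zero hl₁
  have hq0 : 0 ≤ q := hq ▸ hK.integral_nonneg
  have hS := expFamily_dysonSum hT hK hq hq1
  have heq := dysonSum_eq hT hK hq hq1
  set S := dysonSum T K
  set W : ℝ → Op E := fun u => S (t + u) - S t ∘L S u with hW
  -- The defect of the semigroup law satisfies a homogeneous Volterra equation in `u`: the
  -- inhomogeneous terms coming from `S = T + S*K` cancel.
  have hWeq : ∀ u, 0 < u → ∀ f x, W u f x = ∫ r in Set.Iio u, W (u - r) (K r f) x := by
    intro u hu f x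
    have hF1 := convFamily hS hK (t + u)
    have hF2 := convFamily hS hK u
    have hF3 := hF2.comp_left (hS.bpc t)
    have i1 : Integrable fun r => S (t + u - r) (K r f) x := hF1.integrable f x
    have i3 : Integrable fun r => S t (S (u - r) (K r f)) x := hF3.integrable f x
    have e1 : S (t + u) f x = T (t + u) f x + ∫ r, S (t + u - r) (K r f) x := by
      conv_lhs => rw [heq (t + u)]
      rw [add_apply, BMFun.add_apply, conv_apply hS hK]
    -- Beyond `u`, shift `r` by `u` and use `K(r + u) = K(r) T(u)`: the tail is the convolution term
    -- of `S(t)` evaluated at `T(u) f`.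
    have e2 : ∫ r in Set.Ici u, S (t + u - r) (K r f) x =
        S t (T u f) x - T t (T u f) x := by
      have e3 : S t (T u f) x - T t (T u f) x = ∫ r, S (t - r) (K r (T u f)) x := by
        conv_lhs => rw [heq t]
        rw [add_apply, BMFun.add_apply, conv_apply hS hK, add_sub_cancel_left]
      rw [e3, integral_Ici_eq_integral_Ioi]
      have := (measurePreserving_add_right volume u).setIntegral_preimage_emb
        (measurableEmbedding_addRight u) (fun r : ℝ => S (t + u - r) (K r f) x) (Set.Ioi u)
      rw [← this, Set.preimage_add_const_Ioi, sub_self, ← integral_indicator measurableSet_Ioi]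
      congr 1
      ext r
      by_cases hr : r ∈ Set.Ioi (0 : ℝ)
      · rw [Set.indicator_of_mem hr, h.K_add hu hr, add_sub_add_right_eq_sub]
        rfl
      · rw [Set.indicator_of_notMem hr, h.maj.zero r (not_lt.1 hr)]
        simp
    have e4 : S t (S u f) x = S t (T u f) x + ∫ r in Set.Iio u, S t (S (u - r) (K r f)) x := by
      conv_lhs => rw [heq u]
      rw [add_apply, map_add, BMFun.add_apply]
      congr 1
      have := hF2.opIntegral_comp_left (hS.bpc t) (hS.real t)
      have h2 : S t (conv S K u f) = (S t ∘L opIntegral fun s => S (u - s) ∘L K s) f := rfl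
      rw [h2, ← this, hF3.apply, ← integral_indicator measurableSet_Iio]
      congr 1
      ext r
      by_cases hr : r ∈ Set.Iio u
      · rw [Set.indicator_of_mem hr]
        rfl
      · rw [Set.indicator_of_notMem hr]
        change S t (S (u - r) (K r f)) x = 0
        rw [hS.zero (u - r) (sub_nonpos.2 (not_lt.1 hr))]
        simp
    have e5 : T (t + u) f x = T t (T u f) x := by
      rw [h.semigroup.mul u t hu ht]
      rfl
    have e6 : ∫ r in Set.Iio u, W (u - r) (K r f) x =
        (∫ r in Set.Iio u, S (t + u - r) (K r f) x) -
          ∫ r in Set.Iio u, S t (S (u - r) (K r f)) x := by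
      rw [← integral_sub i1.integrableOn i3.integrableOn]
      congr 1
      ext r
      change (S (t + (u - r)) - S t ∘L S (u - r)) (K r f) x = _
      rw [sub_apply, BMFun.sub_apply, add_sub_assoc]
      rfl
    have e7 := integral_add_compl (measurableSet_Iio (a := u)) i1
    rw [Set.compl_Iio] at e7
    change (S (t + u) - S t ∘L S u) f x = _
    rw [sub_apply, BMFun.sub_apply, ContinuousLinearMap.comp_apply, e6, e4, e1, e5]
    have e8 : ∫ r, S (t + u - r) (K r f) x = (∫ r in Set.Iio u, S (t + u - r) (K r f) x) +
      ∫ r in Set.Ici u, S (t + u - r) (K r f) x := e7.symm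
    rw [e8, e2]
    ring
  have hbound : ∃ A, 0 ≤ A ∧ ∀ u, 0 < u → ‖W u‖ ≤ A * Real.exp (l * u) := by
    have hc : 0 ≤ c / (1 - q) := hS.c_nonneg
    refine ⟨c / (1 - q) * Real.exp (l * t) + c / (1 - q) * Real.exp (l * t) * (c / (1 - q)),
      by positivity, fun u _ => ?_⟩
    refine (norm_sub_le _ _).trans ?_
    have h1 := hS.bound (t + u)
    have h2 := (ContinuousLinearMap.opNorm_comp_le (S t) (S u)).trans
      (mul_le_mul (hS.bound t) (hS.bound u) (norm_nonneg _) (by positivity))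
    rw [mul_add l, Real.exp_add] at h1
    linarith
  obtain ⟨A, hA0, hA⟩ := hbound
  -- Each application of the Volterra equation gains a factor `q < 1` in the exponentially weighted
  -- norm, so `W` is zero.
  have hiter : ∀ n : ℕ, ∀ u, 0 < u → ‖W u‖ ≤ A * q ^ n * Real.exp (l * u) := by
    intro n
    induction n with
    | zero => simpa using hA
    | succ n ih =>
      intro u hu
      refine ContinuousLinearMap.opNorm_le_bound _ (by positivity) fun f => ?_
      refine BMFun.norm_le (by positivity) fun x => ?_
      rw [hWeq u hu]
      have hi : Integrable fun r =>
          A * q ^ n * Real.exp (l * u) * ‖f‖ * (Real.exp (-(l * r)) * ψ r) :=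
        hK.int.const_mul _
      refine (norm_integral_le_of_norm_le hi.integrableOn
        ((ae_restrict_iff' measurableSet_Iio).2 (Eventually.of_forall fun r (hr : r < u) => ?_))).trans
        ((setIntegral_le_integral hi (Eventually.of_forall fun r => ?_)).trans_eq ?_)
      · have h1 := (Op.norm_apply_apply_le (W (u - r)) (K r f) x).trans
          (mul_le_mul (ih (u - r) (sub_pos.2 hr)) (((K r).le_opNorm f).trans
          (mul_le_mul_of_nonneg_right (hK.bound r) (norm_nonneg f))) (norm_nonneg _)
          (by positivity))
        refine h1.trans_eq ?_
        rw [mul_sub, sub_eq_add_neg, Real.exp_add]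
        ring
      · have := hK.nonneg r
        simp only [Pi.zero_apply]
        positivity
      · rw [integral_const_mul, hq]
        ring
  have hzero : ‖W s‖ ≤ 0 := by
    have h1 : Tendsto (fun n : ℕ => A * q ^ n * Real.exp (l * s)) atTop (𝓝 (A * 0 * Real.exp (l * s))) :=
      ((tendsto_pow_atTop_nhds_zero_of_lt_one hq0 hq1).const_mul A).mul_const _
    rw [mul_zero, zero_mul] at h1
    exact ge_of_tendsto h1 (Eventually.of_forall fun n => hiter n s hs)
  exact sub_eq_zero.1 (norm_le_zero_iff.1 hzero)

variable [FirstCountableTopology E]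

/-- The perturbed semigroup. -/
theorem sfSemigroup_dysonSum (h : Perturbation T c w K ψ l₁ C l₀) {l q : ℝ} (hl : w ≤ l)
    (hl₁ : l₁ ≤ l) (hq : ∫ t, Real.exp (-(l * t)) * ψ t = q) (hq1 : q < 1) :
    SFSemigroup (dysonSum T K) (c / (1 - q)) l := by
  have hT := h.expFamily_of_le hl
  have hK := h.maj.of_le h.zero hl₁
  have hS := expFamily_dysonSum hT hK hq hq1
  have hD : ∀ n t, 0 < t → ∀ f, Continuous (dyson T K n t f) := by
    intro n
    induction n with
    | zero => exact h.semigroup.strongFeller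
    | succ n ih => exact fun t _ f => continuous_conv (expFamily_dyson hT hK hq n) hK ih t f
  refine ⟨⟨hS, fun s t hs ht => h.dysonSum_add hl hl₁ hq hq1 hs ht⟩, fun t ht f => ?_,
    fun f hf x => ?_⟩
  · have : (dysonSum T K t f : E → ℂ) = fun x => ∑' n, dyson T K n t f x :=
      funext fun x => (hasSum_dyson_apply hT hK hq hq1 t f x).tsum_eq.symm
    rw [this]
    exact continuous_tsum (fun n => hD n t ht f)
      (summable_dyson_bound (hq ▸ hK.integral_nonneg) hq1 _)
      fun n x => norm_dyson_apply_le hT hK hq n t f x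
  · have h1 : ∀ t, dysonSum T K t f x =
        T t f x + ∫ s, dysonSum T K (t - s) (K s f) x := fun t => by
      conv_lhs => rw [dysonSum_eq hT hK hq hq1 t]
      rw [add_apply, BMFun.add_apply, conv_apply hS hK]
    simp only [h1]
    rw [← add_zero (f x)]
    refine (h.semigroup.tendsto f hf x).add ?_
    -- For fixed `s > 0` the integrand is zero as soon as `t < s`, so the convolution term tends to
    -- 0 by dominated convergence.
    rw [← integral_zero ℝ ℂ]
    have hc : 0 ≤ c / (1 - q) := hS.c_nonneg
    refine tendsto_integral_filter_of_dominated_convergence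
      (fun s => c / (1 - q) * Real.exp |l| * (Real.exp (-(l * s)) * ψ s) * ‖f‖) ?_ ?_
      ((hK.int.const_mul _).mul_const _) ?_
    · exact Eventually.of_forall fun t =>
        ((convFamily hS hK t).integrable f x).aestronglyMeasurable
    · have hmem : Set.Ioo (0 : ℝ) 1 ∈ 𝓝[>] (0 : ℝ) := Ioo_mem_nhdsGT one_pos
      filter_upwards [hmem] with t ht
      refine Eventually.of_forall fun s => ((convFamily hS hK t).norm_le f x s).trans ?_
      have := hK.nonneg s
      gcongr
      calc l * t ≤ |l| * t := by gcongr; exacts [ht.1.le, le_abs_self l]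
        _ ≤ |l| := mul_le_of_le_one_right (abs_nonneg l) ht.2.le
    · refine Eventually.of_forall fun s => ?_
      refine tendsto_const_nhds.congr' ?_
      rcases le_or_gt s 0 with hs | hs
      · refine Eventually.of_forall fun t => ?_
        rw [hK.zero s hs]
        simp
      · have hmem : Set.Ioo (0 : ℝ) s ∈ 𝓝[>] (0 : ℝ) := Ioo_mem_nhdsGT hs
        filter_upwards [hmem] with t ht
        rw [hS.zero (t - s) (by linarith [ht.2])]
        simp

/-- The perturbed operator is the full generator of a strong Feller semigroup. -/
theorem exists_semigroup (h : Perturbation T c w K ψ l₁ C l₀) {b : BMFun E → BMFun E}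
    (hb : ∀ l : ℝ, w < l → ∀ f, b (lap T l f) = C (f + ((l₀ : ℂ) - l) • lap T l f)) :
    ∃ (S : ℝ → Op E) (c' w' : ℝ), SFSemigroup S c' w' ∧ gen S = addG (gen T) b := by
  -- Two thresholds are needed: at `l` the Dyson–Phillips series converges, and at a larger `l'` the
  -- operator `1 - lap K l'` is invertible.
  obtain ⟨l, hl, hl₁, hlt⟩ := ((eventually_ge_atTop w).and ((eventually_ge_atTop l₁).and
    ((h.maj.tendsto_integral h.zero).eventually (eventually_lt_nhds one_pos)))).exists
  obtain ⟨l', hl', hn⟩ := ((eventually_gt_atTop l).and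
    (h.eventually_norm_lap_K_le (ε := 1 / 2) (by norm_num))).exists
  have hS := h.sfSemigroup_dysonSum hl hl₁ rfl hlt
  refine ⟨dysonSum T K, _, l, hS, ?_⟩
  obtain ⟨N, hN1, hN2⟩ := exists_inverse_one_sub (C := lap K l') (by linarith)
  have hR := h.semigroup.isRes (z := (l' : ℂ)) (by simpa using hl.trans_lt hl')
  have hRes := hR.addG (b := b) (C := lap K l') (N := N)
    (fun f => by rw [hb l' (hl.trans_lt hl'), h.lap_K (hl.trans_lt hl') (hl₁.trans hl'.le)]) hN1 hN2
  have hSR := hS.isRes (z := (l' : ℂ)) (by simpa using hl')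
  -- Evaluated at `N f`, the identity `lap S (1 - lap K) = lap T` gives `lap S f = lap T (N f)`.
  have : lap (dysonSum T K) l' = lap T l' ∘L N := by
    refine ContinuousLinearMap.ext fun f => ?_
    have h1 := h.lap_dysonSum hl hl₁ rfl hlt hl'
    have h2 := DFunLike.congr_fun h1 (N f)
    rw [add_apply, ContinuousLinearMap.comp_apply, ← sub_eq_iff_eq_add, ← map_sub, hN2] at h2
    exact h2
  rw [this] at hSR
  exact hSR.ext hRes

end Perturbation

end Perturbation

/-! ### A positivity criterion through Laplace integrals -/

section Inversion

theorem exp_neg_mem_unitInterval (t : ℝ) : Real.exp (-max t 0) ∈ unitInterval :=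
  ⟨(Real.exp_pos _).le, Real.exp_le_one_iff.2 (neg_nonpos.2 (le_max_right _ _))⟩

/-- Integrals `∫ e^{-lt} φ(e^{-t}) u(t) dt` with `φ ≥ 0` are nonnegative if this is the case for
`φ(s) = s^j (1-s)^m`. -/
theorem integral_comp_exp_nonneg {u : ℝ → ℝ} {l : ℝ}
    (hint : IntegrableOn (fun t => Real.exp (-(l * t)) * u t) (Set.Ioi 0))
    (h : ∀ m j : ℕ, 0 ≤ ∫ t in Set.Ioi (0 : ℝ),
      Real.exp (-((l + j) * t)) * (1 - Real.exp (-t)) ^ m * u t)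
    (φ : C(unitInterval, ℝ)) (hφ : ∀ s, 0 ≤ φ s) :
    0 ≤ ∫ t in Set.Ioi (0 : ℝ),
      φ ⟨Real.exp (-max t 0), exp_neg_mem_unitInterval t⟩ * (Real.exp (-(l * t)) * u t) := by
  set s : ℝ → unitInterval := fun t => ⟨Real.exp (-max t 0), exp_neg_mem_unitInterval t⟩
  have hs : Continuous s := by
    refine Continuous.subtype_mk ?_ _
    fun_prop
  have hI : ∀ p : C(unitInterval, ℝ), IntegrableOn (fun t => p (s t) *
      (Real.exp (-(l * t)) * u t)) (Set.Ioi 0) := fun p =>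
    hint.bdd_mul (c := ‖p‖) (p.continuous.comp hs).measurable.aestronglyMeasurable
      (Eventually.of_forall fun t => p.norm_coe_le_norm (s t))
  have hlim : Tendsto (fun n : ℕ => ∫ t in Set.Ioi (0 : ℝ), bernsteinApproximation n φ (s t) *
      (Real.exp (-(l * t)) * u t)) atTop
      (𝓝 (∫ t in Set.Ioi (0 : ℝ), φ (s t) * (Real.exp (-(l * t)) * u t))) := by
    have hun := bernsteinApproximation_uniform φ
    obtain ⟨C, hC⟩ := hun.norm.bddAbove_range
    refine tendsto_integral_of_dominated_convergence
      (fun t => C * ‖Real.exp (-(l * t)) * u t‖) (fun n => (hI _).aestronglyMeasurable)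
      (hint.norm.const_mul C) (fun n => Eventually.of_forall fun t => ?_)
      (Eventually.of_forall fun t => Tendsto.mul_const _ ?_)
    · rw [norm_mul]
      gcongr
      exact (ContinuousMap.norm_coe_le_norm _ _).trans (hC ⟨n, rfl⟩)
    · exact ((continuous_eval_const (F := C(unitInterval, ℝ)) (s t)).tendsto φ).comp hun
  refine ge_of_tendsto hlim (Eventually.of_forall fun n => ?_)
  -- At `s = e^{-t}` the basis polynomial `s^k (1-s)^{n-k}` produces the integral in `h` with `m = n
  -- - k` and `j = k`; its coefficient is nonnegative because `φ` is.
  have e1 : ∀ t ∈ Set.Ioi (0 : ℝ), bernsteinApproximation n φ (s t) * (Real.exp (-(l * t)) * u t) =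
      ∑ k : Fin (n + 1), φ (bernstein.z k) * (n.choose k : ℝ) *
        (Real.exp (-((l + (k : ℕ)) * t)) * (1 - Real.exp (-t)) ^ (n - (k : ℕ)) * u t) := by
    intro t (ht : 0 < t)
    have hst : ((s t : unitInterval) : ℝ) = Real.exp (-t) := by
      simp only [s, max_eq_left ht.le]
    rw [bernsteinApproximation.apply, Finset.sum_mul]
    refine Finset.sum_congr rfl fun k _ => ?_
    rw [bernstein_apply, hst, smul_eq_mul, ← Real.exp_nat_mul]
    have : Real.exp (-((l + (k : ℕ)) * t)) =
        Real.exp ((k : ℕ) * -t) * Real.exp (-(l * t)) := by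
      rw [← Real.exp_add]
      ring_nf
    rw [this]
    ring
  rw [setIntegral_congr_fun measurableSet_Ioi e1, integral_finsetSum]
  · refine Finset.sum_nonneg fun k _ => ?_
    rw [integral_const_mul]
    exact mul_nonneg (mul_nonneg (hφ _) (Nat.cast_nonneg _)) (h _ _)
  · intro k _
    refine Integrable.const_mul ?_ _
    have h1 := hint.bdd_mul (c := 1)
      (f := fun t => Real.exp (-((k : ℕ) * max t 0)) * (1 - Real.exp (-max t 0)) ^ (n - (k : ℕ)))
      (Measurable.aestronglyMeasurable (by fun_prop)) (Eventually.of_forall fun t => by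
        have h0 := exp_neg_mem_unitInterval t
        rw [norm_mul, norm_pow, Real.norm_of_nonneg (Real.exp_pos _).le,
          Real.norm_of_nonneg (sub_nonneg.2 h0.2)]
        refine mul_le_one₀ (Real.exp_le_one_iff.2 ?_) (pow_nonneg (sub_nonneg.2 h0.2) _)
          (pow_le_one₀ (sub_nonneg.2 h0.2) (by linarith [h0.1]))
        have := le_max_right t 0
        have h2 : (0 : ℝ) ≤ (k : ℕ) := Nat.cast_nonneg _
        nlinarith)
    refine IntegrableOn.congr_fun h1 (fun t (ht : 0 < t) => ?_) measurableSet_Ioi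
    simp only [max_eq_left ht.le]
    have : Real.exp (-((l + (k : ℕ)) * t)) =
        Real.exp (-((k : ℕ) * t)) * Real.exp (-(l * t)) := by
      rw [← Real.exp_add]
      ring_nf
    rw [this]
    ring

/-- A right-continuous function is nonnegative if sufficiently many of its Laplace type integrals
are. -/
theorem nonneg_of_integral_nonneg {u : ℝ → ℝ} {l : ℝ}
    (hint : IntegrableOn (fun t => Real.exp (-(l * t)) * u t) (Set.Ioi 0))
    (h : ∀ m j : ℕ, 0 ≤ ∫ t in Set.Ioi (0 : ℝ),
      Real.exp (-((l + j) * t)) * (1 - Real.exp (-t)) ^ m * u t)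
    {t₀ : ℝ} (ht₀ : 0 < t₀) (hr : Tendsto u (𝓝[>] t₀) (𝓝 (u t₀))) : 0 ≤ u t₀ := by
  by_contra hneg
  rw [not_le] at hneg
  obtain ⟨b, hb, hsub⟩ := mem_nhdsGT_iff_exists_Ioo_subset.1 (hr.eventually (eventually_lt_nhds hneg))
  have hb : t₀ < b := hb
  -- A bump in the variable `s = e^{-t}` that is positive exactly for `t₀ < t < b`, an interval on
  -- which `u` is negative.
  let φ : C(unitInterval, ℝ) :=
    ⟨fun s => max 0 ((Real.exp (-t₀) - s) * (s - Real.exp (-b))), by fun_prop⟩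
  have hφ : ∀ s, 0 ≤ φ s := fun s => le_max_left _ _
  have h1 := integral_comp_exp_nonneg hint h φ hφ
  set s : ℝ → unitInterval := fun t => ⟨Real.exp (-max t 0), exp_neg_mem_unitInterval t⟩
  have hst : ∀ t : ℝ, 0 < t → φ (s t) =
      max 0 ((Real.exp (-t₀) - Real.exp (-t)) * (Real.exp (-t) - Real.exp (-b))) := by
    intro t ht
    simp only [φ, s, ContinuousMap.coe_mk, max_eq_left ht.le]
  have hI : IntegrableOn (fun t => φ (s t) * (Real.exp (-(l * t)) * u t)) (Set.Ioi 0) := by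
    refine hint.bdd_mul (c := ‖φ‖) ?_ (Eventually.of_forall fun t => φ.norm_coe_le_norm (s t))
    refine (φ.continuous.comp (Continuous.subtype_mk ?_ _)).measurable.aestronglyMeasurable
    fun_prop
  have hin : ∀ t, t ∈ Set.Ioo t₀ b → 0 < φ (s t) ∧ u t < 0 := by
    intro t ht
    refine ⟨?_, hsub ht⟩
    rw [hst t (ht₀.trans ht.1)]
    refine lt_max_of_lt_right (mul_pos ?_ ?_)
    · exact sub_pos.2 (Real.exp_lt_exp.2 (neg_lt_neg ht.1))
    · exact sub_pos.2 (Real.exp_lt_exp.2 (neg_lt_neg ht.2))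
  have hout : ∀ t, 0 < t → t ∉ Set.Ioo t₀ b → φ (s t) = 0 := by
    intro t ht htn
    rw [hst t ht, max_eq_left]
    rcases le_or_gt t t₀ with h2 | h2
    · refine mul_nonpos_of_nonpos_of_nonneg (sub_nonpos.2 (Real.exp_le_exp.2 (neg_le_neg h2)))
        (sub_nonneg.2 (Real.exp_le_exp.2 (neg_le_neg (h2.trans hb.le))))
    · have h3 : b ≤ t := not_lt.1 fun h4 => htn ⟨h2, h4⟩
      exact mul_nonpos_of_nonneg_of_nonpos (sub_nonneg.2 (Real.exp_le_exp.2 (neg_le_neg h2.le)))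
        (sub_nonpos.2 (Real.exp_le_exp.2 (neg_le_neg h3)))
  have hle : ∀ t ∈ Set.Ioi (0 : ℝ), φ (s t) * (Real.exp (-(l * t)) * u t) ≤ 0 := by
    intro t ht
    by_cases hm : t ∈ Set.Ioo t₀ b
    · exact mul_nonpos_of_nonneg_of_nonpos (hφ _)
        (mul_nonpos_of_nonneg_of_nonpos (Real.exp_pos _).le (hin t hm).2.le)
    · rw [hout t ht hm, zero_mul]
  have hpos : 0 < ∫ t in Set.Ioi (0 : ℝ), -(φ (s t) * (Real.exp (-(l * t)) * u t)) := by
    rw [setIntegral_pos_iff_support_of_nonneg_ae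
      ((ae_restrict_iff' measurableSet_Ioi).2 (Eventually.of_forall fun t ht =>
        neg_nonneg.2 (hle t ht))) hI.neg]
    refine lt_of_lt_of_le ?_ (measure_mono (s := Set.Ioo t₀ b) fun t ht => ⟨?_, ht₀.trans ht.1⟩)
    · simpa using hb
    · have := hin t ht
      exact neg_ne_zero.2 (mul_ne_zero this.1.ne' (mul_ne_zero (Real.exp_pos _).ne' this.2.ne))
  rw [integral_neg] at hpos
  linarith

/-- Iterated differences of a Laplace transform. -/
theorem integral_one_sub_exp_pow {u : ℝ → ℝ} {a : ℝ} {v : ℕ → ℝ → ℝ}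
    (hint : ∀ l, a ≤ l → IntegrableOn (fun t => Real.exp (-(l * t)) * u t) (Set.Ioi 0))
    (h0 : ∀ l, a ≤ l → ∫ t in Set.Ioi (0 : ℝ), Real.exp (-(l * t)) * u t = v 0 l)
    (hv : ∀ (m : ℕ) l, a ≤ l → v m l - v m (l + 1) = (m + 1) * v (m + 1) l) (m : ℕ) :
    ∀ l, a ≤ l → IntegrableOn
        (fun t => Real.exp (-(l * t)) * (1 - Real.exp (-t)) ^ m * u t) (Set.Ioi 0) ∧
      ∫ t in Set.Ioi (0 : ℝ), Real.exp (-(l * t)) * (1 - Real.exp (-t)) ^ m * u t =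
        m.factorial * v m l := by
  induction m with
  | zero =>
    intro l hl
    simpa using ⟨hint l hl, h0 l hl⟩
  | succ m ih =>
    intro l hl
    obtain ⟨i1, e1⟩ := ih l hl
    obtain ⟨i2, e2⟩ := ih (l + 1) (by linarith)
    -- One more factor `1 - e^{-t}` is a difference of the integrals at `l` and `l + 1`; the factors
    -- `m + 1` in `hv` accumulate to the factorial.
    have e : ∀ t : ℝ, Real.exp (-(l * t)) * (1 - Real.exp (-t)) ^ (m + 1) * u t =
        Real.exp (-(l * t)) * (1 - Real.exp (-t)) ^ m * u t -
          Real.exp (-((l + 1) * t)) * (1 - Real.exp (-t)) ^ m * u t := by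
      intro t
      have : Real.exp (-((l + 1) * t)) = Real.exp (-(l * t)) * Real.exp (-t) := by
        rw [← Real.exp_add]
        ring_nf
      rw [this]
      ring
    simp only [e]
    refine ⟨i1.sub i2, ?_⟩
    rw [integral_sub i1 i2, e1, e2, ← mul_sub, hv m l hl, Nat.factorial_succ]
    push_cast
    ring

/-- The function `v m l` stands for the value of `R(l) R(l+1) ⋯ R(l+m)`, possibly compared with its
scalar analogue. Differences of step one replace the derivatives of the Laplace transform, so the
resolvent identity alone verifies `hv`. -/
theorem nonneg_of_differences_nonneg {u : ℝ → ℝ} {a : ℝ} {v : ℕ → ℝ → ℝ}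
    (hint : ∀ l, a ≤ l → IntegrableOn (fun t => Real.exp (-(l * t)) * u t) (Set.Ioi 0))
    (h0 : ∀ l, a ≤ l → ∫ t in Set.Ioi (0 : ℝ), Real.exp (-(l * t)) * u t = v 0 l)
    (hv : ∀ (m : ℕ) l, a ≤ l → v m l - v m (l + 1) = (m + 1) * v (m + 1) l)
    (hpos : ∀ m l, a ≤ l → 0 ≤ v m l)
    {t₀ : ℝ} (ht₀ : 0 < t₀) (hr : Tendsto u (𝓝[>] t₀) (𝓝 (u t₀))) : 0 ≤ u t₀ := by
  refine nonneg_of_integral_nonneg (hint a le_rfl) (fun m j => ?_) ht₀ hr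
  have hj : a ≤ a + j := by
    have : (0 : ℝ) ≤ j := j.cast_nonneg
    linarith
  rw [(integral_one_sub_exp_pow hint h0 hv m _ hj).2]
  exact mul_nonneg (Nat.cast_nonneg _) (hpos m _ hj)

/-- The products `Q(l) Q(l+1) ⋯ Q(l+m)`. -/
def resProd {A : Type*} [Mul A] (Q : ℝ → A) : ℕ → ℝ → A
  | 0, l => Q l
  | m + 1, l => Q l * resProd Q m (l + 1)

/-- A discrete product rule: moving the shift past one factor costs one application of `hQ`, and
each application contributes one copy of the longer product. No commutativity is needed. -/
theorem resProd_sub {A : Type*} [Ring A] {Q : ℝ → A} {a : ℝ}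
    (hQ : ∀ l, a ≤ l → Q l - Q (l + 1) = Q l * Q (l + 1)) (m : ℕ) :
    ∀ l, a ≤ l → resProd Q m l - resProd Q m (l + 1) = (m + 1 : ℕ) • resProd Q (m + 1) l := by
  induction m with
  | zero =>
    intro l hl
    simpa [resProd] using hQ l hl
  | succ m ih =>
    intro l hl
    have h1 := ih (l + 1) (by linarith)
    have h2 := hQ l hl
    have h3 : resProd Q (m + 1) l - resProd Q (m + 1) (l + 1) =
        Q l * (resProd Q m (l + 1) - resProd Q m (l + 1 + 1)) +
          (Q l - Q (l + 1)) * resProd Q m (l + 1 + 1) := by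
      simp only [resProd]
      noncomm_ring
    rw [h3, h1, h2, mul_assoc, mul_smul_comm]
    exact (succ_nsmul _ _).symm

end Inversion

/-! ### From resolvent estimates to the semigroup -/

section Positive

variable {E : Type*} [MeasurableSpace E]

/-- Nonnegative functions. -/
def BNonneg (f : BMFun E) : Prop := ∀ x, 0 ≤ (f x).re ∧ (f x).im = 0

/-- Positive operators. -/
def IsPos (Q : Op E) : Prop := ∀ f, BNonneg f → BNonneg (Q f)

theorem IsPos.resProd {Q : ℝ → Op E} {a : ℝ} (hQ : ∀ l, a ≤ l → IsPos (Q l)) (m : ℕ) :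
    ∀ l, a ≤ l → IsPos (resProd Q m l) := by
  induction m with
  | zero => exact hQ
  | succ m ih => exact fun l hl f hf => hQ l hl _ (ih (l + 1) (by linarith) f hf)

/-- The products of `l⁻¹` belong to the constant semigroup 1. They are left unevaluated so that
`resProd_sub` applies to them as well. -/
theorem norm_resProd_le {Q : ℝ → Op E} {a : ℝ} (ha : 0 ≤ a) (hQ : ∀ l, a ≤ l → ‖Q l‖ ≤ l⁻¹)
    (m : ℕ) : ∀ l, a ≤ l → ‖resProd Q m l‖ ≤ resProd (fun l : ℝ => l⁻¹) m l := by
  induction m with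
  | zero => exact hQ
  | succ m ih =>
    intro l hl
    exact (ContinuousLinearMap.opNorm_comp_le _ _).trans
      (mul_le_mul (hQ l hl) (ih (l + 1) (by linarith)) (norm_nonneg _)
        (inv_nonneg.2 (ha.trans hl)))

variable [TopologicalSpace E] {S : ℝ → Op E} {c w : ℝ}

namespace SFSemigroup

/-- The strong Feller property makes `S(t₀) f` continuous, so stochastic continuity at 0 applies to
it and `S(t) f = S(t - t₀) S(t₀) f`. -/
theorem tendsto_right (h : SFSemigroup S c w) (f : BMFun E) (x : E) {t₀ : ℝ} (ht₀ : 0 < t₀) :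
    Tendsto (fun t => S t f x) (𝓝[>] t₀) (𝓝 (S t₀ f x)) := by
  have h1 := h.tendsto (S t₀ f) (h.strongFeller t₀ ht₀ f) x
  have h2 : Tendsto (fun t => t - t₀) (𝓝[>] t₀) (𝓝[>] 0) := by
    refine tendsto_nhdsWithin_iff.2 ⟨?_, ?_⟩
    · have : Tendsto (fun t => t - t₀) (𝓝 t₀) (𝓝 (t₀ - t₀)) := tendsto_id.sub_const t₀
      rw [sub_self] at this
      exact this.mono_left nhdsWithin_le_nhds
    · filter_upwards [self_mem_nhdsWithin] with t (ht : t₀ < t)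
      exact sub_pos.2 ht
  refine (h1.comp h2).congr' ?_
  filter_upwards [self_mem_nhdsWithin] with t (ht : t₀ < t)
  have := h.mul t₀ (t - t₀) ht₀ (sub_pos.2 ht)
  rw [sub_add_cancel] at this
  rw [this]
  rfl

theorem lap_sub (h : SFSemigroup S c w) {a : ℝ} (ha : w < a) (l : ℝ) (hl : a ≤ l) :
    lap S (l : ℝ) - lap S ((l + 1 : ℝ) : ℂ) = lap S l * lap S ((l + 1 : ℝ) : ℂ) := by
  have h1 := (h.isRes (z := (l : ℂ)) (by simpa using ha.trans_le hl)).identity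
    (h.isRes (z := ((l + 1 : ℝ) : ℂ)) (by
      rw [Complex.ofReal_re]
      linarith))
  have h2 : (l : ℂ) - ((l + 1 : ℝ) : ℂ) = -1 := by
    push_cast
    ring
  rw [h2, neg_smul, one_smul] at h1
  conv_lhs => rw [h1]
  rw [← sub_eq_add_neg, sub_sub_cancel]
  rfl

theorem integrable_re (h : SFSemigroup S c w) {a : ℝ} (ha : w < a) (f : BMFun E) (x : E) (l : ℝ)
    (hl : a ≤ l) : IntegrableOn (fun t => Real.exp (-(l * t)) * (S t f x).re) (Set.Ioi 0) ∧
      ∫ t in Set.Ioi (0 : ℝ), Real.exp (-(l * t)) * (S t f x).re = (lap S l f x).re := by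
  have hl' : w < ((l : ℝ) : ℂ).re := by simpa using ha.trans_le hl
  have hi := (h.integrable hl' f x).integrableOn (s := Set.Ioi 0)
  have e : ∀ t : ℝ, Real.exp (-(l * t)) * (S t f x).re =
      (Complex.exp (-((l : ℂ) * t)) * S t f x).re := fun t => by
    rw [cexp_neg_ofReal, Complex.re_ofReal_mul]
  simp only [e]
  refine ⟨hi.re, ?_⟩
  rw [h.lap_apply_Ioi hl']
  exact integral_re hi

/-- A semigroup is positive if its resolvent is positive for large `l`. -/
theorem isPos (h : SFSemigroup S c w) {a : ℝ} (hpos : ∀ l : ℝ, a ≤ l → IsPos (lap S l)) {t : ℝ}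
    (ht : 0 < t) : IsPos (S t) := by
  intro f hf x
  refine ⟨?_, h.real t f (fun x => (hf x).2) x⟩
  set b := max a (w + 1)
  have hb : w < b := (lt_add_one w).trans_le (le_max_right _ _)
  have hab : a ≤ b := le_max_left _ _
  refine nonneg_of_differences_nonneg (u := fun t => (S t f x).re) (a := b)
    (v := fun m l => (resProd (fun l : ℝ => lap S l) m l f x).re)
    (fun l hl => (h.integrable_re hb f x l hl).1) (fun l hl => (h.integrable_re hb f x l hl).2)
    (fun m l hl => ?_)
    (fun m l hl => (IsPos.resProd (fun l hl => hpos l (hab.trans hl)) m l hl f hf x).1) ht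
    ((Complex.continuous_re.tendsto _).comp (h.tendsto_right f x ht))
  have h1 := DFunLike.congr_fun (resProd_sub (Q := fun l : ℝ => lap S l) (h.lap_sub hb) m l hl) f
  have h2 := congrArg (fun g : BMFun E => (g x).re) h1
  simp only [sub_apply, BMFun.sub_apply, Complex.sub_re] at h2
  rw [h2, ← Nat.cast_smul_eq_nsmul ℂ, smul_apply, BMFun.smul_apply]
  simp

/-- A semigroup is contractive if its resolvent satisfies `‖R(l)‖ ≤ 1 / l` for large `l`. -/
theorem norm_le_one (h : SFSemigroup S c w) {a : ℝ} (hn : ∀ l : ℝ, a ≤ l → ‖lap S l‖ ≤ l⁻¹)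
    {t : ℝ} (ht : 0 < t) : ‖S t‖ ≤ 1 := by
  set b := max (max a 1) (w + 1)
  have hb : w < b := (lt_add_one w).trans_le (le_max_right _ _)
  have hab : a ≤ b := (le_max_left _ _).trans (le_max_left _ _)
  have hb1 : 1 ≤ b := (le_max_right _ _).trans (le_max_left _ _)
  -- The positivity criterion is applied to `‖f‖ - Re S(t)f(x)`, whose Laplace transform is `l⁻¹ ‖f‖
  -- - Re R(l)f(x)`.
  have key : ∀ f x, (S t f x).re ≤ ‖f‖ := by
    intro f x
    have hexp : ∀ l, b ≤ l → IntegrableOn (fun t => Real.exp (-(l * t)) * ‖f‖) (Set.Ioi 0) ∧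
        ∫ t in Set.Ioi (0 : ℝ), Real.exp (-(l * t)) * ‖f‖ = l⁻¹ * ‖f‖ := by
      intro l hl
      have hl0 : -l < 0 := by linarith
      have i1 := integrableOn_exp_mul_Ioi hl0 0
      have e1 := integral_exp_mul_Ioi hl0 0
      simp only [neg_mul] at i1 e1
      refine ⟨i1.mul_const _, ?_⟩
      rw [integral_mul_const, e1]
      simp [neg_div, div_neg]
    have := nonneg_of_differences_nonneg (u := fun t => ‖f‖ - (S t f x).re) (a := b)
      (v := fun m l => resProd (fun l : ℝ => l⁻¹) m l * ‖f‖ -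
        (resProd (fun l : ℝ => lap S l) m l f x).re)
      (fun l hl => by
        simp only [mul_sub]
        exact (hexp l hl).1.sub (h.integrable_re hb f x l hl).1)
      (fun l hl => by
        simp only [mul_sub]
        rw [integral_sub (hexp l hl).1 (h.integrable_re hb f x l hl).1, (hexp l hl).2,
          (h.integrable_re hb f x l hl).2]
        rfl)
      (fun m l hl => ?_) (fun m l hl => ?_) ht
      (((Complex.continuous_re.tendsto _).comp (h.tendsto_right f x ht)).const_sub _)
    · exact sub_nonneg.1 this
    · have h1 := DFunLike.congr_fun (resProd_sub (Q := fun l : ℝ => lap S l) (h.lap_sub hb) m l hl) f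
      have h2 := congrArg (fun g : BMFun E => (g x).re) h1
      have h3 := resProd_sub (Q := fun l : ℝ => l⁻¹) (a := b) (fun l hl => by
        have hl0 : l ≠ 0 := by linarith
        have hl1 : l + 1 ≠ 0 := by linarith
        field_simp
        ring) m l hl
      simp only [sub_apply, BMFun.sub_apply, Complex.sub_re] at h2
      rw [← Nat.cast_smul_eq_nsmul ℂ, smul_apply, BMFun.smul_apply] at h2
      rw [nsmul_eq_mul] at h3
      rw [← Complex.ofReal_natCast, Complex.re_ofReal_mul] at h2
      push_cast at h2 h3
      linear_combination ‖f‖ * h3 - h2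
    · refine sub_nonneg.2 ((Complex.re_le_norm _).trans ((Op.norm_apply_apply_le _ _ _).trans ?_))
      gcongr
      exact norm_resProd_le (by linarith) (fun l hl => hn l (hab.trans hl)) m l hl
  refine ContinuousLinearMap.opNorm_le_bound _ zero_le_one fun f => ?_
  rw [one_mul]
  refine BMFun.norm_le (norm_nonneg _) fun x => ?_
  rcases eq_or_ne (S t f x) 0 with h0 | h0
  · rw [h0, norm_zero]
    exact norm_nonneg _
  -- Multiplying `f` by a unimodular constant rotates the value at `x` to its modulus, so the bound
  -- on real parts bounds the modulus.
  have hz : ‖S t f x‖ ≠ 0 := norm_ne_zero_iff.2 h0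
  have h1 := key (((starRingEnd ℂ) (S t f x) / ‖S t f x‖) • f) x
  rw [map_smul, BMFun.smul_apply, norm_smul] at h1
  have h2 : (starRingEnd ℂ) (S t f x) / ‖S t f x‖ * S t f x = (‖S t f x‖ : ℂ) := by
    rw [div_mul_eq_mul_div, mul_comm, Complex.mul_conj, Complex.normSq_eq_norm_sq]
    have : (‖S t f x‖ : ℂ) ≠ 0 := by exact_mod_cast hz
    push_cast
    field_simp
  have h3 : ‖(starRingEnd ℂ) (S t f x) / (‖S t f x‖ : ℂ)‖ = 1 := by
    rw [norm_div, RCLike.norm_conj, Complex.norm_real, norm_norm, div_self hz]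
  rw [h2, h3, one_mul, Complex.ofReal_re] at h1
  exact h1

end SFSemigroup

end Positive

/-! ### Convergence of Neumann series -/

section Approximation

theorem tendsto_of_uniform_approx {a : ℕ → ℂ} {a₀ : ℂ} {b : ℕ → ℕ → ℂ} {b₀ : ℕ → ℂ} {e : ℕ → ℝ}
    (he : Tendsto e atTop (𝓝 0)) (h : ∀ k n, ‖a n - b k n‖ ≤ e k) (h₀ : ∀ k, ‖a₀ - b₀ k‖ ≤ e k)
    (hb : ∀ k, Tendsto (b k) atTop (𝓝 (b₀ k))) : Tendsto a atTop (𝓝 a₀) := by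
  rw [Metric.tendsto_atTop]
  intro ε hε
  obtain ⟨k, hk⟩ := (he.eventually (eventually_lt_nhds (by positivity : 0 < ε / 3))).exists
  obtain ⟨m, hm⟩ := Metric.tendsto_atTop.1 (hb k) (ε / 3) (by positivity)
  refine ⟨m, fun n hn => ?_⟩
  have h1 := hm n hn
  have h2 := h k n
  have h3 := h₀ k
  rw [dist_eq_norm] at h1 ⊢
  have h4 : a n - a₀ = (a n - b k n) + (b k n - b₀ k) - (a₀ - b₀ k) := by ring
  rw [h4]
  refine (norm_sub_le _ _).trans_lt ?_
  have := norm_add_le (a n - b k n) (b k n - b₀ k)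
  linarith

variable {E : Type*} [MeasurableSpace E]

/-- The iterates of `u ↦ f + C u`. -/
noncomputable def neumannIter (C : Op E) (f : BMFun E) : ℕ → BMFun E
  | 0 => 0
  | k + 1 => f + C (neumannIter C f k)

/-- Each iteration halves the error, and the starting error is `‖u‖ ≤ 2 * ‖f‖`. The estimate depends
only on `f` and the bound 1/2, hence is uniform over a family of operators. -/
theorem norm_sub_neumannIter_le {C : Op E} {f u : BMFun E} (hC : ‖C‖ ≤ 1 / 2) (hu : u - C u = f)
    (k : ℕ) : ‖u - neumannIter C f k‖ ≤ (1 / 2) ^ k * (2 * ‖f‖) := by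
  induction k with
  | zero =>
    have h1 : u = f + C u := by rw [← hu, sub_add_cancel]
    have h2 : ‖u‖ ≤ ‖f‖ + 1 / 2 * ‖u‖ := by
      conv_lhs => rw [h1]
      exact (norm_add_le _ _).trans (by grw [C.le_opNorm u, hC])
    change ‖u - 0‖ ≤ _
    rw [sub_zero]
    linarith
  | succ k ih =>
    have h1 : u - neumannIter C f (k + 1) = C (u - neumannIter C f k) := by
      rw [map_sub]
      change u - (f + C (neumannIter C f k)) = _
      rw [← hu]
      abel
    rw [h1]
    refine (C.le_opNorm _).trans ?_
    grw [hC, ih, pow_succ]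
    linarith

/-- Convergence of `(1 - Cₙ)⁻¹` to `(1 - C)⁻¹`. -/
theorem BTendsto.inverse_one_sub {C : Op E} {Cn : ℕ → Op E} {f : BMFun E} {u : BMFun E}
    {un : ℕ → BMFun E} (hC : ‖C‖ ≤ 1 / 2) (hCn : ∀ n, ‖Cn n‖ ≤ 1 / 2)
    (hconv : ∀ (h : ℕ → BMFun E) h₀, BTendsto h h₀ → ∀ x,
      Tendsto (fun n => Cn n (h n) x) atTop (𝓝 (C h₀ x)))
    (hu : u - C u = f) (hun : ∀ n, un n - Cn n (un n) = f) : BTendsto un u := by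
  refine ⟨⟨2 * ‖f‖, fun n => ?_⟩, fun x => ?_⟩
  · simpa [neumannIter] using norm_sub_neumannIter_le (hCn n) (hun n) 0
  -- A fixed iterate involves finitely many operators, so it converges by induction. The argument of
  -- `Cn n` moves with `n`, which is why `hconv` is stated for sequences.
  have hit : ∀ k, BTendsto (fun n => neumannIter (Cn n) f k) (neumannIter C f k) := by
    intro k
    induction k with
    | zero => exact ⟨⟨0, fun n => norm_zero.le⟩, fun x => tendsto_const_nhds⟩
    | succ k ih =>
      obtain ⟨K, hK⟩ := ih.1
      refine ⟨⟨‖f‖ + 1 / 2 * K, fun n => ?_⟩, fun x => ?_⟩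
      · refine (norm_add_le _ _).trans ?_
        have := (Cn n).le_opNorm (neumannIter (Cn n) f k)
        grw [this, hCn n, hK n]
      · exact (hconv _ _ ih x).const_add (f x)
  refine tendsto_of_uniform_approx (b := fun k n => neumannIter (Cn n) f k x)
    (b₀ := fun k => neumannIter C f k x) (e := fun k => (1 / 2) ^ k * (2 * ‖f‖)) ?_
    (fun k n => ?_) (fun k => ?_) fun k => (hit k).2 x
  · have := (tendsto_pow_atTop_nhds_zero_of_lt_one (r := (1 / 2 : ℝ)) (by norm_num)
      (by norm_num)).mul_const (2 * ‖f‖)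
    rwa [zero_mul] at this
  · exact (BMFun.norm_apply_le (un n - neumannIter (Cn n) f k) x).trans
      (norm_sub_neumannIter_le (hCn n) (hun n) k)
  · exact (BMFun.norm_apply_le (u - neumannIter C f k) x).trans
      (norm_sub_neumannIter_le hC hu k)

/-- The two convergence assumptions on `Bₙ R(l)` for large `l` imply joint convergence for
every `l`. -/
theorem tendsto_apply_of_eventually {R : ℝ → Op E} {P : ℝ → Op E} {Pn : ℕ → ℝ → Op E} {w : ℝ}
    (hR : ∀ l, w < l → IsBPC (R l))
    (hP : ∀ l l' : ℝ, w < l → w < l' → ∀ f, P l f = P l' (f + ((l' : ℂ) - l) • R l f))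
    (hPn : ∀ n, ∀ l l' : ℝ, w < l → w < l' → ∀ f,
      Pn n l f = Pn n l' (f + ((l' : ℂ) - l) • R l f))
    (hconv : ∀ f, ∀ᶠ l : ℝ in atTop, ∀ x, Tendsto (fun n => Pn n l f x) atTop (𝓝 (P l f x)))
    (hnull : ∀ h : ℕ → BMFun E, BTendsto h 0 → ∀ᶠ l : ℝ in atTop, ∀ x,
      Tendsto (fun n => Pn n l (h n) x) atTop (𝓝 0))
    {l : ℝ} (hl : w < l) {h : ℕ → BMFun E} {h₀ : BMFun E} (hh : BTendsto h h₀) (x : E) :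
    Tendsto (fun n => Pn n l (h n) x) atTop (𝓝 (P l h₀ x)) := by
  have hsub : BTendsto (fun n => h n - h₀) 0 := by
    obtain ⟨K, hK⟩ := hh.1
    refine ⟨⟨K + ‖h₀‖, fun n => (norm_sub_le _ _).trans (by grw [hK n])⟩, fun x => ?_⟩
    simpa using (hh.2 x).sub_const (h₀ x)
  have hRsub : BTendsto (fun n => R l (h n - h₀)) 0 := by
    have := hsub.map (hR l hl)
    rwa [map_zero] at this
  -- The threshold for `l'` depends on the function or sequence. Only four are involved, namely
  -- `h₀`, `R(l) h₀`, `h n - h₀` and `R(l)(h n - h₀)`, so one `l'` serves them all, and the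
  -- resolvent identity returns to the given `l`.
  obtain ⟨l', ⟨⟨⟨h1, h2⟩, h3⟩, h4⟩, hl'⟩ := ((((hconv h₀).and (hconv (R l h₀))).and
    (hnull _ hsub)).and (hnull _ hRsub)).and (eventually_gt_atTop w) |>.exists
  have e : ∀ n, Pn n l (h n) x = Pn n l' h₀ x + Pn n l' (h n - h₀) x +
      ((l' : ℂ) - l) * (Pn n l' (R l h₀) x + Pn n l' (R l (h n - h₀)) x) := by
    intro n
    rw [hPn n l l' hl hl']
    simp only [map_add, map_smul, map_sub, BMFun.add_apply, BMFun.sub_apply, BMFun.smul_apply]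
    ring
  have e0 : P l h₀ x = P l' h₀ x + 0 + ((l' : ℂ) - l) * (P l' (R l h₀) x + 0) := by
    rw [hP l l' hl hl']
    simp only [map_add, map_smul, BMFun.add_apply, BMFun.smul_apply]
    ring
  rw [e0]
  simp only [e]
  exact ((h1 x).add (h3 x)).add (((h2 x).add (h4 x)).const_mul _)

end Approximation

/-! ### Leftward continuation of positivity -/

section Continuation

variable {E : Type*} [MeasurableSpace E]

theorem BNonneg.of_tendsto {u : ℕ → BMFun E} {u₀ : BMFun E} (h : ∀ n, BNonneg (u n))
    (hu : ∀ x, Tendsto (fun n => u n x) atTop (𝓝 (u₀ x))) : BNonneg u₀ := fun x =>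
  ⟨ge_of_tendsto' ((Complex.continuous_re.tendsto _).comp (hu x)) fun n => (h n x).1,
    tendsto_nhds_unique ((Complex.continuous_im.tendsto _).comp (hu x))
      (tendsto_const_nhds.congr fun n => ((h n x).2).symm)⟩

theorem BNonneg.add_smul {f g : BMFun E} (hf : BNonneg f) (hg : BNonneg g) {e : ℝ} (he : 0 ≤ e) :
    BNonneg (f + (e : ℂ) • g) := fun x => by
  rw [BMFun.add_apply, BMFun.smul_apply]
  simp only [Complex.add_re, Complex.add_im, Complex.re_ofReal_mul, Complex.im_ofReal_mul]
  exact ⟨add_nonneg (hf x).1 (mul_nonneg he (hg x).1), by rw [(hf x).2, (hg x).2]; simp⟩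

/-- The resolvent is positive to the left of a point where it is positive. -/
theorem IsPos.of_identity {Q Q' : Op E} {e : ℝ} (hQ : IsPos Q) (he : 0 ≤ e) (heQ : e * ‖Q‖ ≤ 1 / 2)
    (h : ∀ f, Q' f = Q (f + (e : ℂ) • Q' f)) : IsPos Q' := by
  intro f hf
  have hC : ‖(e : ℂ) • Q‖ ≤ 1 / 2 := by
    rw [norm_smul, Complex.norm_real, Real.norm_of_nonneg he]
    exact heQ
  -- Thus `Q' f` is the limit of the Neumann iterates for `e Q` starting from `Q f`, all of which
  -- are nonnegative.
  have hu : Q' f - ((e : ℂ) • Q) (Q' f) = Q f := by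
    have h1 := h f
    rw [map_add, map_smul] at h1
    rw [smul_apply, sub_eq_iff_eq_add]
    exact h1
  have hpos : ∀ k, BNonneg (neumannIter ((e : ℂ) • Q) (Q f) k) := by
    intro k
    induction k with
    | zero => exact fun x => ⟨le_rfl, rfl⟩
    | succ k ih => exact (hQ f hf).add_smul (hQ _ ih) he
  refine BNonneg.of_tendsto hpos fun x => BMFun.tendsto_apply ?_ x
  rw [tendsto_iff_norm_sub_tendsto_zero]
  have := (tendsto_pow_atTop_nhds_zero_of_lt_one (r := (1 / 2 : ℝ)) (by norm_num)
    (by norm_num)).mul_const (2 * ‖Q f‖)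
  rw [zero_mul] at this
  refine squeeze_zero (fun k => norm_nonneg _) (fun k => ?_) this
  rw [norm_sub_rev]
  exact norm_sub_neumannIter_le hC hu k

/-- If the resolvent exists on `[l, ∞)` and is positive for large arguments, it is positive. -/
theorem IsPos.continuation {G : Set (BMFun E × BMFun E)} {Q : ℝ → Op E} {l a : ℝ}
    (hres : ∀ r, l ≤ r → IsRes G (r : ℂ) (Q r)) (hla : l ≤ a) (ha : IsPos (Q a)) : IsPos (Q l) := by
  have hloc : ∀ r₀, l ≤ r₀ → ∃ δ > 0, ∀ r r', l ≤ r' → r' ≤ r → r < r₀ + δ → r₀ - δ < r' →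
      IsPos (Q r) → IsPos (Q r') := by
    intro r₀ hr₀
    have hq := norm_nonneg (Q r₀)
    -- With this radius the resolvent norm near `r₀` is at most `2 * ‖Q r₀‖`, and a step of length
    -- at most `2δ` keeps `e * ‖Q r‖` below 1/2. The summand 1 covers `Q r₀ = 0`.
    have hδ : 0 < 1 / (8 * (‖Q r₀‖ + 1)) := by positivity
    refine ⟨_, hδ, fun r r' hr' hrr h1 h2 hpos => ?_⟩
    set δ := 1 / (8 * (‖Q r₀‖ + 1)) with hδe
    have hδN : δ * (‖Q r₀‖ + 1) = 1 / 8 := by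
      rw [hδe]
      field_simp
    have hr : l ≤ r := hr'.trans hrr
    have hn : ‖Q r‖ ≤ 2 * ‖Q r₀‖ := by
      have hid := (hres r₀ hr₀).identity (hres r hr)
      have h3 : ‖Q r‖ ≤ ‖Q r₀‖ + δ * (‖Q r₀‖ * ‖Q r‖) := by
        conv_lhs => rw [hid]
        refine (norm_add_le _ _).trans ?_
        rw [norm_smul, ← Complex.ofReal_sub, Complex.norm_real, Real.norm_eq_abs]
        have h4 : |r₀ - r| ≤ δ := abs_le.2 ⟨by linarith, by linarith⟩
        grw [h4, ContinuousLinearMap.opNorm_comp_le]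
      have h5 : δ * (‖Q r₀‖ * ‖Q r‖) ≤ 1 / 8 * ‖Q r‖ := by
        rw [← hδN, ← mul_assoc]
        have := norm_nonneg (Q r)
        gcongr
        linarith
      linarith [norm_nonneg (Q r)]
    refine hpos.of_identity (sub_nonneg.2 hrr) ?_ fun f => ?_
    · have h6 : r - r' ≤ 2 * δ := by linarith
      calc (r - r') * ‖Q r‖ ≤ 2 * δ * (2 * ‖Q r₀‖) := by
            have := norm_nonneg (Q r)
            gcongr
        _ ≤ 4 * (δ * (‖Q r₀‖ + 1)) := by nlinarith
        _ ≤ 1 / 2 := by rw [hδN]; norm_num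
    · have := (hres r hr).identity_apply (hres r' hr') f
      rwa [← Complex.ofReal_sub] at this
  -- At the infimum of `s` the local step reaches `max l (sInf s - δ / 2)`, which therefore lies in
  -- `s`. This is possible only if it equals `l`.
  set s : Set ℝ := {r | l ≤ r ∧ IsPos (Q r)} with hs
  have hsne : s.Nonempty := ⟨a, hla, ha⟩
  have hbdd : BddBelow s := ⟨l, fun r hr => hr.1⟩
  have hl : l ≤ sInf s := le_csInf hsne fun r hr => hr.1
  obtain ⟨δ, hδ, hstep⟩ := hloc (sInf s) hl
  obtain ⟨r, hr, hrδ⟩ := exists_lt_of_csInf_lt hsne (lt_add_of_pos_right (sInf s) hδ)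
  have hinf := csInf_le hbdd hr
  have hm : IsPos (Q (max l (sInf s - δ / 2))) :=
    hstep r _ (le_max_left _ _) (max_le hr.1 (by linarith)) hrδ
      (lt_max_of_lt_right (by linarith)) hr.2
  have h7 : sInf s ≤ max l (sInf s - δ / 2) := csInf_le hbdd ⟨le_max_left _ _, hm⟩
  rcases le_max_iff.1 h7 with h8 | h8
  · rwa [max_eq_left (by linarith)] at hm
  · linarith

end Continuation

/-! ### Translation between the two formulations -/

section Bridge

variable {E : Type*} [MeasurableSpace E]

open Classical in
/-- The operators `T(t)` for `t > 0`, extended by `0` to `t ≤ 0`. -/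
noncomputable def cut (T : ℝ → BB E →L[ℂ] BB E) (t : ℝ) : Op E :=
  if 0 < t then toOp (T t) else 0

theorem cut_of_pos (T : ℝ → BB E →L[ℂ] BB E) {t : ℝ} (ht : 0 < t) : cut T t = toOp (T t) :=
  if_pos ht

theorem cut_of_nonpos (T : ℝ → BB E →L[ℂ] BB E) {t : ℝ} (ht : t ≤ 0) : cut T t = 0 :=
  if_neg (not_lt.2 ht)

/-- A graph in `BB E` as a graph in `BMFun E`. -/
def toGraph (G : Set (BB E × BB E)) : Set (BMFun E × BMFun E) := G

/-- The values of a partially defined operator, extended by `0`. -/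
noncomputable def pvalFn (B : BB E →ₗ.[ℂ] BB E) (f : BMFun E) : BMFun E := toFn (pval B (ofFn f))

theorem kernelFamily_cut {K : ℝ → BB E →L[ℂ] BB E} (hk : ∀ t, 0 < t → IsKernelOp (K t))
    (hm : ∀ f : BB E, Measurable fun p : Set.Ioi (0 : ℝ) × E => K p.1 f p.2) :
    KernelFamily (cut K) where
  zero t ht := cut_of_nonpos K ht
  bpc t := by
    rcases le_or_gt t 0 with ht | ht
    · rw [cut_of_nonpos K ht]
      exact IsBPC.zero
    · rw [cut_of_pos K ht]
      exact (isKernelOp_iff.1 (hk t ht)).1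
  real t := by
    rcases le_or_gt t 0 with ht | ht
    · rw [cut_of_nonpos K ht]
      exact IsRealOp.zero
    · rw [cut_of_pos K ht]
      exact (isKernelOp_iff.1 (hk t ht)).2
  meas f := by
    classical
    -- The value 1 at nonpositive times is arbitrary; the indicator in `h2` removes it.
    let r : ℝ → Set.Ioi (0 : ℝ) := fun t => if h : 0 < t then ⟨t, h⟩ else ⟨1, Set.mem_Ioi.2 one_pos⟩
    have hr : Measurable r := by
      exact Measurable.dite (s := Set.Ioi (0 : ℝ)) measurable_id
        (g := fun _ => (⟨1, Set.mem_Ioi.2 one_pos⟩ : Set.Ioi (0 : ℝ))) measurable_const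
        measurableSet_Ioi
    have h1 := (hm (ofFn f)).comp ((hr.comp measurable_fst).prodMk (measurable_snd (α := ℝ)))
    have h2 : (fun p : ℝ × E => cut K p.1 f p.2) =
        {p : ℝ × E | 0 < p.1}.indicator fun p => K (r p.1) (ofFn f) p.2 := by
      ext p
      by_cases hp : 0 < p.1
      · rw [Set.indicator_of_mem (by exact hp), cut_of_pos K hp]
        simp only [r, dif_pos hp]
        rfl
      · rw [Set.indicator_of_notMem (by exact hp), cut_of_nonpos K (not_lt.1 hp)]
        rfl
    rw [h2]
    exact Measurable.indicator h1 (measurableSet_lt measurable_const measurable_fst)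

theorem IsKernelSemigroup.kSemigroup {T : ℝ → BB E →L[ℂ] BB E} {M ω : ℝ}
    (h : IsKernelSemigroup T M ω) : KSemigroup (cut T) M ω where
  toKernelFamily := kernelFamily_cut h.kernel h.measurable
  bound t := by
    rcases le_or_gt t 0 with ht | ht
    · rw [cut_of_nonpos T ht, norm_zero]
      have := h.pos
      positivity
    · rw [cut_of_pos T ht]
      exact h.bound t ht
  mul s t hs ht := by
    rw [cut_of_pos T ht, cut_of_pos T hs, cut_of_pos T (add_pos ht hs)]
    exact ContinuousLinearMap.ext fun f => h.mul s t hs ht (ofFn f)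

theorem toGraph_fullGenerator {T : ℝ → BB E →L[ℂ] BB E} : toGraph (fullGenerator T) = gen (cut T) := by
  ext ⟨u, g⟩
  refine forall_congr' fun t => forall_congr' fun ht => forall_congr' fun x => ?_
  have e : ∫ s in (0 : ℝ)..t, T s (ofFn g) x = ∫ s in (0 : ℝ)..t, cut T s g x := by
    rw [intervalIntegral.integral_of_le ht.le, intervalIntegral.integral_of_le ht.le]
    refine setIntegral_congr_fun measurableSet_Ioc fun s hs => ?_
    simp only [cut_of_pos T hs.1]
    rfl
  rw [← e, cut_of_pos T ht]
  rfl

theorem toFn_laplace {T : ℝ → BB E →L[ℂ] BB E} {M ω : ℝ} (h : IsKernelSemigroup T M ω) {z : ℂ}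
    (hz : ω < z.re) (f : BB E) : toFn (laplace T z f) = lap (cut T) z (toFn f) := by
  refine BMFun.ext fun x => ?_
  rw [h.kSemigroup.lap_apply_Ioi hz]
  refine (laplace_apply h hz f x).trans (setIntegral_congr_fun measurableSet_Ioi fun t ht => ?_)
  simp only [cut_of_pos T ht]
  rfl

/-- The map `(u, g) ↦ (z • u - g, u)` is a bijection, so equality of the two graphs is an
equivalence of memberships in `G`. -/
theorem isResolventAt_iff {G : Set (BB E × BB E)} {z : ℂ} {Q : BB E →L[ℂ] BB E} :
    IsResolventAt G z Q ↔ IsRes (toGraph G) z (toOp Q) := by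
  constructor
  · intro h u g
    have h1 := Set.ext_iff.1 h (z • ofFn u - ofFn g, ofFn u)
    refine Iff.trans ⟨fun hG => ⟨ofFn u, ofFn g, hG, rfl⟩, ?_⟩ h1
    rintro ⟨u', g', hG, he⟩
    obtain ⟨e1, rfl⟩ := Prod.mk.inj he
    have e2 : ofFn g = g' := sub_right_injective e1
    rw [← e2] at hG
    exact hG
  · intro h
    refine Set.ext fun p => ⟨?_, fun hp => ?_⟩
    · rintro ⟨u, g, hG, rfl⟩
      exact (h (toFn u) (toFn g)).1 hG
    · have hp : toFn p.2 = toOp Q (toFn p.1) := hp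
      have h1 := h.mem (toFn p.1)
      rw [← hp] at h1
      refine ⟨p.2, z • p.2 - p.1, h1, ?_⟩
      rw [sub_sub_cancel]

/-- Because the domain of `G` lies in that of `B`, the sum lives on the former, and the default
value 0 of `pval` is never met there. -/
theorem toGraph_addOp {G : Set (BB E × BB E)} {B : BB E →ₗ.[ℂ] BB E}
    (h : ∀ u ∈ mdomain G, u ∈ B.domain) : toGraph (addOp G B) = addG (toGraph G) (pvalFn B) := by
  ext p
  constructor
  · rintro ⟨u, g, hG, rfl⟩
    refine ⟨toFn u, toFn g, hG, ?_⟩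
    have : pval B u = B u := dif_pos u.2
    rw [pvalFn, show ofFn (toFn (u : BB E)) = u from rfl, this]
    rfl
  · rintro ⟨u, g, hG, rfl⟩
    have hu : ofFn u ∈ B.domain := h _ ⟨_, hG⟩
    refine ⟨⟨ofFn u, hu⟩, ofFn g, hG, ?_⟩
    rw [pvalFn, pval, dif_pos hu]
    rfl

theorem isPositiveOp_iff {Q : BB E →L[ℂ] BB E} : IsPositiveOp Q ↔ IsPos (toOp Q) := Iff.rfl

variable [TopologicalSpace E]

theorem IsCbSemigroup.sfSemigroup {T : ℝ → BB E →L[ℂ] BB E} {M ω : ℝ} (h : IsCbSemigroup T M ω)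
    (hs : ∀ t, 0 < t → IsStrongFeller (T t)) : SFSemigroup (cut T) M ω where
  toKSemigroup := h.toIsKernelSemigroup.kSemigroup
  strongFeller t ht f := by
    rw [cut_of_pos T ht]
    exact hs t ht (ofFn f)
  tendsto f hf x := by
    refine ((h.continuous (ofFn f) hf).apply x).congr' ?_
    filter_upwards [self_mem_nhdsWithin] with t ht
    rw [cut_of_pos T ht]
    rfl

/-- Invariance of continuous functions is part of the strong Feller property, and weak convergence
at 0 follows from pointwise convergence and the bound near 0. The constant becomes `max c 1` because
a type requires `M > 0`. -/
theorem SFSemigroup.generates {S : ℝ → Op E} {c w : ℝ} (h : SFSemigroup S c w)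
    {G : Set (BB E × BB E)} (hG : gen S = toGraph G) :
    GeneratesCbStrongFeller G fun t => ofOp (S t) := by
  have hb : ∀ t : ℝ, ‖S t‖ ≤ max c 1 * Real.exp (w * t) := fun t =>
    (h.bound t).trans (by gcongr; exact le_max_left _ _)
  refine ⟨⟨max c 1, w, ⟨⟨fun t _ => ?_, fun s t hs ht f => ?_, by positivity, fun t _ => hb t,
    fun f => ?_⟩, fun t ht f _ => h.strongFeller t ht (toFn f), fun f hf => ?_⟩⟩,
    fun t ht f => h.strongFeller t ht (toFn f), hG⟩
  · exact isKernelOp_iff.2 ⟨h.bpc t, h.real t⟩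
  · exact DFunLike.congr_fun (h.mul s t hs ht) (toFn f)
  · exact (h.meas (toFn f)).comp (measurable_subtype_coe.prodMap measurable_id)
  · refine tendsto_sintegral (F := fun t => S t (toFn f)) (g := toFn f)
      (C := max c 1 * Real.exp |w| * ‖toFn f‖) ?_ (h.tendsto (toFn f) hf)
    filter_upwards [Ioo_mem_nhdsGT one_pos] with t ht
    refine (ContinuousLinearMap.le_opNorm _ _).trans ?_
    gcongr
    refine (hb t).trans ?_
    gcongr
    calc w * t ≤ |w| * t := by gcongr; exacts [ht.1.le, le_abs_self w]
      _ ≤ |w| := mul_le_of_le_one_right (abs_nonneg w) ht.2.le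

/-- Assembly of the data of an admissible perturbation. -/
theorem PerturbationHyp.exists_perturbation [HasOuterApproxClosed E] [BorelSpace E]
    {T : ℝ → BB E →L[ℂ] BB E} {M ω : ℝ} {B : BB E →ₗ.[ℂ] BB E} (h : PerturbationHyp T M ω B) :
    ∃ (K : ℝ → Op E) (ψ : ℝ → ℝ) (l₁ : ℝ) (C : Op E) (l₀ : ℝ),
      Perturbation (cut T) M ω K ψ l₁ C l₀ ∧ ∀ l : ℝ, ω < l → ∀ f,
        pvalFn B (lap (cut T) l f) = C (f + ((l₀ : ℂ) - l) • lap (cut T) l f) := by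
  have hT := h.semigroup.sfSemigroup h.strongFeller
  obtain ⟨l₀, hl₀, Q, hQ, hQB⟩ := h.resolvent
  obtain ⟨K, hK, hKB, hKm, φ, δ, hδ, hφ, hKφ⟩ := h.extension
  have hl₀' : ω < ((l₀ : ℝ) : ℂ).re := by simpa using hl₀
  have hC : ∀ f, pvalFn B (lap (cut T) l₀ f) = toOp Q f := fun f => by
    rw [← show toFn (ofFn f) = f from rfl, ← toFn_laplace h.semigroup.toIsKernelSemigroup hl₀']
    exact (hQB (ofFn f)).symm
  have hKf := kernelFamily_cut hK hKm
  -- The range of `R(l₀)` lies in the domain of the generator, so `K(t) R(l₀) f = B T(t) R(l₀) f = B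
  -- R(l₀) T(t) f`.
  have hcomp : ∀ t, 0 < t → cut K t ∘L lap (cut T) l₀ = toOp Q ∘L cut T t := by
    intro t ht
    refine ContinuousLinearMap.ext fun f => ?_
    rw [ContinuousLinearMap.comp_apply, ContinuousLinearMap.comp_apply, ← hC,
      ← ContinuousLinearMap.comp_apply (lap (cut T) l₀), ← hT.comp_lap_comm hl₀,
      ContinuousLinearMap.comp_apply, cut_of_pos K ht, cut_of_pos T ht]
    have hmem := (hT.isRes hl₀').mem f
    rw [← toGraph_fullGenerator] at hmem
    exact hKB t ht _ ⟨_, hmem⟩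
  have hδ2 : 0 < δ / 2 := half_pos hδ
  -- The bound `φ` is integrable only near 0. From `δ` on, `K(t) = K(δ/2) T(t - δ/2)` gives the
  -- exponential bound `κ e^{ωt}` instead.
  set κ := ‖cut K (δ / 2)‖ * (M * Real.exp (-(ω * (δ / 2))))
  have hM := h.semigroup.pos
  have hκ : 0 ≤ κ := by positivity
  let ψ : ℝ → ℝ := fun t => (Set.Ioo 0 δ).indicator φ t +
    (Set.Ici δ).indicator (fun t => κ * Real.exp (ω * t)) t
  have hψ0 : ∀ t ≤ 0, ψ t = 0 := fun t ht => by
    simp only [ψ]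
    rw [Set.indicator_of_notMem (fun h : t ∈ Set.Ioo 0 δ => h.1.not_ge ht),
      Set.indicator_of_notMem (fun h : t ∈ Set.Ici δ => (hδ.trans_le (Set.mem_Ici.1 h)).not_ge ht), add_zero]
  have hbound : ∀ t, ‖cut K t‖ ≤ ψ t := by
    intro t
    rcases le_or_gt t 0 with ht | ht
    · rw [hψ0 t ht, hKf.zero t ht, norm_zero]
    rcases lt_or_ge t δ with htδ | htδ
    · simp only [ψ]
      rw [Set.indicator_of_mem (by exact ⟨ht, htδ⟩),
        Set.indicator_of_notMem (fun h : t ∈ Set.Ici δ => htδ.not_ge h), add_zero, cut_of_pos K ht]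
      exact hKφ t ht
    · simp only [ψ]
      rw [Set.indicator_of_notMem (fun h : t ∈ Set.Ioo 0 δ => h.2.not_ge htδ), Set.indicator_of_mem (by exact htδ),
        zero_add]
      have h1 := hT.comp_add hKf hl₀ hcomp (s := t - δ / 2) (t := δ / 2) (by linarith) hδ2
      rw [add_sub_cancel] at h1
      rw [h1]
      refine (ContinuousLinearMap.opNorm_comp_le _ _).trans ?_
      grw [hT.bound (t - δ / 2)]
      refine le_of_eq ?_
      simp only [κ]
      have : Real.exp (ω * (t - δ / 2)) = Real.exp (-(ω * (δ / 2))) * Real.exp (ω * t) := by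
        rw [← Real.exp_add]
        ring_nf
      rw [this]
      ring
  -- The weight `ω + 1` leaves `κ e^{-t}` on the tail and is bounded on `(0, δ)`.
  have hint : Integrable fun t => Real.exp (-((ω + 1) * t)) * ψ t := by
    have i1 : Integrable fun t => (Set.Ioo 0 δ).indicator
        (fun t => Real.exp (-((ω + 1) * t)) * φ t) t := by
      rw [integrable_indicator_iff measurableSet_Ioo]
      refine hφ.bdd_mul (c := Real.exp (|ω + 1| * δ))
        (Measurable.aestronglyMeasurable (by fun_prop))
        ((ae_restrict_iff' measurableSet_Ioo).2 (Eventually.of_forall fun t ht => ?_))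
      rw [Real.norm_of_nonneg (Real.exp_pos _).le]
      refine Real.exp_le_exp.2 ?_
      calc -((ω + 1) * t) = -(ω + 1) * t := by ring
        _ ≤ |ω + 1| * δ := mul_le_mul (neg_le_abs _) ht.2.le ht.1.le (abs_nonneg _)
    have i2 : Integrable fun t => (Set.Ici δ).indicator (fun t => κ * Real.exp (-1 * t)) t := by
      rw [integrable_indicator_iff measurableSet_Ici, integrableOn_Ici_iff_integrableOn_Ioi]
      exact (integrableOn_exp_mul_Ioi (by norm_num) δ).const_mul κ
    refine (i1.add i2).congr (Eventually.of_forall fun t => ?_)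
    simp only [Pi.add_apply, ψ, mul_add]
    congr 1
    · by_cases ht : t ∈ Set.Ioo 0 δ
      · rw [Set.indicator_of_mem ht, Set.indicator_of_mem ht]
      · rw [Set.indicator_of_notMem ht, Set.indicator_of_notMem ht, mul_zero]
    · by_cases ht : t ∈ Set.Ici δ
      · rw [Set.indicator_of_mem ht, Set.indicator_of_mem ht, mul_left_comm, ← Real.exp_add]
        ring_nf
      · rw [Set.indicator_of_notMem ht, Set.indicator_of_notMem ht, mul_zero]
  refine ⟨cut K, ψ, ω + 1, toOp Q, l₀, ⟨hT, ⟨hKf, hbound, hint⟩, hψ0, hl₀,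
    (isKernelOp_iff.1 hQ).1, (isKernelOp_iff.1 hQ).2, hcomp⟩, fun l hl f => ?_⟩
  rw [(hT.isRes hl₀').identity_apply (hT.isRes (z := (l : ℂ)) (by simpa using hl)) f, hC,
    ← (hT.isRes hl₀').identity_apply (hT.isRes (z := (l : ℂ)) (by simpa using hl)) f]

end Bridge

/-! ### Convergence of the perturbed resolvents -/

section Convergence

variable {E : Type*} [MeasurableSpace E] [TopologicalSpace E]

/-- Convergence of the resolvents of the perturbed operators. -/
theorem SFSemigroup.eventually_bTendsto_resolvent {T : ℝ → Op E} {c w : ℝ}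
    (hT : SFSemigroup T c w) {b : BMFun E → BMFun E} {bn : ℕ → BMFun E → BMFun E}
    {P : ℝ → Op E} {Pn : ℕ → ℝ → Op E}
    (hP : ∀ l : ℝ, w < l → ∀ f, b (lap T l f) = P l f)
    (hPn : ∀ n, ∀ l : ℝ, w < l → ∀ f, bn n (lap T l f) = Pn n l f)
    (hs : ∀ᶠ l : ℝ in atTop, ‖P l‖ ≤ 1 / 2) (hsn : ∀ᶠ l : ℝ in atTop, ∀ n, ‖Pn n l‖ ≤ 1 / 2)
    (hconv : ∀ f, ∀ᶠ l : ℝ in atTop, ∀ x, Tendsto (fun n => Pn n l f x) atTop (𝓝 (P l f x)))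
    (hnull : ∀ h : ℕ → BMFun E, BTendsto h 0 → ∀ᶠ l : ℝ in atTop, ∀ x,
      Tendsto (fun n => Pn n l (h n) x) atTop (𝓝 0)) :
    ∀ᶠ l : ℝ in atTop, ∀ (Q : Op E) (Qn : ℕ → Op E), IsRes (addG (gen T) b) l Q →
      (∀ n, IsRes (addG (gen T) (bn n)) l (Qn n)) → ∀ f, BTendsto (fun n => Qn n f) (Q f) := by
  have hR : ∀ l : ℝ, w < l → IsRes (gen T) l (lap T l) := fun l hl => hT.isRes (by simpa using hl)
  have hbpc : ∀ l : ℝ, w < l → IsBPC (lap T l) := fun l hl => hT.isBPC_lap (by simpa using hl)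
  -- The operators `b R(l)` at different `l` are linked by the resolvent identity of the unperturbed
  -- generator.
  have hid : ∀ (b : BMFun E → BMFun E) (P : ℝ → Op E),
      (∀ l : ℝ, w < l → ∀ f, b (lap T l f) = P l f) → ∀ l l' : ℝ, w < l → w < l' → ∀ f,
        P l f = P l' (f + ((l' : ℂ) - l) • lap T l f) := fun b P hP l l' hl hl' f => by
    rw [← hP l hl, (hR l' hl').identity_apply (hR l hl) f, hP l' hl',
      ← (hR l' hl').identity_apply (hR l hl) f]
  filter_upwards [hs, hsn, eventually_gt_atTop w] with l h1 h2 hl Q Qn hQ hQn f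
  obtain ⟨N, hN1, hN2⟩ := exists_inverse_one_sub (C := P l) (by linarith)
  choose Nn hNn1 hNn2 using fun n => exists_inverse_one_sub (C := Pn n l) (by linarith [h2 n])
  have e := hQ.unique ((hR l hl).addG (hP l hl) hN1 hN2)
  have en : ∀ n, Qn n = lap T l ∘L Nn n := fun n =>
    (hQn n).unique ((hR l hl).addG (hPn n l hl) (hNn1 n) (hNn2 n))
  simp only [e, en]
  exact (BTendsto.inverse_one_sub h1 h2 (fun h h₀ hh x => tendsto_apply_of_eventually
    (R := fun l => lap T l) hbpc (hid b P hP) (fun n => hid (bn n) (Pn n) (hPn n)) hconv hnull hl hh x)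
    (hN2 f) fun n => hNn2 n f).map (hbpc l hl)

end Convergence

theorem corollary5p4 {E : Type*} [TopologicalSpace E] [PolishSpace E] [LocallyCompactSpace E]
    [MeasurableSpace E] [BorelSpace E]
    (T : ℝ → BB E →L[ℂ] BB E) (M ω : ℝ)
    (B : BB E →ₗ.[ℂ] BB E) (Bn : ℕ → BB E →ₗ.[ℂ] BB E)
    (hB : PerturbationHyp T M ω B) (hBn : ∀ n, PerturbationHyp T M ω (Bn n))
    (h_small : ∀ ε : ℝ, 0 < ε → ∀ᶠ l : ℝ in atTop, ∀ (n : ℕ) (f : BB E),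
      ‖pval (Bn n) (laplace T l f)‖ ≤ ε * ‖f‖)
    (h_conv : ∀ h : BB E, ∀ᶠ l : ℝ in atTop,
      SigmaTendsto (fun n => pval (Bn n) (laplace T l h)) atTop (pval B (laplace T l h)))
    (h_null : ∀ h : ℕ → BB E, SigmaTendsto h atTop 0 → ∀ᶠ l : ℝ in atTop,
      SigmaTendsto (fun n => pval (Bn n) (laplace T l (h n))) atTop 0) :
    -- the perturbed semigroup exists
    (∃ S : ℝ → BB E →L[ℂ] BB E, GeneratesCbStrongFeller (addOp (fullGenerator T) B) S) ∧
    -- contractivity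
    ((∀ (n : ℕ) (z : ℂ), 0 < z.re → ∃ Q : BB E →L[ℂ] BB E,
        IsResolventAt (addOp (fullGenerator T) (Bn n)) z Q ∧ ‖Q‖ ≤ (z.re)⁻¹) →
      (∀ z : ℂ, 0 < z.re → ∃ Q : BB E →L[ℂ] BB E,
        IsResolventAt (addOp (fullGenerator T) B) z Q ∧ ‖Q‖ ≤ (z.re)⁻¹) ∧
      ∀ S : ℝ → BB E →L[ℂ] BB E, GeneratesCbStrongFeller (addOp (fullGenerator T) B) S →
        IsContractionSemigroup S) ∧
    -- positivity
    (∀ l₀ : ℝ,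
      (∀ (n : ℕ) (l : ℝ), l₀ ≤ l → ∃ Q : BB E →L[ℂ] BB E,
        IsResolventAt (addOp (fullGenerator T) (Bn n)) l Q ∧ IsPositiveOp Q) →
      (∃ l₁ : ℝ, ∀ l : ℝ, l₁ ≤ l → (l : ℂ) ∈ mresolventSet (addOp (fullGenerator T) B)) ∧
      (∀ l : ℝ, l₀ ≤ l →
        (∀ r : ℝ, l ≤ r → (r : ℂ) ∈ mresolventSet (addOp (fullGenerator T) B)) →
        ∃ Q : BB E →L[ℂ] BB E,
          IsResolventAt (addOp (fullGenerator T) B) l Q ∧ IsPositiveOp Q) ∧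
      ∀ S : ℝ → BB E →L[ℂ] BB E, GeneratesCbStrongFeller (addOp (fullGenerator T) B) S →
        ∀ t, 0 < t → IsPositiveOp (S t)) := by
  have hT := hB.semigroup.sfSemigroup hB.strongFeller
  have hTk := hB.semigroup.toIsKernelSemigroup
  obtain ⟨K, ψ, l₁, C, l₀, hK, hC⟩ := hB.exists_perturbation
  choose Kn ψn l₁n Cn l₀n hKn hCn using fun n => (hBn n).exists_perturbation
  have hG : toGraph (addOp (fullGenerator T) B) = addG (gen (cut T)) (pvalFn B) := by
    rw [toGraph_addOp hB.domain_le, toGraph_fullGenerator]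
  have hGn : ∀ n, toGraph (addOp (fullGenerator T) (Bn n)) =
      addG (gen (cut T)) (pvalFn (Bn n)) := fun n => by
    rw [toGraph_addOp (hBn n).domain_le, toGraph_fullGenerator]
  have hlap : ∀ l : ℝ, ω < l → ∀ f, lap (cut T) l f = toFn (laplace T l (ofFn f)) := fun l hl f =>
    (toFn_laplace hTk (by simpa using hl) (ofFn f)).symm
  have hconv : ∀ᶠ l : ℝ in atTop, ∀ (Q : Op E) (Qn : ℕ → Op E),
      IsRes (toGraph (addOp (fullGenerator T) B)) l Q →
      (∀ n, IsRes (toGraph (addOp (fullGenerator T) (Bn n))) l (Qn n)) →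
      ∀ f, BTendsto (fun n => Qn n f) (Q f) := by
    simp only [hG, hGn]
    -- This is `B R(l)` as a bounded operator for every `l > ω`, although the hypotheses provide it
    -- at one point only.
    set P : ℝ → Op E := fun l => C + ((l₀ : ℂ) - l) • (C ∘L lap (cut T) l)
    set Pn : ℕ → ℝ → Op E := fun n l =>
      Cn n + ((l₀n n : ℂ) - l) • (Cn n ∘L lap (cut T) l)
    have hP : ∀ l : ℝ, ω < l → ∀ f, pvalFn B (lap (cut T) l f) = P l f := fun l hl f => by
      rw [hC l hl, map_add, map_smul]
      rfl
    have hPn : ∀ n, ∀ l : ℝ, ω < l → ∀ f, pvalFn (Bn n) (lap (cut T) l f) = Pn n l f :=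
      fun n l hl f => by
        rw [hCn n l hl, map_add, map_smul]
        rfl
    refine hT.eventually_bTendsto_resolvent hP hPn ?_ ?_ (fun f => ?_) (fun h hh => ?_)
    -- Smallness of `B R(l)` comes from the majorant of `B T(t)`; `h_small` concerns only the
    -- approximating operators.
    · filter_upwards [hK.eventually_norm_lap_K_le (ε := 1 / 2) (by norm_num),
        eventually_gt_atTop ω, eventually_ge_atTop l₁] with l h1 h2 h3
      have : P l = lap K l := ContinuousLinearMap.ext fun f => by
        rw [← hP l h2, hC l h2, hK.lap_K h2 h3]
      rwa [this]
    · filter_upwards [h_small (1 / 2) (by norm_num), eventually_gt_atTop ω] with l h1 h2 n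
      refine ContinuousLinearMap.opNorm_le_bound _ (by norm_num) fun f => ?_
      rw [← hPn n l h2, hlap l h2]
      exact h1 n (ofFn f)
    · filter_upwards [h_conv (ofFn f), eventually_gt_atTop ω] with l h1 h2 x
      simp only [← hP l h2, ← hPn _ l h2, hlap l h2]
      exact h1.apply x
    · filter_upwards [h_null (fun n => ofFn (h n)) hh.sigmaTendsto,
        eventually_gt_atTop ω] with l h1 h2 x
      simp only [← hPn _ l h2, hlap l h2]
      exact h1.apply x
  obtain ⟨S₀, c₀, w₀, hS₀, hgen₀⟩ := hK.exists_semigroup hC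
  rw [← hG] at hgen₀
  have hS : ∀ S, GeneratesCbStrongFeller (addOp (fullGenerator T) B) S →
      ∃ c w : ℝ, SFSemigroup (cut S) c w ∧ IsCbSemigroup S c w ∧
        gen (cut S) = toGraph (addOp (fullGenerator T) B) := by
    rintro S ⟨⟨c, w, hS⟩, hsf, hgen⟩
    exact ⟨c, w, hS.sfSemigroup hsf, hS, by rw [← toGraph_fullGenerator, hgen]⟩
  refine ⟨⟨_, hS₀.generates hgen₀⟩, fun hcon => ?_, fun a hpos => ⟨⟨w₀ + 1, fun l hl => ?_⟩, ?_⟩⟩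
  -- Stated for any semigroup with this generator, so that it applies both to the constructed `S₀`
  -- and to an arbitrary `S`. Only the resolvent bounds at large real `l` enter.
  · have hcontr : ∀ (S : ℝ → Op E) (c w : ℝ), SFSemigroup S c w →
        gen S = toGraph (addOp (fullGenerator T) B) → ∀ t, 0 < t → ‖S t‖ ≤ 1 := by
      intro S c w hS hgen t ht
      obtain ⟨a, ha⟩ := eventually_atTop.1 (hconv.and ((eventually_gt_atTop 0).and
        (eventually_gt_atTop w)))
      refine hS.norm_le_one (a := a) (fun l hl => ?_) ht
      obtain ⟨h1, h2, h3⟩ := ha l hl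
      choose Qn hQn hQn' using fun n => hcon n (l : ℂ) (by simpa using h2)
      have h4 := h1 (lap S l) (fun n => toOp (Qn n))
        (hgen ▸ hS.isRes (by simpa using h3)) fun n => isResolventAt_iff.1 (hQn n)
      have h5 : 0 ≤ l⁻¹ := (inv_pos.2 h2).le
      refine ContinuousLinearMap.opNorm_le_bound _ h5 fun f =>
        BMFun.norm_le (mul_nonneg h5 (norm_nonneg f)) fun x => ?_
      refine le_of_tendsto ((h4 f).2 x).norm (Eventually.of_forall fun n => ?_)
      refine (Op.norm_apply_apply_le _ _ _).trans ?_
      gcongr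
      exact (hQn' n).trans_eq (by simp)
    refine ⟨fun z hz => ?_, fun S hS' => ?_⟩
    -- Now that `S₀` is contractive, its Laplace transform exists on the whole right half-plane and
    -- gives both the resolvent and its bound.
    · have hS₁ : KSemigroup S₀ 1 0 := ⟨⟨hS₀.toKernelFamily, fun t => by
        rw [zero_mul, Real.exp_zero, mul_one]
        rcases le_or_gt t 0 with ht | ht
        · rw [hS₀.zero t ht, norm_zero]
          exact zero_le_one
        · exact hcontr S₀ c₀ w₀ hS₀ hgen₀ t ht⟩, hS₀.mul⟩
      refine ⟨ofOp (lap S₀ z), isResolventAt_iff.2 (hgen₀ ▸ hS₁.isRes hz), ?_⟩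
      refine (hS₁.norm_lap_le hz).trans_eq ?_
      rw [sub_zero, one_div]
    · obtain ⟨c, w, h1, h2, h3⟩ := hS S hS'
      refine ⟨h2.kernel, h2.mul, one_pos, fun t ht => ?_, h2.measurable⟩
      rw [zero_mul, Real.exp_zero, mul_one]
      have := hcontr _ c w h1 h3 t ht
      rwa [cut_of_pos S ht] at this
  · exact ⟨ofOp (lap S₀ l), isResolventAt_iff.2 (hgen₀ ▸ hS₀.isRes (by
      rw [Complex.ofReal_re]
      linarith))⟩
  -- Positivity first holds for large `l`, as a pointwise limit of positive resolvents; it is then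
  -- continued leftwards to `l`, and transferred to `S` by inversion.
  · have hev : ∀ᶠ l : ℝ in atTop, ∀ Q : Op E,
        IsRes (toGraph (addOp (fullGenerator T) B)) l Q → IsPos Q := by
      filter_upwards [hconv, eventually_ge_atTop a] with l h1 h2 Q hQ f hf
      choose Qn hQn hQn' using fun n => hpos n l h2
      exact BNonneg.of_tendsto (fun n => isPositiveOp_iff.1 (hQn' n) f hf)
        (h1 Q (fun n => toOp (Qn n)) hQ (fun n => isResolventAt_iff.1 (hQn n)) f).2
    refine ⟨fun l hl hr => ?_, fun S hS' t ht => ?_⟩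
    · choose! Q hQ using hr
      have hQ' : ∀ r, l ≤ r → IsRes (toGraph (addOp (fullGenerator T) B)) (r : ℂ) (toOp (Q r)) :=
        fun r hr => isResolventAt_iff.1 (hQ r hr)
      obtain ⟨b, hb, hlb⟩ := (hev.and (eventually_ge_atTop l)).exists
      exact ⟨Q l, hQ l le_rfl, isPositiveOp_iff.2
        (IsPos.continuation (Q := fun r => toOp (Q r)) hQ' hlb (hb _ (hQ' b hlb)))⟩
    · obtain ⟨c, w, h1, h2, h3⟩ := hS S hS'
      obtain ⟨b, hb⟩ := eventually_atTop.1 (hev.and (eventually_gt_atTop w))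
      have := h1.isPos (a := b) (fun l hl => (hb l hl).1 _
        (h3 ▸ h1.isRes (by simpa using (hb l hl).2))) ht
      rw [cut_of_pos S ht] at this
      exact isPositiveOp_iff.2 this
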